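/- \textbf{Setting.} All vector spaces are complex. $\widehat{\mathfrak{sl}_2}$ is the Lie algebra with basis $\mathsf J^{\pm}_n,\mathsf J^0_n$ ($n\in\mathbb Z$), $\mathsf K$, with $\mathsf K$ central and $$[\mathsf J^0_n,\mathsf J^\pm_m]=\pm \mathsf J^\pm_{n+m},\quad [\mathsf J^+_n,\mathsf J^-_m]=2\mathsf J^0_{n+m}+n\delta_{n+m,0}\mathsf K,\quad [\mathsf J^0_n,\mathsf J^0_m]=\tfrac n2\delta_{n+m,0}\mathsf K,$$ other brackets of basis elements being zero. The Verma module $\mathcal V^{k,j}$ is $U\widehat{\mathfrak{sl}_2}$ modulo the left ideal generated by $\mathsf J_0^+$, $\mathsf J^a_n$ ($n\ge 1$, $a\in\{+,0,-\}$), $\mathsf K-k$, $\mathsf J^0_0-j$, and $\mathcal H^{k,j}$ is the quotient of $\mathcal V^{k,j}$ by the sum of its proper submodules. For $\epsilon\in\{0,\frac12\}$ let $f_\epsilon\in\mathcal H^{1,\epsilon}$ be the image of $1$ and let $K^a_n$ be the operators by which $\mathsf J^a_n$ acts on $\mathcal H^{1,\epsilon}$; $K^a(z)=\sum_n K^a_n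 z^{-n-1}$. For fields $A(z)=\sum_n A_{(n)}z^{-n-1}$, $B(z)=\sum_n B_{(n)}z^{-n-1}$ (on each vector, $A_{(n)}$ and $B_{(n)}$ vanish for $n\gg0$) the normally ordered product is $:\!AB\!:_{(n)}=\sum_{m<0}A_{(m)}B_{(n-m-1)}+\sum_{m\ge0}B_{(n-m-1)}A_{(m)}$. The Sugawara field of currents $J^a(z)=\sum_n J^a_n z^{-n-1}$ at level $k\neq-2$ is $$T^J=\tfrac1{k+2}\left(:\!J^0J^0\!:+\tfrac12:\!J^+J^-\!:+\tfrac12:\!J^-J^+\!:\right).$$ Let $\kappa,j\in\mathbb C$ with $\kappa\ne0$, put $k=\kappa^2-2$ and assume $k\neq-3$. Let $\mathfrak w$ be the Lie algebra with basis $a_n,\beta_n,\gamma_n$ ($n\in\mathbb Z$), $I$, with $I$ central, $[\gamma_m,\beta_n]=\delta_{m+n,0}I$, $[a_m,a_n]=\frac m2\delta_{m+n,0}I$ and other brackets of basis elements zero. Let $\mathcal W^{\kappa,j}$ be $U\mathfrak w$ modulo the left ideal generated by $a_0-\kappa^{-1}j$, $I-1$ and $\beta_n,\gamma_{n+1},a_{n+1}$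 ($n\ge0$), and $\widetilde{\mathcal W}^{\kappa,j}$ be $U\mathfrak w$ modulo the left ideal generated by $a_0+\kappa^{-1}(j+1)$, $I-1$ and $\beta_{n+1},\gamma_n,a_{n+1}$ ($n\ge0$); let $w_{\kappa,j}$, $\widetilde w_{\kappa,j}$ be the images of $1$. With $\partial\phi(z)=\sum a_nz^{-n-1}$, $\beta(z)=\sum\beta_nz^{-n-1}$, $\gamma(z)=\sum\gamma_nz^{-n}$, define the level $k$ currents $$J^+=\beta,\quad J^0=:\!\gamma\beta\!:+\kappa\,\partial\phi,\quad J^-=-:\!\gamma^2\beta\!:-2\kappa\gamma\,\partial\phi-k\,\partial\gamma\quad\text{on }\mathcal W^{\kappa,j},$$ $$\widetilde J^+=:\!\gamma^2\beta\!:+2\kappa\gamma\,\partial\phi+k\,\partial\gamma,\quad \widetilde J^0=-:\!\gamma\beta\!:-\kappa\,\partial\phi,\quad \widetilde J^-=-\beta\quad\text{on }\widetilde{\mathcal W}^{\kappa,j},$$ where $:\!\gamma^2\beta\!:\,=\,:\!\gamma(:\!\gamma\beta\!:)\!:$. On $\mathcal W^{\kappa,j}\otimes\mathcal H^{1,\epsilon}$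 put $\mathcal J^a=J^a+K^a$ (level $k+1$ currents) and on $\widetilde{\mathcal W}^{\kappa,j}\otimes\mathcal H^{1,\epsilon}$ put $\mathcal J^a=\widetilde J^a+K^a$; on both, with $J$ replaced by $\widetilde J$ on the second, let $T^{\mathsf{Vir}}=T^J+T^K-T^{\mathcal J}=\sum_nL_n^{\mathsf{Vir}}z^{-n-2}$, with Sugawara fields at levels $k$, $1$, $k+1$ respectively. Let $$\rho=\gamma^2K^+-2\gamma K^0-K^--\partial\gamma,\qquad \widetilde\rho=\gamma^2K^--2\gamma K^0-K^++\partial\gamma$$ on $\mathcal W^{\kappa,j}\otimes\mathcal H^{1,\epsilon}$ and $\widetilde{\mathcal W}^{\kappa,j}\otimes\mathcal H^{1,\epsilon}$ respectively, with modes $\rho(z)=\sum_n\rho_nz^{-n-1}$, $\widetilde\rho(z)=\sum_n\widetilde\rho_nz^{-n-1}$. Put $w^0_{\kappa,j,\epsilon}=w_{\kappa,j}\otimes f_\epsilon$, $\widetilde w^0_{\kappa,j,\epsilon}=\widetilde w_{\kappa,j}\otimes f_\epsilon$ and, for $n\ge1$, $$w^n_{\kappa,j,0}=\rho_{-2n+1}\cdots\rho_{-3}\rho_{-1}w^0_{\kappa,j,0},\qquad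 w^n_{\kappa,j,\frac12}=(-1)^n\rho_{-2n+2}\cdots\rho_{-2}\rho_0w^0_{\kappa,j,\frac12},$$ $$\widetilde w^n_{\kappa,j,0}=\widetilde\rho_{-2n+1}\cdots\widetilde\rho_{-3}\widetilde\rho_{-1}\widetilde w^0_{\kappa,j,0},\qquad \widetilde w^n_{\kappa,j,\frac12}=(-1)^n\widetilde\rho_{-2n}\cdots\widetilde\rho_{-4}\widetilde\rho_{-2}\widetilde w^0_{\kappa,j,\frac12}.$$ For $n\in\mathbb Z$ let $$\Delta^n_{k,j,\epsilon}=\frac{j(j+1)}{k+2}-\frac{(j+\epsilon+n)(j+\epsilon+n+1)}{k+3}+(n+\epsilon)^2 .$$ \textbf{Proposition.} For all $\kappa,j\in\mathbb C$ with $\kappa\neq0$ and $k=\kappa^2-2\ne-3$, all $\epsilon\in\{0,\frac12\}$ and all integers $n\ge0$, the vectors $w^n_{\kappa,j,\epsilon}$ and $\widetilde w^n_{\kappa,j,\epsilon}$ are nonzero and are annihilated by $\mathcal J^a_m$ and $L^{\mathsf{Vir}}_m$ for all $m>0$ and $a\in\{+,0,-\}$, and by $\mathcal J^+_0$. Moreover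 $$\mathcal J^0_0w^n_{\kappa,j,\epsilon}=(j+\epsilon-n)\,w^n_{\kappa,j,\epsilon},\qquad L_0^{\mathsf{Vir}}w^n_{\kappa,j,\epsilon}=\Delta^{-n}_{k,j,\epsilon}\,w^n_{\kappa,j,\epsilon},$$ $$\mathcal J^0_0\widetilde w^n_{\kappa,j,\epsilon}=(j+\epsilon+n)\,\widetilde w^n_{\kappa,j,\epsilon},\qquad L_0^{\mathsf{Vir}}\widetilde w^n_{\kappa,j,\epsilon}=\Delta^{n}_{k,j,\epsilon}\,\widetilde w^n_{\kappa,j,\epsilon}.$$ -/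

import Mathlib

open scoped TensorProduct

noncomputable section

namespace AffineCoset

attribute [local instance 100] LieRing.ofAssociativeRing

/-! ### Fields, normally ordered products and the Sugawara construction -/

/-- A field `A(z) = ∑ₙ A₍ₙ₎ z⁻ⁿ⁻¹` on a complex vector space `V`: an operator-valued formal series
such that for every `v` the series `A(z) v` has finitely many negative powers of `z`.
`A.mode n` is the coefficient of `z⁻ⁿ⁻¹`. -/
@[ext]
structure QField (V : Type*) [AddCommGroup V] [Module ℂ V] where
  mode : ℤ → Module.End ℂ V
  trunc : ∀ v : V, ∃ N : ℤ, ∀ n : ℤ, N ≤ n → mode n v = 0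

namespace QField

variable {V : Type*} [AddCommGroup V] [Module ℂ V]

instance : Add (QField V) where
  add A B :=
    { mode := fun n => A.mode n + B.mode n
      trunc := fun v => by
        obtain ⟨N, hN⟩ := A.trunc v
        obtain ⟨M, hM⟩ := B.trunc v
        exact ⟨max N M, fun n hn => by
          simp [hN n (le_trans (le_max_left _ _) hn), hM n (le_trans (le_max_right _ _) hn)]⟩ }

instance : SMul ℂ (QField V) where
  smul c A :=
    { mode := fun n => c • A.mode n
      trunc := fun v => by
        obtain ⟨N, hN⟩ := A.trunc v
        exact ⟨N, fun n hn => by simp [hN n hn]⟩ }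

instance : Neg (QField V) where
  neg A := (-1 : ℂ) • A

instance : Sub (QField V) where
  sub A B := A + -B

/-- The derivative `∂A(z)`. -/
def deriv (A : QField V) : QField V where
  mode n := (-(n : ℂ)) • A.mode (n - 1)
  trunc v := by
    obtain ⟨N, hN⟩ := A.trunc v
    exact ⟨N + 1, fun n hn => by simp [hN (n - 1) (by omega)]⟩

theorem finite_creation (A B : QField V) (n : ℤ) (v : V) :
    (Function.support fun m : ℕ =>
      A.mode (-(m : ℤ) - 1) (B.mode (n + m) v)).Finite := by
  obtain ⟨N, hN⟩ := B.trunc v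
  refine (Set.finite_Iio (N - n).toNat).subset fun m hm => ?_
  by_contra h
  simp only [Set.mem_Iio, not_lt] at h
  exact hm (by simp [hN (n + m) (by omega)])

theorem finite_annihilation (A B : QField V) (n : ℤ) (v : V) :
    (Function.support fun m : ℕ => B.mode (n - m - 1) (A.mode (m : ℤ) v)).Finite := by
  obtain ⟨N, hN⟩ := A.trunc v
  refine (Set.finite_Iio N.toNat).subset fun m hm => ?_
  by_contra h
  simp only [Set.mem_Iio, not_lt] at h
  exact hm (by simp [hN m (by omega)])

/-- The normally ordered product `:A(z)B(z):`, i.e. the term of order `(z - w)⁰` in the operator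
product expansion of `A(z)B(w)`. In modes,
`:AB:₍ₙ₎ = ∑_{m < 0} A₍ₘ₎ B₍ₙ₋ₘ₋₁₎ + ∑_{m ≥ 0} B₍ₙ₋ₘ₋₁₎ A₍ₘ₎`
(the first sum is written here with `-m-1` in place of `m`, so both sums are over `m : ℕ`).
Both sums are finite on every vector. -/
def nprod (A B : QField V) : QField V where
  mode n :=
    { toFun := fun v =>
        (∑ᶠ m : ℕ, A.mode (-(m : ℤ) - 1) (B.mode (n + m) v)) +
          ∑ᶠ m : ℕ, B.mode (n - m - 1) (A.mode (m : ℤ) v)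
      map_add' := fun v w => by
        simp only [map_add]
        rw [finsum_add_distrib (finite_creation A B n v) (finite_creation A B n w),
          finsum_add_distrib (finite_annihilation A B n v) (finite_annihilation A B n w)]
        abel
      map_smul' := fun c v => by
        simp only [map_smul, RingHom.id_apply, smul_add]
        rw [smul_finsum' c (finite_creation A B n v),
          smul_finsum' c (finite_annihilation A B n v)] }
  trunc v := by
    obtain ⟨N, hN⟩ := B.trunc v
    obtain ⟨M, hM⟩ := A.trunc v
    choose f hf using fun m : ℕ => B.trunc (A.mode (m : ℤ) v)
    obtain ⟨K, hK⟩ : ∃ K : ℤ, ∀ m ∈ Finset.range M.toNat, f m + m + 1 ≤ K := by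
      obtain ⟨K, hK⟩ := ((Finset.range M.toNat).image fun m => f m + (m : ℤ) + 1).bddAbove
      exact ⟨K, fun m hm => hK (Finset.mem_coe.2 (Finset.mem_image_of_mem _ hm))⟩
    refine ⟨max N K, fun n hn => ?_⟩
    have h1 : N ≤ n := le_trans (le_max_left _ _) hn
    have h2 : K ≤ n := le_trans (le_max_right _ _) hn
    simp only [LinearMap.coe_mk, AddHom.coe_mk]
    rw [finsum_eq_zero_of_forall_eq_zero, finsum_eq_zero_of_forall_eq_zero, add_zero]
    · intro m
      by_cases hm : m < M.toNat
      · have := hK m (Finset.mem_range.2 hm)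
        exact hf m _ (by omega)
      · rw [hM m (by omega), map_zero]
    · intro m
      rw [hN (n + m) (by omega), map_zero]

/-- The field `A(z) ⊗ 1` on `V ⊗ H`. -/
def onLeft (H : Type*) [AddCommGroup H] [Module ℂ H] (A : QField V) : QField (V ⊗[ℂ] H) where
  mode n := LinearMap.rTensor H (A.mode n)
  trunc t := by
    induction t using TensorProduct.induction_on with
    | zero => exact ⟨0, fun n _ => map_zero _⟩
    | tmul v h =>
      obtain ⟨N, hN⟩ := A.trunc v
      exact ⟨N, fun n hn => by simp [hN n hn]⟩
    | add x y hx hy =>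
      obtain ⟨N, hN⟩ := hx
      obtain ⟨M, hM⟩ := hy
      exact ⟨max N M, fun n hn => by
        rw [map_add, hN n (le_trans (le_max_left _ _) hn),
          hM n (le_trans (le_max_right _ _) hn), add_zero]⟩

/-- The field `1 ⊗ A(z)` on `H ⊗ V`. -/
def onRight (H : Type*) [AddCommGroup H] [Module ℂ H] (A : QField V) : QField (H ⊗[ℂ] V) where
  mode n := LinearMap.lTensor H (A.mode n)
  trunc t := by
    induction t using TensorProduct.induction_on with
    | zero => exact ⟨0, fun n _ => map_zero _⟩
    | tmul h v =>
      obtain ⟨N, hN⟩ := A.trunc v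
      exact ⟨N, fun n hn => by simp [hN n hn]⟩
    | add x y hx hy =>
      obtain ⟨N, hN⟩ := hx
      obtain ⟨M, hM⟩ := hy
      exact ⟨max N M, fun n hn => by
        rw [map_add, hN n (le_trans (le_max_left _ _) hn),
          hM n (le_trans (le_max_right _ _) hn), add_zero]⟩

end QField

/-- Labels `+, 0, -` of the `sl₂` currents. -/
inductive SlIdx
  | plus
  | zero
  | minus

/-- A triple of currents `J⁺(z), J⁰(z), J⁻(z)` on `V`; the operator `Jᵃₙ` is `(J a).mode n`. -/
abbrev Currents (V : Type*) [AddCommGroup V] [Module ℂ V] : Type _ := SlIdx → QField V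

/-- The Sugawara field at level `k`,
`T(z) = (k+2)⁻¹ (:J⁰J⁰: + ½ :J⁺J⁻: + ½ :J⁻J⁺:)`. -/
def sugawara {V : Type*} [AddCommGroup V] [Module ℂ V] (k : ℂ) (J : Currents V) : QField V :=
  (k + 2)⁻¹ • (QField.nprod (J .zero) (J .zero)
    + (1 / 2 : ℂ) • QField.nprod (J .plus) (J .minus)
    + (1 / 2 : ℂ) • QField.nprod (J .minus) (J .plus))

/-! ### Enveloping algebras and cyclic modules -/

section Enveloping

variable {L : Type*} [LieRing L] [LieAlgebra ℂ L]
variable {M : Type*} [AddCommGroup M] [Module ℂ M] [Module (UniversalEnvelopingAlgebra ℂ L) M]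
  [IsScalarTower ℂ (UniversalEnvelopingAlgebra ℂ L) M]

/-- The operator by which an element of the Lie algebra `L` acts on a `U(L)`-module. -/
def act (M : Type*) [AddCommGroup M] [Module ℂ M] [Module (UniversalEnvelopingAlgebra ℂ L) M]
    [IsScalarTower ℂ (UniversalEnvelopingAlgebra ℂ L) M] (x : L) : Module.End ℂ M :=
  Algebra.lsmul ℂ ℂ M (UniversalEnvelopingAlgebra.ι ℂ x)

theorem act_add (x y : L) : act M (x + y) = act M x + act M y := by
  simp [act]

theorem act_smul (c : ℂ) (x : L) : act M (c • x) = c • act M x := by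
  simp [act]

theorem act_zero_apply (m : M) : act M (0 : L) m = 0 := by
  simp [act]

theorem act_act (x y : L) (m : M) :
    act M x (act M y m) = act M y (act M x m) + act M ⁅x, y⁆ m := by
  simp only [act, Algebra.lsmul_coe, LieHom.map_lie, Ring.lie_def, sub_smul, mul_smul]
  abel

/-- A subspace stable under `L` is stable under `U(L)`. -/
theorem smul_mem_of_stable (S : Submodule ℂ M) (hS : ∀ (x : L), ∀ m ∈ S, act M x m ∈ S)
    (u : UniversalEnvelopingAlgebra ℂ L) {m : M} (hm : m ∈ S) : u • m ∈ S := by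
  let A : Subalgebra ℂ (UniversalEnvelopingAlgebra ℂ L) :=
    { carrier := {u | ∀ m ∈ S, u • m ∈ S}
      mul_mem' := fun {a b} ha hb m hm => by rw [mul_smul]; exact ha _ (hb _ hm)
      add_mem' := fun {a b} ha hb m hm => by rw [add_smul]; exact S.add_mem (ha _ hm) (hb _ hm)
      algebraMap_mem' := fun c m hm => by
        rw [algebraMap_smul]; exact S.smul_mem c hm }
  let f : L →ₗ⁅ℂ⁆ A :=
    { toFun := fun x => ⟨UniversalEnvelopingAlgebra.ι ℂ x, fun m hm => hS x m hm⟩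
      map_add' := fun x y => Subtype.ext (by simp)
      map_smul' := fun c x => Subtype.ext (by simp)
      map_lie' := fun {x y} => Subtype.ext (by
        change UniversalEnvelopingAlgebra.ι ℂ ⁅x, y⁆ = _
        rw [LieHom.map_lie]; rfl) }
  have h : A.val.comp (UniversalEnvelopingAlgebra.lift ℂ f) =
      AlgHom.id ℂ (UniversalEnvelopingAlgebra ℂ L) := by
    ext x
    change A.val (UniversalEnvelopingAlgebra.lift ℂ f (UniversalEnvelopingAlgebra.ι ℂ x)) = _
    rw [UniversalEnvelopingAlgebra.lift_ι_apply]
    rfl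
  have h2 : (UniversalEnvelopingAlgebra.lift ℂ f u).1 = u := DFunLike.congr_fun h u
  have h3 := (UniversalEnvelopingAlgebra.lift ℂ f u).2 m hm
  rwa [h2] at h3

/-- In a cyclic quotient of `U(L)`, a property that cuts out an `L`-stable subspace containing the
image of `1` holds everywhere. -/
theorem cyclic_induction (I : Ideal (UniversalEnvelopingAlgebra ℂ L))
    (S : Submodule ℂ (UniversalEnvelopingAlgebra ℂ L ⧸ I))
    (h1 : (Submodule.Quotient.mk 1 : UniversalEnvelopingAlgebra ℂ L ⧸ I) ∈ S)
    (hS : ∀ (x : L), ∀ m ∈ S, act (UniversalEnvelopingAlgebra ℂ L ⧸ I) x m ∈ S)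
    (v : UniversalEnvelopingAlgebra ℂ L ⧸ I) : v ∈ S := by
  obtain ⟨u, rfl⟩ := Submodule.Quotient.mk_surjective I v
  have := smul_mem_of_stable S hS u h1
  rwa [← Submodule.Quotient.mk_smul, smul_eq_mul, mul_one] at this

theorem act_mk_one (I : Ideal (UniversalEnvelopingAlgebra ℂ L)) (x : L)
    (hx : UniversalEnvelopingAlgebra.ι ℂ x ∈ I) :
    act (UniversalEnvelopingAlgebra ℂ L ⧸ I) x (Submodule.Quotient.mk 1) = 0 := by
  simp only [act, Algebra.lsmul_coe]
  rw [← Submodule.Quotient.mk_smul, smul_eq_mul, mul_one]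
  exact (Submodule.Quotient.mk_eq_zero I).2 hx

end Enveloping

/-! ### The affine Lie algebra, Verma modules and irreducible highest weight modules -/

/-- The Lie algebra `sl₂` of traceless complex `2 × 2` matrices. -/
abbrev Sl2 : Type := LieAlgebra.SpecialLinear.sl (Fin 2) ℂ

/-- The trace form `(x, y) ↦ tr (x y)` on `sl₂`. -/
def sl2Form : LinearMap.BilinForm ℂ Sl2 :=
  LinearMap.mk₂ ℂ (fun x y => Matrix.trace (x.1 * y.1))
    (fun x y z => by simp [add_mul]) (fun c x y => by simp)
    (fun x y z => by simp [mul_add]) (fun c x y => by simp)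

theorem sl2Form_symm : (-sl2Form).IsSymm :=
  ⟨fun x y => by simp [sl2Form, Matrix.trace_mul_comm x.1 y.1]⟩

theorem sl2Form_inv : (-sl2Form).lieInvariant Sl2 := by
  intro x y z
  simp only [sl2Form, LinearMap.neg_apply, LinearMap.mk₂_apply, LieSubalgebra.coe_bracket,
    Ring.lie_def, sub_mul, mul_sub, Matrix.trace_sub, neg_sub]
  rw [Matrix.trace_mul_cycle x.1 y.1 z.1, Matrix.mul_assoc y.1 x.1 z.1,
    Matrix.trace_mul_comm y.1 (x.1 * z.1), Matrix.mul_assoc x.1 z.1 y.1,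
    Matrix.mul_assoc z.1 x.1 y.1, Matrix.trace_mul_comm z.1 (x.1 * y.1),
    Matrix.mul_assoc x.1 y.1 z.1, Matrix.trace_mul_comm x.1 (z.1 * y.1),
    Matrix.trace_mul_comm x.1 (y.1 * z.1), Matrix.mul_assoc z.1 y.1 x.1,
    Matrix.mul_assoc y.1 z.1 x.1]

/-- The 2-cocycle `(x tⁿ, y tᵐ) ↦ n δ_{n+m,0} tr (x y)` on the loop algebra of `sl₂`. (Mathlib's
residue pairing gives `m Φ(x, y) δ_{n+m,0}`, whence the sign of the form.) -/
abbrev affineCocycle :=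
  LieAlgebra.LoopAlgebra.twoCocycleOfBilinear ℂ ℤ Sl2 (-sl2Form) sl2Form_inv sl2Form_symm

/-- The affine Lie algebra: the central extension of the loop algebra of `sl₂`. -/
abbrev AffineSl2 : Type := LieAlgebra.ofTwoCocycle affineCocycle

/-- `J⁺ = e`, `J⁰ = h / 2`, `J⁻ = f` in `sl₂`. -/
def slElt : SlIdx → Sl2
  | .plus => ⟨!![0, 1; 0, 0], by simp [LieAlgebra.SpecialLinear.sl, Matrix.trace_fin_two]⟩
  | .zero => ⟨!![1 / 2, 0; 0, -1 / 2], by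
      simp [LieAlgebra.SpecialLinear.sl, Matrix.trace_fin_two]; norm_num⟩
  | .minus => ⟨!![0, 0; 1, 0], by simp [LieAlgebra.SpecialLinear.sl, Matrix.trace_fin_two]⟩

/-- The element `x tⁿ` of the affine Lie algebra. -/
def loopElt (x : Sl2) (n : ℤ) : AffineSl2 :=
  LieAlgebra.ofProd affineCocycle (AddMonoidAlgebra.single n 1 ⊗ₜ[ℂ] x, 0)

/-- The basis element `Jᵃₙ = Jᵃ tⁿ`. -/
def Jelt (a : SlIdx) (n : ℤ) : AffineSl2 := loopElt (slElt a) n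

/-- The central element `c K`. -/
def centralElt (c : ℂ) : AffineSl2 :=
  LieAlgebra.ofProd affineCocycle (0, (TrivialLieModule.equiv ℂ _ ℂ).symm c)

/-- The central basis element `K`. -/
def Kelt : AffineSl2 := centralElt 1

theorem loopElt_lie (x y : Sl2) (n m : ℤ) :
    ⁅loopElt x n, loopElt y m⁆ =
      loopElt ⁅x, y⁆ (n + m) + centralElt (if n + m = 0 then n * sl2Form x y else 0) := by
  rw [LieAlgebra.bracket_ofTwoCocycle]
  simp only [loopElt, centralElt, ← LieAlgebra.of_add]
  refine congrArg _ (Prod.ext ?_ ?_)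
  · change ⁅(AddMonoidAlgebra.single n (1 : ℂ) ⊗ₜ[ℂ] x : LieAlgebra.loopAlgebra ℂ ℤ Sl2),
      (AddMonoidAlgebra.single m (1 : ℂ) ⊗ₜ[ℂ] y : LieAlgebra.loopAlgebra ℂ ℤ Sl2)⁆ =
      AddMonoidAlgebra.single (n + m) (1 : ℂ) ⊗ₜ[ℂ] ⁅x, y⁆ + 0
    rw [LieAlgebra.ExtendScalars.bracket_tmul, AddMonoidAlgebra.single_mul_single, one_mul,
      add_zero]
  · change (TrivialLieModule.equiv ℂ (LieAlgebra.loopAlgebra ℂ ℤ Sl2) ℂ).symm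
        (LieAlgebra.LoopAlgebra.residuePairing ℂ ℤ Sl2 (-sl2Form)
          (AddMonoidAlgebra.single n (1 : ℂ) ⊗ₜ[ℂ] x)
          (AddMonoidAlgebra.single m (1 : ℂ) ⊗ₜ[ℂ] y)) +
        ⁅(AddMonoidAlgebra.single n (1 : ℂ) ⊗ₜ[ℂ] x : LieAlgebra.loopAlgebra ℂ ℤ Sl2),
          (0 : TrivialLieModule ℂ (LieAlgebra.loopAlgebra ℂ ℤ Sl2) ℂ)⁆ -
        ⁅(AddMonoidAlgebra.single m (1 : ℂ) ⊗ₜ[ℂ] y : LieAlgebra.loopAlgebra ℂ ℤ Sl2),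
          (0 : TrivialLieModule ℂ (LieAlgebra.loopAlgebra ℂ ℤ Sl2) ℂ)⁆ =
      0 + (TrivialLieModule.equiv ℂ (LieAlgebra.loopAlgebra ℂ ℤ Sl2) ℂ).symm
        (if n + m = 0 then (n : ℂ) * sl2Form x y else 0)
    rw [lie_zero, lie_zero, sub_zero, add_zero, zero_add]
    congr 1
    rw [LieAlgebra.LoopAlgebra.residuePairing_apply_apply]
    simp only [LieAlgebra.LoopAlgebra.toFinsupp_single_tmul]
    rw [Finsupp.sum_single_index (by simp)]
    by_cases h : n + m = 0
    · have hn : n = -m := by omega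
      subst hn
      simp
    · rw [if_neg h, Finsupp.single_eq_of_ne (by omega)]
      simp

theorem lie_centralElt (c : ℂ) (y : AffineSl2) : ⁅y, centralElt c⁆ = 0 := by
  rw [LieAlgebra.bracket_ofTwoCocycle]
  have h (u : LieAlgebra.loopAlgebra ℂ ℤ Sl2)
      (v : TrivialLieModule ℂ (LieAlgebra.loopAlgebra ℂ ℤ Sl2) ℂ) : ⁅u, v⁆ = 0 :=
    trivial_lie_zero _ _ _ _
  simp [centralElt, h]
  rfl

theorem loopElt_add (x y : Sl2) (n : ℤ) : loopElt (x + y) n = loopElt x n + loopElt y n := by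
  simp [loopElt, TensorProduct.tmul_add, ← LieAlgebra.of_add]

theorem loopElt_smul (c : ℂ) (x : Sl2) (n : ℤ) : loopElt (c • x) n = c • loopElt x n := by
  simp [loopElt, ← LieAlgebra.of_smul]

theorem affine_induction {P : AffineSl2 → Prop} (hadd : ∀ x y, P x → P y → P (x + y))
    (hloop : ∀ x n, P (loopElt x n)) (hcent : ∀ c, P (centralElt c)) (y : AffineSl2) : P y := by
  obtain ⟨⟨l, c⟩⟩ := y
  have h1 : P (LieAlgebra.ofProd affineCocycle (l, 0)) := by
    induction l using TensorProduct.induction_on with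
    | zero =>
      have h := hcent 0
      rw [centralElt, map_zero] at h
      exact h
    | tmul p x =>
      induction p using AddMonoidAlgebra.induction_linear with
      | zero =>
        have h := hcent 0
        rw [centralElt, map_zero] at h
        rw [TensorProduct.zero_tmul]
        exact h
      | add p q hp hq =>
        have h := hadd _ _ hp hq
        rw [← LieAlgebra.of_add, Prod.mk_add_mk, add_zero, ← TensorProduct.add_tmul] at h
        exact h
      | single n r =>
        have h := hloop (r • x) n
        rw [loopElt, ← TensorProduct.smul_tmul, AddMonoidAlgebra.smul_single, smul_eq_mul,
          mul_one] at h
        exact h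
    | add a b ha hb =>
      have h := hadd _ _ ha hb
      rw [← LieAlgebra.of_add, Prod.mk_add_mk, add_zero] at h
      exact h
  have h2 := hadd _ _ h1 (hcent (TrivialLieModule.equiv ℂ _ ℂ c))
  rw [centralElt, LinearEquiv.symm_apply_apply, ← LieAlgebra.of_add, Prod.mk_add_mk, add_zero,
    zero_add] at h2
  exact h2

theorem slElt_span (x : Sl2) :
    x = (x.1 0 1) • slElt .plus + (2 * x.1 0 0) • slElt .zero + (x.1 1 0) • slElt .minus := by
  have hx : x.1 0 0 + x.1 1 1 = 0 := by
    simpa [LieAlgebra.SpecialLinear.sl, Matrix.trace_fin_two] using x.2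
  have hx' : x.1 1 1 = -x.1 0 0 := by linear_combination hx
  apply Subtype.ext
  ext i j
  fin_cases i <;> fin_cases j <;> simp [slElt, hx'] <;> ring

/-- The universal enveloping algebra of the affine Lie algebra. -/
abbrev UAffine : Type := UniversalEnvelopingAlgebra ℂ AffineSl2

/-- The left ideal generated by `J⁺₀`, all `Jᵃₙ` with `n ≥ 1`, `K - k` and `J⁰₀ - j`. -/
def vermaIdeal (k j : ℂ) : Ideal UAffine :=
  Ideal.span
    ({UniversalEnvelopingAlgebra.ι ℂ (Jelt .plus 0)}
      ∪ {u | ∃ (a : SlIdx) (n : ℤ), 1 ≤ n ∧ u = UniversalEnvelopingAlgebra.ι ℂ (Jelt a n)}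
      ∪ {UniversalEnvelopingAlgebra.ι ℂ Kelt - algebraMap ℂ UAffine k,
          UniversalEnvelopingAlgebra.ι ℂ (Jelt .zero 0) - algebraMap ℂ UAffine j})

/-- The Verma module of highest weight `(k, j)`. -/
abbrev Verma (k j : ℂ) : Type := UAffine ⧸ vermaIdeal k j

/-- The sum of all proper submodules of the Verma module. -/
def vermaRad (k j : ℂ) : Submodule UAffine (Verma k j) := sSup {N | N ≠ ⊤}

/-- The irreducible highest weight module of highest weight `(k, j)`. -/
abbrev IrrHW (k j : ℂ) : Type := Verma k j ⧸ vermaRad k j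

/-- The highest weight vector of the irreducible module: the image of `1`. -/
def irrVec (k j : ℂ) : IrrHW k j := Submodule.Quotient.mk (Submodule.Quotient.mk 1)

theorem verma_trunc (k j : ℂ) (v : Verma k j) :
    ∃ N : ℤ, ∀ n : ℤ, N ≤ n → ∀ x : Sl2, act (Verma k j) (loopElt x n) v = 0 := by
  let S : Submodule ℂ (Verma k j) :=
    { carrier := {v | ∃ N : ℤ, ∀ n : ℤ, N ≤ n → ∀ x : Sl2, act (Verma k j) (loopElt x n) v = 0}
      zero_mem' := ⟨0, fun n _ x => map_zero _⟩
      add_mem' := by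
        rintro a b ⟨N, hN⟩ ⟨M, hM⟩
        exact ⟨max N M, fun n hn x => by
          rw [map_add, hN n (le_trans (le_max_left _ _) hn),
            hM n (le_trans (le_max_right _ _) hn), add_zero]⟩
      smul_mem' := by
        rintro c a ⟨N, hN⟩
        exact ⟨N, fun n hn x => by rw [map_smul, hN n hn, smul_zero]⟩ }
  refine cyclic_induction (vermaIdeal k j) S ⟨1, fun n hn x => ?_⟩ (fun y m hm => ?_) v
  · have h (a : SlIdx) : act (Verma k j) (Jelt a n) (Submodule.Quotient.mk 1) = 0 :=
      act_mk_one _ _ (Ideal.subset_span (Or.inl (Or.inr ⟨a, n, hn, rfl⟩)))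
    rw [slElt_span x]
    simp only [loopElt_add, loopElt_smul, act_add, act_smul, LinearMap.add_apply,
      LinearMap.smul_apply]
    change _ • act (Verma k j) (Jelt .plus n) _ + _ • act (Verma k j) (Jelt .zero n) _ +
      _ • act (Verma k j) (Jelt .minus n) _ = 0
    rw [h, h, h, smul_zero, smul_zero, smul_zero, add_zero, add_zero]
  · induction y using affine_induction with
    | hadd x y hx hy => rw [act_add, LinearMap.add_apply]; exact S.add_mem hx hy
    | hloop z p =>
      obtain ⟨N, hN⟩ := hm
      refine ⟨max N (max (N - p) (1 - p)), fun n hn x => ?_⟩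
      have h1 : N ≤ n := le_trans (le_max_left _ _) hn
      have h2 : N - p ≤ n := le_trans (le_trans (le_max_left _ _) (le_max_right _ _)) hn
      have h3 : 1 - p ≤ n := le_trans (le_trans (le_max_right _ _) (le_max_right _ _)) hn
      rw [act_act, hN n h1, map_zero, zero_add, loopElt_lie, if_neg (by omega), act_add,
        LinearMap.add_apply, hN (n + p) (by omega), zero_add, centralElt, map_zero]
      exact act_zero_apply _
    | hcent c =>
      obtain ⟨N, hN⟩ := hm
      refine ⟨N, fun n hn x => ?_⟩
      rw [act_act, hN n hn, map_zero, zero_add, lie_centralElt, act_zero_apply]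

/-- The currents `Jᵃ(z)` acting on the irreducible highest weight module of weight `(k, j)`. -/
def irrCurrents (k j : ℂ) : Currents (IrrHW k j) := fun a =>
  { mode := fun n => act (IrrHW k j) (Jelt a n)
    trunc := fun v => by
      obtain ⟨w, rfl⟩ := Submodule.Quotient.mk_surjective _ v
      obtain ⟨N, hN⟩ := verma_trunc k j w
      refine ⟨N, fun n hn => ?_⟩
      have h := congrArg (Submodule.Quotient.mk (p := vermaRad k j)) (hN n hn (slElt a))
      rw [Submodule.Quotient.mk_zero] at h
      exact h }

/-! ### Free fields and Wakimoto Fock modules -/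

/-- Labels of the oscillators `aₙ, βₙ, γₙ`, `n ∈ ℤ`. -/
inductive Osc
  | a (n : ℤ)
  | β (n : ℤ)
  | γ (n : ℤ)

/-- `[γₘ, βₙ] = δ_{m+n,0}`, `[βₘ, γₙ] = -δ_{m+n,0}`, `[aₘ, aₙ] = (m/2) δ_{m+n,0}`, and all other
brackets vanish; the values are coefficients of the central element `I`. -/
def oscPairing : Osc → Osc → ℂ
  | .γ m, .β n => if m + n = 0 then 1 else 0
  | .β m, .γ n => if m + n = 0 then -1 else 0
  | .a m, .a n => if m + n = 0 then (m : ℂ) / 2 else 0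
  | _, _ => 0

theorem oscPairing_skew (x y : Osc) : oscPairing x y = -oscPairing y x := by
  cases x <;> cases y <;> simp only [oscPairing, neg_zero, add_comm] <;> split_ifs <;> try simp
  rename_i m n h
  have : n = -m := by omega
  subst this
  push_cast
  ring

/-- The bilinear extension of `oscPairing`. -/
def oscForm : (Osc →₀ ℂ) →ₗ[ℂ] (Osc →₀ ℂ) →ₗ[ℂ] ℂ :=
  Finsupp.linearCombination ℂ fun x => Finsupp.linearCombination ℂ (oscPairing x)

theorem oscForm_skew (f g : Osc →₀ ℂ) : oscForm f g = -oscForm g f := by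
  have h : oscForm = -oscForm.flip := by
    ext x y
    simp [oscForm, oscPairing_skew x y]
  exact LinearMap.congr_fun₂ h f g

/-- The Lie algebra with basis `aₙ, βₙ, γₙ` (`n ∈ ℤ`) and a central element `I`: pairs
`(f, c)` standing for `∑ f(x) x + c I`. -/
def OscLie : Type := (Osc →₀ ℂ) × ℂ

instance : AddCommGroup OscLie := inferInstanceAs (AddCommGroup ((Osc →₀ ℂ) × ℂ))
instance : Module ℂ OscLie := inferInstanceAs (Module ℂ ((Osc →₀ ℂ) × ℂ))

instance : LieRing OscLie where
  bracket x y := ((0 : Osc →₀ ℂ), oscForm x.1 y.1)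
  add_lie x y z := Prod.ext (add_zero _).symm (by
    change oscForm (x.1 + y.1) z.1 = oscForm x.1 z.1 + oscForm y.1 z.1
    rw [map_add, LinearMap.add_apply])
  lie_add x y z := Prod.ext (add_zero _).symm (map_add _ _ _)
  lie_self x := Prod.ext rfl (by
    change oscForm x.1 x.1 = 0
    have := oscForm_skew x.1 x.1
    linear_combination this / 2)
  leibniz_lie x y z := Prod.ext (add_zero _).symm (by
    change oscForm x.1 0 = oscForm 0 z.1 + oscForm y.1 0
    simp)

instance : LieAlgebra ℂ OscLie where
  lie_smul _ _ _ := Prod.ext (smul_zero _).symm (map_smul _ _ _)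

/-- The basis elements `aₙ, βₙ, γₙ`. -/
def oscElt (x : Osc) : OscLie := (Finsupp.single x 1, (0 : ℂ))

/-- The central basis element `I`. -/
def oscI : OscLie := ((0 : Osc →₀ ℂ), (1 : ℂ))

/-- The universal enveloping algebra of the oscillator Lie algebra. -/
abbrev UOsc : Type := UniversalEnvelopingAlgebra ℂ OscLie

/-- The left ideal generated by `a₀ - κ⁻¹ j`, `I - 1` and `βₙ, γₙ₊₁, aₙ₊₁` for `n ≥ 0`. -/
def fockIdeal (κ j : ℂ) : Ideal UOsc :=
  Ideal.span
    ({UniversalEnvelopingAlgebra.ι ℂ (oscElt (.a 0)) - algebraMap ℂ UOsc (κ⁻¹ * j),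
        UniversalEnvelopingAlgebra.ι ℂ oscI - 1}
      ∪ {u | ∃ n : ℤ, 0 ≤ n ∧
          (u = UniversalEnvelopingAlgebra.ι ℂ (oscElt (.β n))
            ∨ u = UniversalEnvelopingAlgebra.ι ℂ (oscElt (.γ (n + 1)))
            ∨ u = UniversalEnvelopingAlgebra.ι ℂ (oscElt (.a (n + 1))))})

/-- The left ideal generated by `a₀ + κ⁻¹ (j + 1)`, `I - 1` and `βₙ₊₁, γₙ, aₙ₊₁` for `n ≥ 0`. -/
def dualFockIdeal (κ j : ℂ) : Ideal UOsc :=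
  Ideal.span
    ({UniversalEnvelopingAlgebra.ι ℂ (oscElt (.a 0)) + algebraMap ℂ UOsc (κ⁻¹ * (j + 1)),
        UniversalEnvelopingAlgebra.ι ℂ oscI - 1}
      ∪ {u | ∃ n : ℤ, 0 ≤ n ∧
          (u = UniversalEnvelopingAlgebra.ι ℂ (oscElt (.β (n + 1)))
            ∨ u = UniversalEnvelopingAlgebra.ι ℂ (oscElt (.γ n))
            ∨ u = UniversalEnvelopingAlgebra.ι ℂ (oscElt (.a (n + 1))))})

/-- The Wakimoto Fock module. -/
abbrev Fock (κ j : ℂ) : Type := UOsc ⧸ fockIdeal κ j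

/-- The dual Wakimoto Fock module. -/
abbrev DualFock (κ j : ℂ) : Type := UOsc ⧸ dualFockIdeal κ j

/-- The vacuum of the Fock module: the image of `1`. -/
def fockVec (κ j : ℂ) : Fock κ j := Submodule.Quotient.mk 1

/-- The vacuum of the dual Fock module: the image of `1`. -/
def dualFockVec (κ j : ℂ) : DualFock κ j := Submodule.Quotient.mk 1

theorem oscPairing_eventually (y : Osc) : ∃ N : ℤ, ∀ n : ℤ, N ≤ n →
    oscPairing (.a n) y = 0 ∧ oscPairing (.β n) y = 0 ∧ oscPairing (.γ n) y = 0 := by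
  rcases y with m | m | m <;>
  exact ⟨1 - m, fun n hn => by simp [oscPairing, show n + m ≠ 0 by omega]⟩

/-- A family of oscillators `cₙ` (one of `aₙ`, `βₙ`, `γₙ`) that annihilates the image of `1` for
all `n ≥ 1` is eventually zero on every vector. -/
theorem osc_trunc (I : Ideal UOsc) (c : ℤ → Osc)
    (hc : ∀ y : Osc, ∃ N : ℤ, ∀ n : ℤ, N ≤ n → oscPairing (c n) y = 0)
    (hI : ∀ n : ℤ, 1 ≤ n → UniversalEnvelopingAlgebra.ι ℂ (oscElt (c n)) ∈ I) (v : UOsc ⧸ I) :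
    ∃ N : ℤ, ∀ n : ℤ, N ≤ n → act (UOsc ⧸ I) (oscElt (c n)) v = 0 := by
  have hform (f : Osc →₀ ℂ) :
      ∃ N : ℤ, ∀ n : ℤ, N ≤ n → oscForm (Finsupp.single (c n) 1) f = 0 := by
    induction f using Finsupp.induction_linear with
    | zero => exact ⟨0, fun n _ => map_zero _⟩
    | add f g hf hg =>
      obtain ⟨N, hN⟩ := hf
      obtain ⟨M, hM⟩ := hg
      exact ⟨max N M, fun n hn => by
        rw [map_add, hN n (le_trans (le_max_left _ _) hn),
          hM n (le_trans (le_max_right _ _) hn), add_zero]⟩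
    | single y r =>
      obtain ⟨N, hN⟩ := hc y
      exact ⟨N, fun n hn => by simp [oscForm, hN n hn]⟩
  let S : Submodule ℂ (UOsc ⧸ I) :=
    { carrier := {v | ∃ N : ℤ, ∀ n : ℤ, N ≤ n → act (UOsc ⧸ I) (oscElt (c n)) v = 0}
      zero_mem' := ⟨0, fun n _ => map_zero _⟩
      add_mem' := by
        rintro a b ⟨N, hN⟩ ⟨M, hM⟩
        exact ⟨max N M, fun n hn => by
          rw [map_add, hN n (le_trans (le_max_left _ _) hn),
            hM n (le_trans (le_max_right _ _) hn), add_zero]⟩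
      smul_mem' := by
        rintro r a ⟨N, hN⟩
        exact ⟨N, fun n hn => by rw [map_smul, hN n hn, smul_zero]⟩ }
  refine cyclic_induction I S ⟨1, fun n hn => act_mk_one _ _ (hI n hn)⟩ (fun y m hm => ?_) v
  obtain ⟨N, hN⟩ := hm
  obtain ⟨M, hM⟩ := hform y.1
  refine ⟨max N M, fun n hn => ?_⟩
  have h : ⁅oscElt (c n), y⁆ = 0 :=
    Prod.ext rfl (hM n (le_trans (le_max_right _ _) hn))
  rw [act_act, hN n (le_trans (le_max_left _ _) hn), map_zero, zero_add, h, act_zero_apply]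

theorem fockIdeal_mem (κ j : ℂ) (n : ℤ) (hn : 1 ≤ n) :
    UniversalEnvelopingAlgebra.ι ℂ (oscElt (.a n)) ∈ fockIdeal κ j ∧
    UniversalEnvelopingAlgebra.ι ℂ (oscElt (.β n)) ∈ fockIdeal κ j ∧
    UniversalEnvelopingAlgebra.ι ℂ (oscElt (.γ n)) ∈ fockIdeal κ j :=
  ⟨Ideal.subset_span (Or.inr ⟨n - 1, by omega, Or.inr (Or.inr (by rw [sub_add_cancel]))⟩),
    Ideal.subset_span (Or.inr ⟨n, by omega, Or.inl rfl⟩),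
    Ideal.subset_span (Or.inr ⟨n - 1, by omega, Or.inr (Or.inl (by rw [sub_add_cancel]))⟩)⟩

theorem dualFockIdeal_mem (κ j : ℂ) (n : ℤ) (hn : 1 ≤ n) :
    UniversalEnvelopingAlgebra.ι ℂ (oscElt (.a n)) ∈ dualFockIdeal κ j ∧
    UniversalEnvelopingAlgebra.ι ℂ (oscElt (.β n)) ∈ dualFockIdeal κ j ∧
    UniversalEnvelopingAlgebra.ι ℂ (oscElt (.γ n)) ∈ dualFockIdeal κ j :=
  ⟨Ideal.subset_span (Or.inr ⟨n - 1, by omega, Or.inr (Or.inr (by rw [sub_add_cancel]))⟩),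
    Ideal.subset_span (Or.inr ⟨n - 1, by omega, Or.inl (by rw [sub_add_cancel])⟩),
    Ideal.subset_span (Or.inr ⟨n, by omega, Or.inr (Or.inl rfl)⟩)⟩

/-- The three free fields `∂φ(z) = ∑ aₙ z⁻ⁿ⁻¹`, `β(z) = ∑ βₙ z⁻ⁿ⁻¹`, `γ(z) = ∑ γₙ z⁻ⁿ` on a
vector space. -/
structure FreeFields (V : Type*) [AddCommGroup V] [Module ℂ V] where
  dphi : QField V
  beta : QField V
  gamma : QField V

/-- The free fields on a quotient of the oscillator enveloping algebra by a left ideal containing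
`aₙ, βₙ, γₙ` for `n ≥ 1`. Since `γ(z) = ∑ γₙ z⁻ⁿ`, the coefficient of `z⁻ⁿ⁻¹` in it is `γₙ₊₁`. -/
def oscFields (I : Ideal UOsc)
    (hI : ∀ n : ℤ, 1 ≤ n → UniversalEnvelopingAlgebra.ι ℂ (oscElt (.a n)) ∈ I ∧
      UniversalEnvelopingAlgebra.ι ℂ (oscElt (.β n)) ∈ I ∧
      UniversalEnvelopingAlgebra.ι ℂ (oscElt (.γ n)) ∈ I) : FreeFields (UOsc ⧸ I) where
  dphi :=
    { mode := fun n => act (UOsc ⧸ I) (oscElt (.a n))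
      trunc := osc_trunc I .a
        (fun y => (oscPairing_eventually y).imp fun _ h n hn => (h n hn).1)
        fun n hn => (hI n hn).1 }
  beta :=
    { mode := fun n => act (UOsc ⧸ I) (oscElt (.β n))
      trunc := osc_trunc I .β
        (fun y => (oscPairing_eventually y).imp fun _ h n hn => (h n hn).2.1)
        fun n hn => (hI n hn).2.1 }
  gamma :=
    { mode := fun n => act (UOsc ⧸ I) (oscElt (.γ (n + 1)))
      trunc := fun v => by
        obtain ⟨N, hN⟩ := osc_trunc I .γ
          (fun y => (oscPairing_eventually y).imp fun _ h n hn => (h n hn).2.2)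
          (fun n hn => (hI n hn).2.2) v
        exact ⟨N, fun n hn => hN (n + 1) (by omega)⟩ }

/-- The free fields on the Fock module. -/
def fockFields (κ j : ℂ) : FreeFields (Fock κ j) := oscFields _ (fockIdeal_mem κ j)

/-- The free fields on the dual Fock module. -/
def dualFockFields (κ j : ℂ) : FreeFields (DualFock κ j) := oscFields _ (dualFockIdeal_mem κ j)

/-- The level `k = κ² - 2`. -/
def level (κ : ℂ) : ℂ := κ ^ 2 - 2

section Wakimoto

variable {V : Type*} [AddCommGroup V] [Module ℂ V]

/-- The Wakimoto currents
`J⁺ = β`, `J⁰ = :γβ: + κ ∂φ`, `J⁻ = -:γ²β: - 2κ γ∂φ - k ∂γ`.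
The free-field (Wick) ordered product `:γ²β:` is the right-nested product `:γ(:γβ:):`. -/
def wakimoto (κ : ℂ) (F : FreeFields V) : Currents V
  | .plus => F.beta
  | .zero => QField.nprod F.gamma F.beta + κ • F.dphi
  | .minus =>
      -QField.nprod F.gamma (QField.nprod F.gamma F.beta)
        - (2 * κ) • QField.nprod F.gamma F.dphi - level κ • F.gamma.deriv

/-- The dual Wakimoto currents
`J⁺ = :γ²β: + 2κ γ∂φ + k ∂γ`, `J⁰ = -:γβ: - κ ∂φ`, `J⁻ = -β`. -/
def dualWakimoto (κ : ℂ) (F : FreeFields V) : Currents V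
  | .plus =>
      QField.nprod F.gamma (QField.nprod F.gamma F.beta)
        + (2 * κ) • QField.nprod F.gamma F.dphi + level κ • F.gamma.deriv
  | .zero => -QField.nprod F.gamma F.beta - κ • F.dphi
  | .minus => -F.beta

end Wakimoto

/-! ### The tensor product, the coset Virasoro field and the special vectors -/

section Coset

variable {V H : Type*} [AddCommGroup V] [Module ℂ V] [AddCommGroup H] [Module ℂ H]

/-- The currents `Jᵃ(z) ⊗ 1 + 1 ⊗ Kᵃ(z)` on `V ⊗ H`. -/
def totalCurrents (J : Currents V) (K : Currents H) : Currents (V ⊗[ℂ] H) :=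
  fun a => (J a).onLeft H + (K a).onRight V

/-- The coset field `T^Vir = T^J + T^K - T^{J+K}`, for `J` of level `k` and `K` of level `1`. -/
def cosetT (k : ℂ) (J : Currents V) (K : Currents H) : QField (V ⊗[ℂ] H) :=
  sugawara k (fun a => (J a).onLeft H) + sugawara 1 (fun a => (K a).onRight V)
    - sugawara (k + 1) (totalCurrents J K)

/-- The Virasoro mode `L^Vir_n`, the coefficient of `z⁻ⁿ⁻²` in `T^Vir(z)`. -/
def cosetL (k : ℂ) (J : Currents V) (K : Currents H) (n : ℤ) : Module.End ℂ (V ⊗[ℂ] H) :=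
  (cosetT k J K).mode (n + 1)

/-- `ρ = γ² K⁺ - 2 γ K⁰ - K⁻ - ∂γ` on `V ⊗ H`. -/
def rho (γ : QField V) (K : Currents H) : QField (V ⊗[ℂ] H) :=
  QField.nprod (γ.onLeft H) (QField.nprod (γ.onLeft H) ((K .plus).onRight V))
    - (2 : ℂ) • QField.nprod (γ.onLeft H) ((K .zero).onRight V)
    - (K .minus).onRight V - γ.deriv.onLeft H

/-- `ρ̃ = γ² K⁻ - 2 γ K⁰ - K⁺ + ∂γ` on `V ⊗ H`. -/
def rhoTilde (γ : QField V) (K : Currents H) : QField (V ⊗[ℂ] H) :=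
  QField.nprod (γ.onLeft H) (QField.nprod (γ.onLeft H) ((K .minus).onRight V))
    - (2 : ℂ) • QField.nprod (γ.onLeft H) ((K .zero).onRight V)
    - (K .plus).onRight V + γ.deriv.onLeft H

end Coset

/-- `modeChain R s v n = R_{s (n-1)} ⋯ R_{s 1} R_{s 0} v`. -/
def modeChain {V : Type*} [AddCommGroup V] [Module ℂ V] (R : QField V) (s : ℕ → ℤ) (v : V) :
    ℕ → V
  | 0 => v
  | n + 1 => R.mode (s n) (modeChain R s v n)

/-- The two possible values `ε ∈ {0, 1/2}`. -/
inductive Eps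
  | zero
  | half

/-- The complex number `ε`. -/
def Eps.val : Eps → ℂ
  | .zero => 0
  | .half => 1 / 2

/-- The space `W^{κ,j} ⊗ H^{1,ε}`. -/
abbrev TFock (κ j : ℂ) (ε : Eps) : Type := Fock κ j ⊗[ℂ] IrrHW 1 ε.val

/-- The space `W̃^{κ,j} ⊗ H^{1,ε}`. -/
abbrev TDualFock (κ j : ℂ) (ε : Eps) : Type := DualFock κ j ⊗[ℂ] IrrHW 1 ε.val

/-- The level `k + 1` currents on `W^{κ,j} ⊗ H^{1,ε}`. -/
def calJ (κ j : ℂ) (ε : Eps) : Currents (TFock κ j ε) :=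
  totalCurrents (wakimoto κ (fockFields κ j)) (irrCurrents 1 ε.val)

/-- The level `k + 1` currents on `W̃^{κ,j} ⊗ H^{1,ε}`. -/
def calJDual (κ j : ℂ) (ε : Eps) : Currents (TDualFock κ j ε) :=
  totalCurrents (dualWakimoto κ (dualFockFields κ j)) (irrCurrents 1 ε.val)

/-- `L^Vir_n` on `W^{κ,j} ⊗ H^{1,ε}`. -/
def LVir (κ j : ℂ) (ε : Eps) (n : ℤ) : Module.End ℂ (TFock κ j ε) :=
  cosetL (level κ) (wakimoto κ (fockFields κ j)) (irrCurrents 1 ε.val) n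

/-- `L^Vir_n` on `W̃^{κ,j} ⊗ H^{1,ε}`. -/
def LVirDual (κ j : ℂ) (ε : Eps) (n : ℤ) : Module.End ℂ (TDualFock κ j ε) :=
  cosetL (level κ) (dualWakimoto κ (dualFockFields κ j)) (irrCurrents 1 ε.val) n

/-- The vectors `wⁿ`: for `ε = 0`, `ρ_{-2n+1} ⋯ ρ_{-3} ρ_{-1} w⁰`; for `ε = 1/2`,
`(-1)ⁿ ρ_{-2n+2} ⋯ ρ_{-2} ρ_0 w⁰`. -/
def wVec (κ j : ℂ) : (ε : Eps) → (n : ℕ) → TFock κ j ε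
  | .zero, n =>
      modeChain (rho (fockFields κ j).gamma (irrCurrents 1 Eps.zero.val))
        (fun i => -2 * (i : ℤ) - 1) (fockVec κ j ⊗ₜ[ℂ] irrVec 1 Eps.zero.val) n
  | .half, n =>
      (-1 : ℂ) ^ n • modeChain (rho (fockFields κ j).gamma (irrCurrents 1 Eps.half.val))
        (fun i => -2 * (i : ℤ)) (fockVec κ j ⊗ₜ[ℂ] irrVec 1 Eps.half.val) n

/-- The vectors `w̃ⁿ`: for `ε = 0`, `ρ̃_{-2n+1} ⋯ ρ̃_{-3} ρ̃_{-1} w̃⁰`; for `ε = 1/2`,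
`(-1)ⁿ ρ̃_{-2n} ⋯ ρ̃_{-4} ρ̃_{-2} w̃⁰`. -/
def wVecDual (κ j : ℂ) : (ε : Eps) → (n : ℕ) → TDualFock κ j ε
  | .zero, n =>
      modeChain (rhoTilde (dualFockFields κ j).gamma (irrCurrents 1 Eps.zero.val))
        (fun i => -2 * (i : ℤ) - 1) (dualFockVec κ j ⊗ₜ[ℂ] irrVec 1 Eps.zero.val) n
  | .half, n =>
      (-1 : ℂ) ^ n • modeChain (rhoTilde (dualFockFields κ j).gamma (irrCurrents 1 Eps.half.val))
        (fun i => -2 * (i : ℤ) - 2) (dualFockVec κ j ⊗ₜ[ℂ] irrVec 1 Eps.half.val) n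

/-- `Δⁿ_{k,j,ε} = j(j+1)/(k+2) - (j+ε+n)(j+ε+n+1)/(k+3) + (n+ε)²`. -/
def cosetWeight (k j ε : ℂ) (n : ℤ) : ℂ :=
  j * (j + 1) / (k + 2) - (j + ε + n) * (j + ε + n + 1) / (k + 3) + (n + ε) ^ 2

end AffineCoset

end

open AffineCoset

open scoped TensorProduct

noncomputable section

namespace AffineCoset

attribute [local instance 100] LieRing.ofAssociativeRing

/-! ### Calculus of normally ordered products -/

section Calculus

variable {V : Type*} [AddCommGroup V] [Module ℂ V]

/-! Both halves are one statement. The automorphism J^± ↦ -J^∓, J^0 ↦ -J^0 (`swap`) exchanges the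
Wakimoto and dual Wakimoto currents and turns ρ̃ into -ρ for the swapped currents K. Both Fock
modules are therefore treated together as vacuum modules, with a parameter t: for t = 0 the mode γ_0
is a creation operator, for t = 1 it is β_0.

The field ρ commutes with 𝒥^+ and with γ, has charge -1 under 𝒥^0, satisfies [𝒥^-_m, ρ_n] = 2
:γρ:_{m+n}, and is primary of weight one for T^J + T^K (`plus_lie_rho`, `zero_lie_rho`,
`minus_lie_rho`, `rho_lie_sugawara`). So if v is a top vector (`IsTop`) and ρ_m v = 0 for all m > s,
then ρ_s v is again a top vector, with charge lowered by 1 and the eigenvalue of the zero mode of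
T^J + T^K changed by -s (`IsTop.rho`). The Sugawara field of 𝒥 acts on a highest weight vector by an
explicit scalar, so the claims on T^Vir need no further brackets.

It remains to see that the required modes of ρ vanish along the chain and that the chain does not
reach 0. Both are read off from the vacuum component. Let φ be a functional on the Fock module that
is 1 on the vacuum and kills the image of the creation modes of γ. On vectors killed by the
annihilation modes of γ, φ ⊗ 1 carries ρ_n to -K^-_n, since every other term of ρ contains γ
(`contractLeft_rhoField`). Conversely, a vector that is polynomial in the creation modes of γ and
satisfies (β_n + K^+_n) y = 0 is determined by its vacuum component, because β_n differentiates
(`IsPolynomialVacuum.eq_zero_of_contractLeft`). What is left is a statement on H^{1,ε}: the vectors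
obtained from f by the successive modes K^-_{s_i} are nonzero, and each is killed by the modes of
K^- above the next index.

That is `extremal_chain`, and it follows from :K^-K^-: = 0, the level-one relation. For :K^+K^+: the
relation is proved by irreducibility: its modes and their iterated brackets with K^-_0 form a family
closed, up to scalars, under brackets with the currents. Applied to f they give vectors that are
singular by induction and lie above f in the L_0-grading, hence vanish (`nprod_plus_plus_eq_zero`).

Finally f ≠ 0. The Verma module is nonzero because a Wakimoto module with κ² = 3 is a level-one
module with a nonzero highest weight vector, and its generator avoids the sum of the proper
submodules by the grading 2L_0 - K^0_0 (`irrVec_ne_zero`). -/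

theorem bracket_apply (X Y : Module.End ℂ V) (v : V) : ⁅X, Y⁆ v = X (Y v) - Y (X v) := rfl

theorem apply_apply_eq (X Y : Module.End ℂ V) (v : V) : X (Y v) = Y (X v) + ⁅X, Y⁆ v := by
  rw [bracket_apply]; abel

theorem apply_comm_of_bracket_eq_zero {X Y : Module.End ℂ V} (h : ⁅X, Y⁆ = 0) (v : V) :
    X (Y v) = Y (X v) := by
  rw [apply_apply_eq, h, LinearMap.zero_apply, add_zero]

theorem bracket_one (X : Module.End ℂ V) : ⁅X, (1 : Module.End ℂ V)⁆ = 0 := by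
  rw [Ring.lie_def, mul_one, one_mul, sub_self]

theorem bracket_symm_eq {X Y Z : Module.End ℂ V} (h : ⁅X, Y⁆ = Z) : ⁅Y, X⁆ = -Z := by
  rw [← h, lie_skew]

theorem bracket_symm_zero {X Y : Module.End ℂ V} (h : ⁅X, Y⁆ = 0) : ⁅Y, X⁆ = 0 := by
  rw [bracket_symm_eq h, neg_zero]

namespace QField

variable (A B : QField V)

@[simp] theorem add_mode (n : ℤ) : (A + B).mode n = A.mode n + B.mode n := rfl
@[simp] theorem smul_mode (c : ℂ) (n : ℤ) : (c • A).mode n = c • A.mode n := rfl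
@[simp] theorem neg_mode (n : ℤ) : (-A).mode n = -A.mode n := by
  change (-1 : ℂ) • A.mode n = _
  rw [neg_smul, one_smul]
@[simp] theorem sub_mode (n : ℤ) : (A - B).mode n = A.mode n - B.mode n := by
  change A.mode n + (-B).mode n = _
  rw [neg_mode, sub_eq_add_neg]
theorem deriv_mode (n : ℤ) : A.deriv.mode n = (-(n : ℂ)) • A.mode (n - 1) := rfl

/-- The field `z⁻q⁻¹`, whose only nonzero mode is the identity in position `q`. -/
def delta (q : ℤ) : QField V where
  mode n := if n = q then 1 else 0
  trunc v := ⟨q + 1, fun n hn => by rw [if_neg (by omega), LinearMap.zero_apply]⟩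

theorem delta_mode (q n : ℤ) : (delta q : QField V).mode n = if n = q then 1 else 0 := rfl

theorem lie_delta (X : Module.End ℂ V) (q n : ℤ) : ⁅X, (delta q : QField V).mode n⁆ = 0 := by
  rw [delta_mode]; split_ifs
  · exact bracket_one X
  · exact lie_zero X

theorem delta_lie (X : Module.End ℂ V) (q n : ℤ) : ⁅(delta q : QField V).mode n, X⁆ = 0 :=
  bracket_symm_zero (lie_delta X q n)

/-- Multiplication of the modes by scalars depending on the index. -/
def scale (c : ℤ → ℂ) (A : QField V) : QField V where
  mode n := c n • A.mode n
  trunc v := by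
    obtain ⟨N, hN⟩ := A.trunc v
    exact ⟨N, fun n hn => by simp [hN n hn]⟩

theorem scale_mode (c : ℤ → ℂ) (n : ℤ) : (A.scale c).mode n = c n • A.mode n := rfl

/-- Multiplication of a field by `z⁻ʳ`. -/
def shift (r : ℤ) (A : QField V) : QField V where
  mode n := A.mode (n - r)
  trunc v := by
    obtain ⟨N, hN⟩ := A.trunc v
    exact ⟨N + r, fun n hn => by simp [hN (n - r) (by omega)]⟩

theorem shift_mode (r n : ℤ) : (A.shift r).mode n = A.mode (n - r) := rfl

/-- The `p`-th summand of the product of `A` and `B` ordered at `c`. -/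
def nterm (c N p : ℤ) (v : V) : V :=
  if p < c then A.mode p (B.mode (N - p) v) else B.mode (N - p) (A.mode p v)

theorem finite_nterm (c N : ℤ) (v : V) : (Function.support fun p => nterm A B c N p v).Finite := by
  obtain ⟨M, hM⟩ := A.trunc v
  obtain ⟨K, hK⟩ := B.trunc v
  refine (Set.finite_Icc (min c (N - K)) (max c M)).subset fun p hp => ?_
  simp only [Function.mem_support, nterm] at hp
  split_ifs at hp with hc
  · refine ⟨?_, le_trans hc.le (le_max_left _ _)⟩
    by_contra h
    exact hp (by rw [hK _ (by have := min_le_right c (N - K); omega), map_zero])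
  · refine ⟨le_trans (min_le_left _ _) (not_lt.1 hc), ?_⟩
    by_contra h
    exact hp (by rw [hM _ (by have := le_max_right c M; omega), map_zero])

/-- The sum `∑_{p < c} A₍ₚ₎ B₍N-p₎ + ∑_{p ≥ c} B₍N-p₎ A₍ₚ₎`. -/
def nsum (c N : ℤ) : Module.End ℂ V where
  toFun v := ∑ᶠ p : ℤ, nterm A B c N p v
  map_add' v w := by
    rw [← finsum_add_distrib (finite_nterm A B c N v) (finite_nterm A B c N w)]
    refine finsum_congr fun p => ?_
    simp only [nterm]; split_ifs <;> simp only [map_add]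
  map_smul' a v := by
    rw [RingHom.id_apply, smul_finsum' a (finite_nterm A B c N v)]
    refine finsum_congr fun p => ?_
    simp only [nterm]; split_ifs <;> simp only [map_smul]

theorem nsum_apply (c N : ℤ) (v : V) : nsum A B c N v = ∑ᶠ p : ℤ, nterm A B c N p v := rfl

/-- Splitting a finitely supported sum over `ℤ` at `0`. -/
theorem finsum_int_split {M : Type*} [AddCommMonoid M] (f : ℤ → M)
    (hf : (Function.support f).Finite) :
    ∑ᶠ p : ℤ, f p = (∑ᶠ m : ℕ, f (-(m : ℤ) - 1)) + ∑ᶠ m : ℕ, f m := by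
  have h1 : Function.Injective fun m : ℕ => -(m : ℤ) - 1 := fun a b h => by simp at h; omega
  have h2 : Function.Injective fun m : ℕ => (m : ℤ) := Nat.cast_injective
  have hu : (Set.range fun m : ℕ => -(m : ℤ) - 1) ∪ (Set.range fun m : ℕ => (m : ℤ)) =
      Set.univ := by
    refine Set.eq_univ_of_forall fun p => ?_
    rcases lt_or_ge p 0 with h | h
    · exact Or.inl ⟨(-p - 1).toNat, by simp; omega⟩
    · exact Or.inr ⟨p.toNat, by simp; omega⟩
  rw [← finsum_mem_range h1, ← finsum_mem_range h2, ← finsum_mem_union' ?_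
    (hf.subset Set.inter_subset_right) (hf.subset Set.inter_subset_right), hu, finsum_mem_univ]
  rw [Set.disjoint_left]
  rintro _ ⟨a, rfl⟩ ⟨b, hb⟩
  simp at hb
  omega

/-- As one sum over ℤ with an explicit ordering point, the product can be reindexed by translations
and reflections. The total index is n - 1 because modes are counted by z^{-n-1}. -/
theorem nprod_mode (n : ℤ) : (nprod A B).mode n = nsum A B 0 (n - 1) := by
  refine LinearMap.ext fun v => ?_
  rw [nsum_apply, finsum_int_split _ (finite_nterm A B 0 (n - 1) v)]
  change (∑ᶠ m : ℕ, A.mode (-(m : ℤ) - 1) (B.mode (n + m) v)) +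
          ∑ᶠ m : ℕ, B.mode (n - m - 1) (A.mode (m : ℤ) v) = _
  congr 1
  · refine finsum_congr fun m => ?_
    rw [nterm, if_pos (by omega)]
    congr 3; ring
  · refine finsum_congr fun m => ?_
    rw [nterm, if_neg (by omega)]
    congr 2; ring

variable {A B} in
/-- Commutator of an operator with a normally ordered product. -/
theorem lie_nsum {X : Module.End ℂ V} {A' B' : QField V} {n : ℤ}
    (hA : ∀ p, ⁅X, A.mode p⁆ = A'.mode (n + p)) (hB : ∀ p, ⁅X, B.mode p⁆ = B'.mode (n + p))
    (c N : ℤ) : ⁅X, nsum A B c N⁆ = nsum A' B (n + c) (n + N) + nsum A B' c (n + N) := by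
  refine LinearMap.ext fun v => ?_
  rw [bracket_apply, LinearMap.add_apply]
  simp only [nsum_apply]
  -- In the product containing A' the index is translated by n, which moves its ordering point from
  -- c to n + c. This displacement is one source of the anomalous terms below.
  rw [← finsum_comp_equiv (Equiv.addLeft n) (f := fun p => nterm A' B (n + c) (n + N) p v)]
  have h1 : (Function.support fun p => X (nterm A B c N p v)).Finite :=
    (finite_nterm A B c N v).subset fun p hp h => hp (by simp only [h, map_zero])
  have h2 : (Function.support
      fun p => nterm A' B (n + c) (n + N) ((Equiv.addLeft n) p) v).Finite :=
    (finite_nterm A' B (n + c) (n + N) v).preimage (Equiv.injective _).injOn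
  rw [show X (∑ᶠ p, nterm A B c N p v) = ∑ᶠ p, X (nterm A B c N p v) from
    X.toAddMonoidHom.map_finsum (finite_nterm A B c N v), ← finsum_sub_distrib h1 (finite_nterm A B c N _),
    ← finsum_add_distrib h2 (finite_nterm A B' c (n + N) v)]
  refine finsum_congr fun p => ?_
  have e1 : n + N - (n + p) = N - p := by ring
  have e2 : n + N - p = n + (N - p) := by ring
  simp only [nterm, Equiv.coe_addLeft, add_lt_add_iff_left, e1, e2, ← hA, ← hB, bracket_apply]
  split_ifs <;> simp only [map_sub] <;> abel

variable {A B} in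
theorem lie_nprod {X : Module.End ℂ V} {A' B' : QField V} {n : ℤ}
    (hA : ∀ p, ⁅X, A.mode p⁆ = A'.mode (n + p)) (hB : ∀ p, ⁅X, B.mode p⁆ = B'.mode (n + p))
    (N : ℤ) : ⁅X, (nprod A B).mode N⁆ =
      nsum A' B n (n + N - 1) + (nprod A B').mode (n + N) := by
  rw [nprod_mode, nprod_mode, lie_nsum hA hB, add_zero, add_sub_assoc]

theorem nsum_add_left (A' : QField V) (c N : ℤ) :
    nsum (A + A') B c N = nsum A B c N + nsum A' B c N := by
  refine LinearMap.ext fun v => ?_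
  rw [LinearMap.add_apply]
  simp only [nsum_apply]
  rw [← finsum_add_distrib (finite_nterm _ _ _ _ v) (finite_nterm _ _ _ _ v)]
  refine finsum_congr fun p => ?_
  simp only [nterm]; split_ifs <;> simp

/-- The reflection p ↦ N - p exchanges the two factors and reverses the order on the indices, so p <
c turns into p ≥ N - c + 1. -/
theorem nsum_swap (c N : ℤ) : nsum B A c N = nsum A B (N - c + 1) N := by
  refine LinearMap.ext fun v => ?_
  simp only [nsum_apply]
  rw [← finsum_comp_equiv (Equiv.subLeft N)]
  refine finsum_congr fun p => ?_
  simp only [nterm, Equiv.subLeft_apply, sub_sub_cancel]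
  by_cases h : p < N - c + 1
  · rw [if_pos h, if_neg (by omega)]
  · rw [if_neg h, if_pos (by omega)]

theorem nsum_smul_left (a : ℂ) (c N : ℤ) : nsum (a • A) B c N = a • nsum A B c N := by
  refine LinearMap.ext fun v => ?_
  rw [LinearMap.smul_apply]
  simp only [nsum_apply]
  rw [smul_finsum' a (finite_nterm _ _ _ _ v)]
  refine finsum_congr fun p => ?_
  simp only [nterm]; split_ifs <;> simp

theorem nsum_add_right (B' : QField V) (c N : ℤ) :
    nsum A (B + B') c N = nsum A B c N + nsum A B' c N := by
  rw [nsum_swap, nsum_add_left, ← nsum_swap, ← nsum_swap]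

theorem nsum_smul_right (a : ℂ) (c N : ℤ) : nsum A (a • B) c N = a • nsum A B c N := by
  rw [nsum_swap, nsum_smul_left, ← nsum_swap]

theorem nsum_neg_left (c N : ℤ) : nsum (-A) B c N = -nsum A B c N := by
  rw [← neg_one_smul ℂ (nsum A B c N)]; exact nsum_smul_left A B (-1) c N

theorem nsum_neg_right (c N : ℤ) : nsum A (-B) c N = -nsum A B c N := by
  rw [← neg_one_smul ℂ (nsum A B c N)]; exact nsum_smul_right A B (-1) c N

theorem nsum_sub_right (B' : QField V) (c N : ℤ) :
    nsum A (B - B') c N = nsum A B c N - nsum A B' c N := by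
  rw [sub_eq_add_neg, ← nsum_neg_right, ← nsum_add_right]; rfl

theorem nsum_delta_left (q c N : ℤ) : nsum (delta q) B c N = B.mode (N - q) := by
  refine LinearMap.ext fun v => ?_
  rw [nsum_apply, finsum_eq_single _ q]
  · simp [nterm, delta_mode]
  · intro p hp
    simp [nterm, delta_mode, hp]

theorem nsum_delta_right (q c N : ℤ) : nsum A (delta q) c N = A.mode (N - q) := by
  rw [nsum_swap, nsum_delta_left]

/-- Only the summand with p = c changes its order, and the change is a commutator. -/
theorem nsum_succ (c N : ℤ) :
    nsum A B (c + 1) N = nsum A B c N + ⁅A.mode c, B.mode (N - c)⁆ := by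
  refine LinearMap.ext fun v => ?_
  rw [LinearMap.add_apply, ← sub_eq_iff_eq_add']
  simp only [nsum_apply]
  rw [← finsum_sub_distrib (finite_nterm _ _ _ _ v) (finite_nterm _ _ _ _ v),
    finsum_eq_single _ c]
  · simp [nterm]
  · intro p hp
    simp only [nterm]
    by_cases h : p < c
    · rw [if_pos h, if_pos (by omega), sub_self]
    · rw [if_neg h, if_neg (by omega), sub_self]

variable {A B} in
/-- Moving the point at which a product is ordered. -/
theorem nsum_eq_of_lie {N : ℤ} {X Y : Module.End ℂ V}
    (h : ∀ p, ⁅A.mode p, B.mode (N - p)⁆ = X + (p : ℂ) • Y) (c : ℤ) :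
    nsum A B c N = nsum A B 0 N + (c : ℂ) • X + ((c : ℂ) * (c - 1) / 2) • Y := by
  induction c using Int.induction_on with
  | zero => simp
  | succ i ih =>
    rw [nsum_succ, ih, h]
    push_cast
    module
  | pred i ih =>
    have h1 := nsum_succ A B (-(i : ℤ) - 1) N
    rw [sub_add_cancel, ih, h] at h1
    rw [← sub_eq_iff_eq_add] at h1
    rw [← h1]
    push_cast
    module

variable {A B} in
theorem nsum_eq_of_lie_const {N : ℤ} {X : Module.End ℂ V}
    (h : ∀ p, ⁅A.mode p, B.mode (N - p)⁆ = X) (c : ℤ) :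
    nsum A B c N = nsum A B 0 N + (c : ℂ) • X := by
  rw [nsum_eq_of_lie (X := X) (Y := 0) (fun p => by rw [h, smul_zero, add_zero]), smul_zero,
    add_zero]

variable {A B} in
theorem nsum_eq_of_comm (h : ∀ p q, ⁅A.mode p, B.mode q⁆ = 0) (c N : ℤ) :
    nsum A B c N = (nprod A B).mode (N + 1) := by
  rw [nsum_eq_of_lie_const (X := 0) (fun p => h _ _), smul_zero, add_zero, nprod_mode,
    add_sub_cancel_right]

variable {A B} in
theorem lie_nprod_eq_zero {X : Module.End ℂ V} (hA : ∀ p, ⁅X, A.mode p⁆ = 0)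
    (hB : ∀ p, ⁅X, B.mode p⁆ = 0) (N : ℤ) : ⁅X, (nprod A B).mode N⁆ = 0 := by
  rw [lie_nprod (A' := (0 : ℂ) • A) (B' := (0 : ℂ) • B) (n := 0) (fun p => by simp [hA])
    (fun p => by simp [hB]), nsum_smul_left, nprod_mode, nsum_smul_right, zero_smul, add_zero]

variable {A B} in
theorem nprod_lie_eq_zero {X : Module.End ℂ V} (hA : ∀ p, ⁅A.mode p, X⁆ = 0)
    (hB : ∀ p, ⁅B.mode p, X⁆ = 0) (N : ℤ) : ⁅(nprod A B).mode N, X⁆ = 0 :=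
  bracket_symm_zero
    (lie_nprod_eq_zero (fun p => bracket_symm_zero (hA p)) (fun p => bracket_symm_zero (hB p)) N)

variable {A B} in
/-- Eigenvalues of a commutator add up in normally ordered products. -/
theorem lie_nprod_weight {X : Module.End ℂ V} {a b : ℂ} (hA : ∀ p, ⁅X, A.mode p⁆ = a • A.mode p)
    (hB : ∀ p, ⁅X, B.mode p⁆ = b • B.mode p) (N : ℤ) :
    ⁅X, (nprod A B).mode N⁆ = (a + b) • (nprod A B).mode N := by
  rw [lie_nprod (A' := a • A) (B' := b • B) (n := 0) (fun p => by simp [hA])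
    (fun p => by simp [hB]), nsum_smul_left, nprod_mode, nprod_mode, nsum_smul_right, zero_add,
    add_smul]

end QField
end Calculus

/-! ### Currents of a given level and their Sugawara field -/

section Affine

variable {V : Type*} [AddCommGroup V] [Module ℂ V]

open QField

/-- The modes of `J` satisfy the relations of affine `sl₂` at level `k`. -/
structure IsAffine (k : ℂ) (J : Currents V) : Prop where
  plus_plus : ∀ m n, ⁅(J .plus).mode m, (J .plus).mode n⁆ = 0
  minus_minus : ∀ m n, ⁅(J .minus).mode m, (J .minus).mode n⁆ = 0
  zero_plus : ∀ m n, ⁅(J .zero).mode m, (J .plus).mode n⁆ = (J .plus).mode (m + n)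
  zero_minus : ∀ m n, ⁅(J .zero).mode m, (J .minus).mode n⁆ = -(J .minus).mode (m + n)
  zero_zero : ∀ m n, ⁅(J .zero).mode m, (J .zero).mode n⁆ = (k * m / 2) • (delta 0).mode (m + n)
  plus_minus : ∀ m n, ⁅(J .plus).mode m, (J .minus).mode n⁆ =
    (2 : ℂ) • (J .zero).mode (m + n) + (k * m) • (delta 0).mode (m + n)

/-- Where the delta is nonzero, m + n = q. Used to rewrite a central term in the other index when a
bracket is reversed. -/
theorem smul_delta_symm (m n : ℤ) (q : ℤ) :
    (m : ℂ) • (delta q : QField V).mode (m + n) = ((q : ℂ) - n) • (delta q).mode (m + n) := by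
  rw [delta_mode]
  split_ifs with h
  · rw [← h]; push_cast; congr 1; ring
  · simp

namespace IsAffine

variable {k : ℂ} {J : Currents V} (h : IsAffine k J)
include h

theorem plus_zero (m n : ℤ) : ⁅(J .plus).mode m, (J .zero).mode n⁆ = -(J .plus).mode (m + n) := by
  rw [bracket_symm_eq (h.zero_plus n m), add_comm]

theorem minus_zero (m n : ℤ) : ⁅(J .minus).mode m, (J .zero).mode n⁆ = (J .minus).mode (m + n) := by
  rw [bracket_symm_eq (h.zero_minus n m), add_comm, neg_neg]

theorem minus_plus (m n : ℤ) : ⁅(J .minus).mode m, (J .plus).mode n⁆ =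
    (-2 : ℂ) • (J .zero).mode (m + n) + (k * m) • (delta 0).mode (m + n) := by
  rw [bracket_symm_eq (h.plus_minus n m), add_comm n m, neg_add, ← neg_smul, ← neg_smul,
    mul_smul, ← neg_mul, mul_smul, smul_delta_symm]
  simp only [Int.cast_zero, zero_sub]
  module

/-- The image of a triple of currents under the automorphism `J^± ↦ -J^∓`, `J⁰ ↦ -J⁰`. -/
def _root_.AffineCoset.swap (J : Currents V) : Currents V
  | .plus => -J .minus
  | .zero => -J .zero
  | .minus => -J .plus

theorem swap : IsAffine k (swap J) where
  plus_plus m n := by simp [AffineCoset.swap, h.minus_minus]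
  minus_minus m n := by simp [AffineCoset.swap, h.plus_plus]
  zero_plus m n := by simp [AffineCoset.swap, h.zero_minus]
  zero_minus m n := by simp [AffineCoset.swap, h.zero_plus]
  zero_zero m n := by simp [AffineCoset.swap, h.zero_zero]
  plus_minus m n := by
    simp only [AffineCoset.swap, neg_mode, neg_lie, lie_neg, neg_neg, h.minus_plus]
    module

omit h in
theorem _root_.AffineCoset.neg_nprod_neg (A B : QField V) : nprod (-A) (-B) = nprod A B := by
  ext1; funext n
  rw [nprod_mode, nprod_mode, nsum_neg_left, nsum_neg_right, neg_neg]

omit h in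
theorem _root_.AffineCoset.sugawara_mode (k : ℂ) (J : Currents V) (N : ℤ) :
    (sugawara k J).mode N = (k + 2)⁻¹ • (nsum (J .zero) (J .zero) 0 (N - 1)
      + (1 / 2 : ℂ) • nsum (J .plus) (J .minus) 0 (N - 1)
      + (1 / 2 : ℂ) • nsum (J .minus) (J .plus) 0 (N - 1)) := by
  simp only [sugawara, smul_mode, add_mode, nprod_mode]

omit h in
theorem _root_.AffineCoset.sugawara_swap (k : ℂ) (J : Currents V) :
    sugawara k (AffineCoset.swap J) = sugawara k J := by
  ext1; funext n
  simp only [sugawara, AffineCoset.swap, neg_nprod_neg, smul_mode, add_mode]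
  abel_nf

/-- The product :J^0J^0: contributes k n through the central term. In the two mixed products the
ordering point has moved to n; bringing it back contributes 2n, and the central corrections of the
two orders cancel. The sum k + 2 is the Sugawara normalisation. -/
theorem zero_lie_sugawara (hk : k + 2 ≠ 0) (n N : ℤ) :
    ⁅(J .zero).mode n, (sugawara k J).mode N⁆ = (n : ℂ) • (J .zero).mode (n + N - 1) := by
  have h0 : ∀ p, ⁅(J .zero).mode n, (J .zero).mode p⁆ =
      ((k * n / 2) • delta 0 : QField V).mode (n + p) := fun p => h.zero_zero n p
  have hp : ∀ p, ⁅(J .zero).mode n, (J .plus).mode p⁆ = (J .plus).mode (n + p) := h.zero_plus n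
  have hm : ∀ p, ⁅(J .zero).mode n, (J .minus).mode p⁆ = (-J .minus).mode (n + p) :=
    fun p => by rw [h.zero_minus, neg_mode]
  rw [sugawara_mode, lie_smul, lie_add, lie_add, lie_smul, lie_smul, lie_nsum h0 h0,
    lie_nsum hp hm, lie_nsum hm hp]
  simp only [nsum_smul_left, nsum_smul_right, nsum_delta_left, nsum_delta_right, nsum_neg_left,
    nsum_neg_right, sub_zero, add_zero]
  rw [nsum_eq_of_lie (A := J .plus) (B := J .minus) (X := (2 : ℂ) • (J .zero).mode (n + (N - 1)))
      (Y := k • (delta 0).mode (n + (N - 1)))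
      (fun p => by rw [h.plus_minus, mul_comm, mul_smul, add_sub_cancel]) n,
    nsum_eq_of_lie (A := J .minus) (B := J .plus) (X := (-2 : ℂ) • (J .zero).mode (n + (N - 1)))
      (Y := k • (delta 0).mode (n + (N - 1)))
      (fun p => by rw [h.minus_plus, mul_comm, mul_smul, add_sub_cancel]) n, ← add_sub_assoc]
  rw [inv_smul_eq_iff₀ hk]
  module

/-- The quadratic terms cancel between :J^0J^0: and the mixed products. Central terms give k n and
displaced orderings give 2n. -/
theorem plus_lie_sugawara (hk : k + 2 ≠ 0) (n N : ℤ) :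
    ⁅(J .plus).mode n, (sugawara k J).mode N⁆ = (n : ℂ) • (J .plus).mode (n + N - 1) := by
  have h0 : ∀ p, ⁅(J .plus).mode n, (J .zero).mode p⁆ = (-J .plus).mode (n + p) :=
    fun p => by rw [h.plus_zero, neg_mode]
  have hp : ∀ p, ⁅(J .plus).mode n, (J .plus).mode p⁆ = ((0 : ℂ) • J .plus).mode (n + p) :=
    fun p => by rw [h.plus_plus, smul_mode, zero_smul]
  have hm : ∀ p, ⁅(J .plus).mode n, (J .minus).mode p⁆ =
    ((2 : ℂ) • J .zero + (k * n) • delta 0).mode (n + p) := h.plus_minus n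
  rw [sugawara_mode, lie_smul, lie_add, lie_add, lie_smul, lie_smul, lie_nsum h0 h0,
    lie_nsum hp hm, lie_nsum hm hp]
  simp only [nsum_add_left, nsum_add_right, nsum_smul_left, nsum_smul_right, nsum_delta_left,
    nsum_delta_right, nsum_neg_left, nsum_neg_right, sub_zero, add_zero]
  rw [nsum_eq_of_lie_const (A := J .plus) (B := J .zero) (X := -(J .plus).mode (n + (N - 1)))
      (fun p => by rw [h.plus_zero, add_sub_cancel]) n,
    nsum_eq_of_lie_const (A := J .zero) (B := J .plus) (X := (J .plus).mode (n + (N - 1)))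
      (fun p => by rw [h.zero_plus, add_sub_cancel]) n, ← add_sub_assoc]
  rw [inv_smul_eq_iff₀ hk]
  module

/-- The currents are primary of weight one for their Sugawara field. -/
theorem lie_sugawara (hk : k + 2 ≠ 0) (a : SlIdx) (n N : ℤ) :
    ⁅(J a).mode n, (sugawara k J).mode N⁆ = (n : ℂ) • (J a).mode (n + N - 1) := by
  cases a
  · exact h.plus_lie_sugawara hk n N
  · exact h.zero_lie_sugawara hk n N
  -- The Sugawara field is invariant under `swap`, so the case of J^- is that of J^+ for the swapped
  -- currents.
  · have := h.swap.plus_lie_sugawara hk n N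
    rw [sugawara_swap] at this
    simpa only [AffineCoset.swap, neg_mode, neg_lie, smul_neg, neg_inj] using this

end IsAffine

/-- Two triples of currents commute with each other. -/
def CurrentsCommute (J K : Currents V) : Prop :=
  ∀ a b m n, ⁅(J a).mode m, (K b).mode n⁆ = 0

/-- Currents of levels `k` and `l` that commute add up to currents of level `k + l`. -/
theorem IsAffine.add {k l : ℂ} {J K : Currents V} (hJ : IsAffine k J) (hK : IsAffine l K)
    (hJK : CurrentsCommute J K) : IsAffine (k + l) (fun a => J a + K a) := by
  have hKJ : ∀ a b m n, ⁅(K a).mode m, (J b).mode n⁆ = 0 :=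
    fun a b m n => bracket_symm_zero (hJK b a n m)
  have e : ∀ a b m n, ⁅(J a + K a).mode m, (J b + K b).mode n⁆ =
      ⁅(J a).mode m, (J b).mode n⁆ + ⁅(K a).mode m, (K b).mode n⁆ := fun a b m n => by
    rw [add_mode, add_mode, add_lie, lie_add, lie_add, hJK, hKJ, add_zero, zero_add]
  constructor <;> intro m n <;> rw [e]
  · rw [hJ.plus_plus, hK.plus_plus, add_zero]
  · rw [hJ.minus_minus, hK.minus_minus, add_zero]
  · rw [hJ.zero_plus, hK.zero_plus, add_mode]
  · rw [hJ.zero_minus, hK.zero_minus, add_mode, neg_add]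
  · rw [hJ.zero_zero, hK.zero_zero]; module
  · rw [hJ.plus_minus, hK.plus_minus, add_mode]; module

/-- `v` is a highest weight vector for the currents `J`, of weight `l`. -/
structure IsHighestWeight (J : Currents V) (l : ℂ) (v : V) : Prop where
  pos : ∀ a m, 0 < m → (J a).mode m v = 0
  plus : (J .plus).mode 0 v = 0
  zero : (J .zero).mode 0 v = l • v

/-- For p < 0 the mode of B applied first has index N - p > 0, and for p > 0 the mode of A kills v;
only p = 0 survives. -/
theorem nsum_apply_eq_of_pos {A B : QField V} {v : V} (hA : ∀ m, 0 < m → A.mode m v = 0)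
    (hB : ∀ m, 0 < m → B.mode m v = 0) {N : ℤ} (hN : 0 ≤ N) :
    nsum A B 0 N v = B.mode N (A.mode 0 v) := by
  rw [nsum_apply, finsum_eq_single _ 0]
  · simp [nterm]
  · intro p hp
    rw [nterm]
    split_ifs with h
    · rw [hB _ (by omega), map_zero]
    · rw [hA _ (by omega), map_zero]

/-- The only surviving term that is not zero at sight is J^+_{N-1} J^-_0 v, which equals its
commutator 2 J^0_{N-1} v and vanishes because N - 1 > 0. -/
theorem IsHighestWeight.sugawara_pos {k l : ℂ} {J : Currents V} {v : V} (hJ : IsAffine k J)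
    (hv : IsHighestWeight J l v) {N : ℤ} (hN : 1 < N) : (sugawara k J).mode N v = 0 := by
  have hN' : 0 ≤ N - 1 := by omega
  rw [sugawara_mode]
  simp only [LinearMap.smul_apply, LinearMap.add_apply]
  rw [nsum_apply_eq_of_pos (hv.pos _) (hv.pos _) hN', nsum_apply_eq_of_pos (hv.pos _) (hv.pos _) hN',
    nsum_apply_eq_of_pos (hv.pos _) (hv.pos _) hN', hv.zero, hv.plus, map_zero, map_smul,
    hv.pos _ _ (by omega), apply_apply_eq, hv.pos _ _ (by omega), hJ.plus_minus]
  simp [hv.pos _ _ (show 0 < N - 1 by omega), delta_mode, show N - 1 ≠ 0 by omega]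

/-- The product :J^0J^0: gives l², and half of J^+_0 J^-_0 v = 2 J^0_0 v supplies the linear term l.
-/
theorem IsHighestWeight.sugawara_zero {k l : ℂ} {J : Currents V} {v : V} (hJ : IsAffine k J)
    (hv : IsHighestWeight J l v) :
    (sugawara k J).mode 1 v = (l * (l + 1) / (k + 2)) • v := by
  rw [sugawara_mode, sub_self]
  simp only [LinearMap.smul_apply, LinearMap.add_apply]
  rw [nsum_apply_eq_of_pos (hv.pos _) (hv.pos _) le_rfl,
    nsum_apply_eq_of_pos (hv.pos _) (hv.pos _) le_rfl,
    nsum_apply_eq_of_pos (hv.pos _) (hv.pos _) le_rfl, hv.zero, hv.plus, map_zero, map_smul,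
    hv.zero, apply_apply_eq, hv.plus, hJ.plus_minus]
  simp only [Int.cast_zero, mul_zero, zero_smul, add_zero, LinearMap.smul_apply, map_zero, zero_add,
    hv.zero, smul_zero]
  rw [div_eq_inv_mul]
  module

end Affine

/-! ### Free fields and the Wakimoto currents -/

section FreeFieldCalculus

variable {V : Type*} [AddCommGroup V] [Module ℂ V]

open QField

/-- The free fields satisfy the canonical commutation relations. -/
structure IsCCR (F : FreeFields V) : Prop where
  gamma_beta : ∀ m n, ⁅F.gamma.mode m, F.beta.mode n⁆ = (delta (-1)).mode (m + n)
  gamma_gamma : ∀ m n, ⁅F.gamma.mode m, F.gamma.mode n⁆ = 0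
  beta_beta : ∀ m n, ⁅F.beta.mode m, F.beta.mode n⁆ = 0
  dphi_gamma : ∀ m n, ⁅F.dphi.mode m, F.gamma.mode n⁆ = 0
  dphi_beta : ∀ m n, ⁅F.dphi.mode m, F.beta.mode n⁆ = 0
  dphi_dphi : ∀ m n, ⁅F.dphi.mode m, F.dphi.mode n⁆ = ((m : ℂ) / 2) • (delta 0).mode (m + n)

/-- Operators of the same nonzero charge are equal if they have the same commutators with all
modes of `β` and `γ`. -/
theorem eq_of_charge {F : FreeFields V} {X Y : Module.End ℂ V} {c : ℂ} (hc : c ≠ 0)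
    (hX : ⁅(nprod F.gamma F.beta).mode 0, X⁆ = c • X)
    (hY : ⁅(nprod F.gamma F.beta).mode 0, Y⁆ = c • Y)
    (hβ : ∀ p, ⁅F.beta.mode p, X⁆ = ⁅F.beta.mode p, Y⁆)
    (hγ : ∀ p, ⁅F.gamma.mode p, X⁆ = ⁅F.gamma.mode p, Y⁆) : X = Y := by
  -- The charge operator is itself a product of γ and β, so it commutes with the difference; but the
  -- difference has charge c ≠ 0.
  have h1 : ⁅(nprod F.gamma F.beta).mode 0, X - Y⁆ = 0 :=
    nprod_lie_eq_zero (fun p => by rw [lie_sub, hγ, sub_self]) (fun p => by rw [lie_sub, hβ, sub_self]) 0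
  rw [lie_sub, hX, hY, ← smul_sub, smul_eq_zero] at h1
  exact sub_eq_zero.1 (h1.resolve_left hc)

namespace IsCCR

variable {F : FreeFields V} (h : IsCCR F)
include h

/-- The delta sits at -1 because mode n of the field γ is the oscillator γ_{n+1}. -/
theorem beta_gamma (m n : ℤ) :
    ⁅F.beta.mode m, F.gamma.mode n⁆ = (-delta (-1) : QField V).mode (m + n) := by
  rw [bracket_symm_eq (h.gamma_beta n m), add_comm, neg_mode]

theorem gamma_dphi (m n : ℤ) : ⁅F.gamma.mode m, F.dphi.mode n⁆ = 0 :=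
  bracket_symm_zero (h.dphi_gamma n m)

theorem beta_dphi (m n : ℤ) : ⁅F.beta.mode m, F.dphi.mode n⁆ = 0 :=
  bracket_symm_zero (h.dphi_beta n m)

theorem beta_lie_gb (n N : ℤ) :
    ⁅F.beta.mode n, (nprod F.gamma F.beta).mode N⁆ = -F.beta.mode (n + N) := by
  rw [lie_nprod (A' := -delta (-1)) (B' := (0 : ℂ) • F.beta) (h.beta_gamma n)
    (fun p => by simp [h.beta_beta]), nprod_mode, nsum_smul_right, zero_smul, add_zero,
    nsum_neg_left, nsum_delta_left]
  congr 2; ring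

theorem gamma_lie_gb (n N : ℤ) :
    ⁅F.gamma.mode n, (nprod F.gamma F.beta).mode N⁆ = F.gamma.mode (n + N) := by
  rw [lie_nprod (A' := (0 : ℂ) • F.gamma) (B' := delta (-1)) (fun p => by simp [h.gamma_gamma])
    (h.gamma_beta n), nprod_mode, nsum_smul_left, zero_smul, zero_add, nsum_delta_right]
  congr 1; ring

theorem gb_lie_beta (n N : ℤ) :
    ⁅(nprod F.gamma F.beta).mode n, F.beta.mode N⁆ = F.beta.mode (n + N) := by
  rw [bracket_symm_eq (h.beta_lie_gb N n), neg_neg, add_comm]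

theorem gb_lie_gamma (n N : ℤ) :
    ⁅(nprod F.gamma F.beta).mode n, F.gamma.mode N⁆ = -F.gamma.mode (n + N) := by
  rw [bracket_symm_eq (h.gamma_lie_gb N n), add_comm]

theorem dphi_lie_gb (n N : ℤ) : ⁅F.dphi.mode n, (nprod F.gamma F.beta).mode N⁆ = 0 :=
  lie_nprod_eq_zero (h.dphi_gamma n) (h.dphi_beta n) N

theorem charge_gamma (N : ℤ) :
    ⁅(nprod F.gamma F.beta).mode 0, F.gamma.mode N⁆ = (-1 : ℂ) • F.gamma.mode N := by
  rw [h.gb_lie_gamma, zero_add, neg_one_smul]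

theorem charge_beta (N : ℤ) :
    ⁅(nprod F.gamma F.beta).mode 0, F.beta.mode N⁆ = (1 : ℂ) • F.beta.mode N := by
  rw [h.gb_lie_beta, zero_add, one_smul]

theorem beta_lie_gamma_nprod (n : ℤ) {X X' : QField V}
    (hX : ∀ p, ⁅F.beta.mode n, X.mode p⁆ = X'.mode (n + p)) (N : ℤ) :
    ⁅F.beta.mode n, (nprod F.gamma X).mode N⁆ = -X.mode (n + N) + (nprod F.gamma X').mode (n + N) := by
  rw [lie_nprod (h.beta_gamma n) hX, nsum_neg_left, nsum_delta_left]
  congr 3; ring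

theorem gamma_lie_gamma_nprod (n : ℤ) {X X' : QField V}
    (hX : ∀ p, ⁅F.gamma.mode n, X.mode p⁆ = X'.mode (n + p)) (N : ℤ) :
    ⁅F.gamma.mode n, (nprod F.gamma X).mode N⁆ = (nprod F.gamma X').mode (n + N) := by
  rw [lie_nprod (A' := (0 : ℂ) • F.gamma) (fun p => by simp [h.gamma_gamma]) hX, nsum_smul_left,
    zero_smul, zero_add]

theorem beta_lie_gg (n N : ℤ) : ⁅F.beta.mode n, (nprod F.gamma F.gamma).mode N⁆ =
    (-2 : ℂ) • F.gamma.mode (n + N) := by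
  rw [h.beta_lie_gamma_nprod n (h.beta_gamma n), nprod_mode, nsum_neg_right, nsum_delta_right]
  rw [show n + N - 1 - -1 = n + N by ring]
  module

theorem gamma_lie_gg (n N : ℤ) : ⁅F.gamma.mode n, (nprod F.gamma F.gamma).mode N⁆ = 0 :=
  lie_nprod_eq_zero (h.gamma_gamma n) (h.gamma_gamma n) N

theorem charge_gg (N : ℤ) : ⁅(nprod F.gamma F.beta).mode 0, (nprod F.gamma F.gamma).mode N⁆ =
    (-2 : ℂ) • (nprod F.gamma F.gamma).mode N := by
  rw [lie_nprod_weight h.charge_gamma h.charge_gamma]; norm_num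

theorem beta_lie_ggb (n N : ℤ) :
    ⁅F.beta.mode n, (nprod F.gamma (nprod F.gamma F.beta)).mode N⁆ =
      (-2 : ℂ) • (nprod F.gamma F.beta).mode (n + N) := by
  rw [h.beta_lie_gamma_nprod n (X' := -F.beta) (fun p => by rw [h.beta_lie_gb, neg_mode]),
    nprod_mode, nprod_mode, nsum_neg_right]
  module

theorem gamma_lie_ggb (n N : ℤ) :
    ⁅F.gamma.mode n, (nprod F.gamma (nprod F.gamma F.beta)).mode N⁆ =
      (nprod F.gamma F.gamma).mode (n + N) :=
  h.gamma_lie_gamma_nprod n (h.gamma_lie_gb n) N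

theorem charge_ggb (N : ℤ) :
    ⁅(nprod F.gamma F.beta).mode 0, (nprod F.gamma (nprod F.gamma F.beta)).mode N⁆ =
      (-1 : ℂ) • (nprod F.gamma (nprod F.gamma F.beta)).mode N := by
  rw [lie_nprod_weight h.charge_gamma (lie_nprod_weight h.charge_gamma h.charge_beta)]; norm_num

theorem beta_lie_dgamma (n N : ℤ) :
    ⁅F.beta.mode n, F.gamma.deriv.mode N⁆ = (-(n : ℂ)) • (delta 0).mode (n + N) := by
  rw [deriv_mode, lie_smul, h.beta_gamma, neg_mode, delta_mode, delta_mode]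
  by_cases e : n + N = 0
  · rw [if_pos (by omega), if_pos e, show N = -n by omega]
    push_cast; module
  · rw [if_neg (by omega), if_neg e]; simp

/-- `:(:γγ:)β: = :γ(:γβ:): + 2∂γ`. -/
theorem nprod_gg_beta (N : ℤ) : (nprod (nprod F.gamma F.gamma) F.beta).mode N =
    (nprod F.gamma (nprod F.gamma F.beta)).mode N + (2 : ℂ) • F.gamma.deriv.mode N := by
  refine eq_of_charge (F := F) (c := -1) (by norm_num) ?_ ?_ (fun p => ?_) (fun p => ?_)
  · rw [lie_nprod_weight h.charge_gg h.charge_beta]; norm_num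
  · rw [lie_add, lie_smul, h.charge_ggb, deriv_mode, lie_smul, h.charge_gamma]; module
  -- Bringing the displaced product of γ and β back to the ordering point 0 costs a multiple p of
  -- the delta, which is the bracket of β_p with the extra 2∂γ.
  · rw [lie_nprod (A' := (-2 : ℂ) • F.gamma) (B' := (0 : ℂ) • F.beta)
      (fun q => by rw [h.beta_lie_gg, smul_mode]) (fun q => by simp [h.beta_beta]), nprod_mode,
      nsum_smul_left, nsum_smul_right, nsum_eq_of_lie_const (X := (delta (-1)).mode (p + N - 1))
      (fun q => by rw [h.gamma_beta, add_sub_cancel]), lie_add, lie_smul, h.beta_lie_ggb,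
      h.beta_lie_dgamma, nprod_mode, delta_mode, delta_mode,
      if_congr (show p + N - 1 = -1 ↔ p + N = 0 by omega) rfl rfl]
    module
  · rw [lie_nprod (A' := (0 : ℂ) • F.gamma) (B' := delta (-1))
      (fun q => by simp [h.gamma_lie_gg]) (h.gamma_beta p), nsum_smul_left, zero_smul, zero_add,
      nprod_mode, nsum_delta_right, lie_add, h.gamma_lie_ggb, deriv_mode, lie_smul, lie_smul,
      h.gamma_gamma, smul_zero, smul_zero, add_zero]
    congr 1; ring

/-- `2:γ∂γ: = ∂(:γγ:)`. -/
theorem nprod_gamma_dgamma (N : ℤ) : (2 : ℂ) • (nprod F.gamma F.gamma.deriv).mode N =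
    (-(N : ℂ)) • (nprod F.gamma F.gamma).mode (N - 1) := by
  refine eq_of_charge (F := F) (c := -2) (by norm_num) ?_ ?_ (fun p => ?_) (fun p => ?_)
  · rw [lie_smul, lie_nprod_weight h.charge_gamma (b := -1)
      (fun p => by rw [deriv_mode, lie_smul, h.charge_gamma]; module)]
    module
  · rw [lie_smul, h.charge_gg]; module
  · rw [lie_smul, h.beta_lie_gamma_nprod p (X' := (-(p : ℂ)) • delta 0) (h.beta_lie_dgamma p),
      nprod_mode, nsum_smul_right, nsum_delta_right, lie_smul, h.beta_lie_gg, deriv_mode, sub_zero,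
      add_sub_assoc]
    push_cast
    module
  · rw [lie_smul, h.gamma_lie_gamma_nprod p (X' := (0 : ℂ) • F.gamma)
      (fun q => by rw [deriv_mode, lie_smul, h.gamma_gamma]; simp), nprod_mode, nsum_smul_right,
      lie_smul, h.gamma_lie_gg]
    simp

/-- `:(:γγ:)X: = :γ(:γX:):` for fields `X` commuting with `β` and `γ`. -/
theorem nprod_gg_eq {X : QField V} (hβ : ∀ m n, ⁅F.beta.mode m, X.mode n⁆ = 0)
    (hγ : ∀ m n, ⁅F.gamma.mode m, X.mode n⁆ = 0) :
    nprod (nprod F.gamma F.gamma) X = nprod F.gamma (nprod F.gamma X) := by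
  ext1; funext N
  have hX : ∀ n, ⁅(nprod F.gamma F.beta).mode 0, X.mode n⁆ = (0 : ℂ) • X.mode n := fun n => by
    rw [zero_smul]; exact nprod_lie_eq_zero (fun p => hγ p n) (fun p => hβ p n) 0
  have hβ' : ∀ m n, ⁅F.beta.mode m, X.mode n⁆ = ((0 : ℂ) • X).mode (m + n) := fun m n => by
    simp [hβ]
  refine eq_of_charge (F := F) (c := -2) (by norm_num) ?_ ?_ (fun p => ?_) (fun p => ?_)
  · rw [lie_nprod_weight h.charge_gg hX]; norm_num
  · rw [lie_nprod_weight h.charge_gamma (lie_nprod_weight h.charge_gamma hX)]; norm_num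
  · rw [lie_nprod (A' := (-2 : ℂ) • F.gamma) (fun q => by rw [h.beta_lie_gg, smul_mode]) (hβ' p),
      h.beta_lie_gamma_nprod p (X' := -X) (fun q => by
        rw [h.beta_lie_gamma_nprod p (hβ' p), nprod_mode, nsum_smul_right]; simp),
      nsum_smul_left, nsum_eq_of_comm hγ, sub_add_cancel]
    simp only [nprod_mode, nsum_smul_right, nsum_neg_right]
    module
  · rw [lie_nprod_eq_zero (h.gamma_lie_gg p) (hγ p), lie_nprod_eq_zero (h.gamma_gamma p)
      (lie_nprod_eq_zero (h.gamma_gamma p) (hγ p))]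

/-- Reassociation one step beyond `nprod_gg_eq`: γX no longer commutes with β, but its bracket is
-X, so the charge argument still applies and uses `nprod_gg_eq` itself. It is needed for the cubic
term in `minus_lie_rho`. -/
theorem nprod_gg_gamma_eq {X : QField V} (hβ : ∀ m n, ⁅F.beta.mode m, X.mode n⁆ = 0)
    (hγ : ∀ m n, ⁅F.gamma.mode m, X.mode n⁆ = 0) :
    nprod (nprod F.gamma F.gamma) (nprod F.gamma X) =
      nprod F.gamma (nprod F.gamma (nprod F.gamma X)) := by
  ext1; funext N
  have hX : ∀ n, ⁅(nprod F.gamma F.beta).mode 0, X.mode n⁆ = (0 : ℂ) • X.mode n := fun n => by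
    rw [zero_smul]; exact nprod_lie_eq_zero (fun p => hγ p n) (fun p => hβ p n) 0
  have hβ' : ∀ m n, ⁅F.beta.mode m, (nprod F.gamma X).mode n⁆ = (-X).mode (m + n) := fun m n => by
    rw [h.beta_lie_gamma_nprod m (X' := (0 : ℂ) • X) (fun p => by simp [hβ]), nprod_mode,
      nsum_smul_right]
    simp
  have hγ' : ∀ m n, ⁅F.gamma.mode m, (nprod F.gamma X).mode n⁆ = 0 := fun m n =>
    lie_nprod_eq_zero (h.gamma_gamma m) (hγ m) n
  have hX' := lie_nprod_weight h.charge_gamma hX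
  refine eq_of_charge (F := F) (c := -3) (by norm_num) ?_ ?_ (fun p => ?_) (fun p => ?_)
  · rw [lie_nprod_weight h.charge_gg hX']; norm_num
  · rw [lie_nprod_weight h.charge_gamma (lie_nprod_weight h.charge_gamma hX')]; norm_num
  · rw [lie_nprod (A' := (-2 : ℂ) • F.gamma) (fun q => by rw [h.beta_lie_gg, smul_mode]) (hβ' p),
      h.beta_lie_gamma_nprod p (X' := (-2 : ℂ) • nprod F.gamma X) (fun q => by
        rw [h.beta_lie_gamma_nprod p (hβ' p)]
        simp only [nprod_mode, nsum_neg_right, smul_mode]; module),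
      nsum_smul_left, nsum_eq_of_comm hγ', sub_add_cancel]
    rw [nprod_mode (nprod F.gamma F.gamma), nsum_neg_right, ← nprod_mode, h.nprod_gg_eq hβ hγ]
    simp only [nprod_mode, nsum_smul_right]
    module
  · rw [lie_nprod_eq_zero (h.gamma_lie_gg p) (hγ' p), lie_nprod_eq_zero (h.gamma_gamma p)
      (lie_nprod_eq_zero (h.gamma_gamma p) (hγ' p))]

end IsCCR

end FreeFieldCalculus

/-! ### Affine relations of the Wakimoto currents -/

section WakimotoRelations

variable {V : Type*} [AddCommGroup V] [Module ℂ V]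

open QField

theorem wakimoto_plus_mode (κ : ℂ) (F : FreeFields V) (n : ℤ) :
    (wakimoto κ F .plus).mode n = F.beta.mode n := rfl

theorem wakimoto_zero_mode (κ : ℂ) (F : FreeFields V) (n : ℤ) :
    (wakimoto κ F .zero).mode n = (nprod F.gamma F.beta).mode n + κ • F.dphi.mode n := rfl

theorem wakimoto_minus_mode (κ : ℂ) (F : FreeFields V) (n : ℤ) :
    (wakimoto κ F .minus).mode n = -(nprod F.gamma (nprod F.gamma F.beta)).mode n
      - (2 * κ) • (nprod F.gamma F.dphi).mode n - level κ • F.gamma.deriv.mode n := by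
  simp only [wakimoto, sub_mode, neg_mode, smul_mode]

namespace IsCCR

variable {F : FreeFields V} (h : IsCCR F) (κ : ℂ)
include h

theorem zero_lie_gamma (m n : ℤ) :
    ⁅(wakimoto κ F .zero).mode m, F.gamma.mode n⁆ = -F.gamma.mode (m + n) := by
  rw [wakimoto_zero_mode, add_lie, smul_lie, h.dphi_gamma, smul_zero, add_zero, h.gb_lie_gamma]

theorem minus_lie_gamma (m n : ℤ) :
    ⁅(wakimoto κ F .minus).mode m, F.gamma.mode n⁆ = (nprod F.gamma F.gamma).mode (m + n) := by
  rw [wakimoto_minus_mode, sub_lie, sub_lie, neg_lie, smul_lie, smul_lie, deriv_mode, smul_lie,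
    h.gamma_gamma, nprod_lie_eq_zero (fun p => h.gamma_gamma p n) (fun p => h.dphi_gamma p n),
    bracket_symm_eq (h.gamma_lie_ggb n m), add_comm]
  simp

theorem zero_lie_dphi (m n : ℤ) :
    ⁅(wakimoto κ F .zero).mode m, F.dphi.mode n⁆ = (κ * m / 2) • (delta 0).mode (m + n) := by
  rw [wakimoto_zero_mode, add_lie, smul_lie, h.dphi_dphi, bracket_symm_zero (h.dphi_lie_gb n m)]
  module

theorem dphi_lie_gamma_dphi (m n : ℤ) :
    ⁅F.dphi.mode m, (nprod F.gamma F.dphi).mode n⁆ = ((m : ℂ) / 2) • F.gamma.mode (m + n - 1) := by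
  rw [lie_nprod (A' := (0 : ℂ) • F.gamma) (B' := ((m : ℂ) / 2) • delta 0)
    (fun p => by simp [h.dphi_gamma]) (h.dphi_dphi m), nsum_smul_left, nprod_mode, nsum_smul_right,
    nsum_delta_right, sub_zero]
  module

theorem minus_lie_dphi (m n : ℤ) :
    ⁅(wakimoto κ F .minus).mode m, F.dphi.mode n⁆ = (κ * n) • F.gamma.mode (m + n - 1) := by
  rw [wakimoto_minus_mode, sub_lie, sub_lie, neg_lie, smul_lie, smul_lie, deriv_mode, smul_lie,
    h.gamma_dphi, nprod_lie_eq_zero (fun p => h.gamma_dphi p n)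
      (fun p => bracket_symm_zero (h.dphi_lie_gb n p)),
    bracket_symm_eq (h.dphi_lie_gamma_dphi n m), add_comm n m]
  module

theorem beta_lie_minus (m n : ℤ) :
    ⁅F.beta.mode m, (wakimoto κ F .minus).mode n⁆ =
      (2 : ℂ) • (wakimoto κ F .zero).mode (m + n) + (level κ * m) • (delta 0).mode (m + n) := by
  rw [wakimoto_minus_mode, lie_sub, lie_sub, lie_neg, lie_smul, lie_smul, h.beta_lie_ggb,
    h.beta_lie_dgamma, h.beta_lie_gamma_nprod m (X' := (0 : ℂ) • F.dphi)
      (fun p => by simp [h.beta_dphi]), wakimoto_zero_mode, nprod_mode _ _ (m + n),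
    nprod_mode _ _ (m + n), nsum_smul_right]
  module

/-- The single contractions cancel up to the displaced ordering point, whose correction is the
double contraction -m. It lowers the level from κ², the contribution of κ ∂φ, to κ² - 2. -/
theorem zero_lie_gb (m n : ℤ) : ⁅(wakimoto κ F .zero).mode m, (nprod F.gamma F.beta).mode n⁆ =
    (-(m : ℂ)) • (delta 0).mode (m + n) := by
  rw [wakimoto_zero_mode, add_lie, smul_lie, h.dphi_lie_gb, smul_zero, add_zero,
    lie_nprod (A' := -F.gamma) (B' := F.beta) (fun p => by rw [h.gb_lie_gamma, neg_mode])
    (h.gb_lie_beta m), nsum_neg_left, nprod_mode,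
    nsum_eq_of_lie_const (X := (delta (-1)).mode (m + n - 1))
      (fun q => by rw [h.gamma_beta, add_sub_cancel]), delta_mode, delta_mode,
    if_congr (show m + n - 1 = -1 ↔ m + n = 0 by omega) rfl rfl]
  module

theorem zero_lie_beta (m n : ℤ) :
    ⁅(wakimoto κ F .zero).mode m, F.beta.mode n⁆ = F.beta.mode (m + n) := by
  rw [wakimoto_zero_mode, add_lie, smul_lie, h.dphi_beta, smul_zero, add_zero, h.gb_lie_beta]

/-- Apart from the terms that match at once, γ_{m+n-1} in field modes occurs with coefficient 2m
(contraction and reordering in :γγβ:), -κ² m (contraction with ∂φ) and -k n. These add up to -k(m +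
n) exactly for k = κ² - 2. -/
theorem zero_lie_minus (m n : ℤ) : ⁅(wakimoto κ F .zero).mode m, (wakimoto κ F .minus).mode n⁆ =
    -(wakimoto κ F .minus).mode (m + n) := by
  have h1 : ∀ p, ⁅(wakimoto κ F .zero).mode m, F.gamma.mode p⁆ = (-F.gamma).mode (m + p) :=
    fun p => by rw [h.zero_lie_gamma, neg_mode]
  rw [wakimoto_minus_mode κ F n, lie_sub, lie_sub, lie_neg, lie_smul, lie_smul, deriv_mode,
    lie_smul, h.zero_lie_gamma, lie_nprod (B' := (-(m : ℂ)) • delta 0) h1 (h.zero_lie_gb κ m),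
    lie_nprod (B' := (κ * m / 2) • delta 0) h1 (h.zero_lie_dphi κ m), wakimoto_minus_mode κ F,
    deriv_mode]
  simp only [nprod_mode _ _ (m + n), nsum_smul_right, nsum_delta_right, nsum_neg_left]
  rw [nsum_eq_of_lie_const (A := F.gamma) (B := nprod F.gamma F.beta)
    (X := F.gamma.mode (m + n - 1))
      (fun q => by rw [h.gamma_lie_gb, add_sub_cancel]),
    nsum_eq_of_lie_const (A := F.gamma) (B := F.dphi) (X := 0) (fun q => h.gamma_dphi _ _),
    ← add_sub_assoc, sub_zero, level]
  push_cast
  module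

theorem minus_lie_gg (m n : ℤ) :
    ⁅(wakimoto κ F .minus).mode m, (nprod F.gamma F.gamma).mode n⁆ =
      nsum (nprod F.gamma F.gamma) F.gamma 0 (m + n - 1)
        + nsum F.gamma (nprod F.gamma F.gamma) 0 (m + n - 1) := by
  rw [lie_nprod (h.minus_lie_gamma κ m) (h.minus_lie_gamma κ m), nprod_mode,
    nsum_eq_of_lie_const (X := 0) (fun q => bracket_symm_zero (h.gamma_lie_gg _ _)), smul_zero,
    add_zero]

/-- A direct expansion is avoided: the bracket commutes with all modes of β, γ and ∂φ by the Jacobi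
identity, hence with J^0_0; but it has weight -2 under J^0_0, so it is zero. -/
theorem minus_lie_minus (m n : ℤ) :
    ⁅(wakimoto κ F .minus).mode m, (wakimoto κ F .minus).mode n⁆ = 0 := by
  have hz : ∀ n, ⁅(wakimoto κ F .zero).mode 0, (wakimoto κ F .minus).mode n⁆ =
      (-1 : ℂ) • (wakimoto κ F .minus).mode n := fun n => by
    rw [h.zero_lie_minus, zero_add, neg_one_smul]
  have hβ : ∀ p, ⁅F.beta.mode p, ⁅(wakimoto κ F .minus).mode m, (wakimoto κ F .minus).mode n⁆⁆
      = 0 := fun p => by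
    rw [leibniz_lie, h.beta_lie_minus, h.beta_lie_minus, add_lie, lie_add, smul_lie, smul_lie,
      lie_smul, lie_smul, delta_lie, lie_delta, h.zero_lie_minus,
      bracket_symm_eq (h.zero_lie_minus κ (p + n) m), show p + n + m = p + m + n by ring]
    module
  have hγ : ∀ p, ⁅F.gamma.mode p, ⁅(wakimoto κ F .minus).mode m, (wakimoto κ F .minus).mode n⁆⁆
      = 0 := fun p => by
    rw [leibniz_lie, bracket_symm_eq (h.minus_lie_gamma κ m p),
      bracket_symm_eq (h.minus_lie_gamma κ n p), lie_neg, h.minus_lie_gg, neg_lie,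
      bracket_symm_eq (h.minus_lie_gg κ n (m + p)), show n + (m + p) = m + (n + p) by ring]
    module
  have ha : ∀ p, ⁅F.dphi.mode p, ⁅(wakimoto κ F .minus).mode m, (wakimoto κ F .minus).mode n⁆⁆
      = 0 := fun p => by
    rw [leibniz_lie, bracket_symm_eq (h.minus_lie_dphi κ m p),
      bracket_symm_eq (h.minus_lie_dphi κ n p), lie_neg, lie_smul, h.minus_lie_gamma, neg_lie,
      smul_lie, bracket_symm_eq (h.minus_lie_gamma κ n _),
      show n + (m + p - 1) = m + (n + p - 1) by ring]
    module
  have h1 : ⁅(wakimoto κ F .zero).mode 0,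
      ⁅(wakimoto κ F .minus).mode m, (wakimoto κ F .minus).mode n⁆⁆ = 0 := by
    rw [wakimoto_zero_mode, add_lie, smul_lie, ha, nprod_lie_eq_zero hγ hβ, smul_zero, add_zero]
  rw [leibniz_lie, hz, hz, smul_lie, lie_smul, ← add_smul] at h1
  exact (smul_eq_zero.1 h1).resolve_left (by norm_num)

/-- The Wakimoto currents satisfy the relations of affine `sl₂` at level `κ² - 2`. -/
theorem isAffine : IsAffine (level κ) (wakimoto κ F) where
  plus_plus := h.beta_beta
  minus_minus := h.minus_lie_minus κ
  zero_plus := h.zero_lie_beta κ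
  zero_minus := h.zero_lie_minus κ
  zero_zero m n := by
    rw [wakimoto_zero_mode κ F n, lie_add, lie_smul, h.zero_lie_gb, h.zero_lie_dphi, level]
    module
  plus_minus := h.beta_lie_minus κ

/-- `γ` is primary of weight zero for the Sugawara field of the Wakimoto currents. -/
theorem gamma_lie_sugawara (hκ : κ ≠ 0) (n N : ℤ) :
    ⁅F.gamma.mode n, (sugawara (level κ) (wakimoto κ F)).mode N⁆ =
      ((n : ℂ) + N) • F.gamma.mode (n + N - 1) := by
  have h0 : ∀ p, ⁅F.gamma.mode n, (wakimoto κ F .zero).mode p⁆ = F.gamma.mode (n + p) :=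
    fun p => by rw [bracket_symm_eq (h.zero_lie_gamma κ p n), neg_neg, add_comm]
  have hp : ∀ p, ⁅F.gamma.mode n, (wakimoto κ F .plus).mode p⁆ = (delta (-1)).mode (n + p) :=
    h.gamma_beta n
  have hm : ∀ p, ⁅F.gamma.mode n, (wakimoto κ F .minus).mode p⁆ =
      (-nprod F.gamma F.gamma).mode (n + p) :=
    fun p => by rw [bracket_symm_eq (h.minus_lie_gamma κ p n), add_comm, neg_mode]
  have hk : level κ + 2 ≠ 0 := by rw [level, sub_add_cancel]; exact pow_ne_zero 2 hκ
  rw [sugawara_mode, lie_smul, lie_add, lie_add, lie_smul, lie_smul, lie_nsum h0 h0,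
    lie_nsum hp hm, lie_nsum hm hp]
  simp only [nsum_delta_left, nsum_delta_right, nsum_neg_left, nsum_neg_right, add_zero]
  -- All products are put with the γ-factors on the left and ordered at 0. The corrections from J^0
  -- and from :γγ:β cancel each other. After `e1` and `e2` the cubic and ∂φ terms cancel as well,
  -- and -(k + 2) ∂γ is left.
  rw [nsum_swap F.gamma (wakimoto κ F .zero), nsum_swap (nprod F.gamma F.gamma)
    (wakimoto κ F .plus), sub_zero,
    nsum_eq_of_lie_const (A := F.gamma) (B := wakimoto κ F .zero)
      (X := F.gamma.mode (n + (N - 1))) (fun p => by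
        rw [bracket_symm_eq (h.zero_lie_gamma κ _ p), sub_add_cancel, neg_neg]) n,
    nsum_eq_of_lie_const (A := F.gamma) (B := wakimoto κ F .zero)
      (X := F.gamma.mode (n + (N - 1))) (fun p => by
        rw [bracket_symm_eq (h.zero_lie_gamma κ _ p), sub_add_cancel, neg_neg]) (n + (N - 1) + 1),
    nsum_eq_of_lie_const (A := nprod F.gamma F.gamma) (B := wakimoto κ F .plus)
      (X := (2 : ℂ) • F.gamma.mode (n + (N - 1))) (fun p => by
        rw [wakimoto_plus_mode, bracket_symm_eq (h.beta_lie_gg _ p), sub_add_cancel]; module) n,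
    nsum_eq_of_lie_const (A := nprod F.gamma F.gamma) (B := wakimoto κ F .plus)
      (X := (2 : ℂ) • F.gamma.mode (n + (N - 1))) (fun p => by
        rw [wakimoto_plus_mode, bracket_symm_eq (h.beta_lie_gg _ p), sub_add_cancel]; module)
      (n + (N - 1) + 1)]
  have e1 : nsum F.gamma (wakimoto κ F .zero) 0 (n + (N - 1)) =
      (nprod F.gamma (nprod F.gamma F.beta)).mode (n + N) +
        κ • (nprod F.gamma F.dphi).mode (n + N) := by
    rw [nprod_mode, nprod_mode, ← nsum_smul_right, ← nsum_add_right, add_sub_assoc]; rfl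
  have e2 : nsum (nprod F.gamma F.gamma) (wakimoto κ F .plus) 0 (n + (N - 1)) =
      (nprod F.gamma (nprod F.gamma F.beta)).mode (n + N) +
        (2 : ℂ) • F.gamma.deriv.mode (n + N) := by
    rw [← h.nprod_gg_beta, nprod_mode, add_sub_assoc]; rfl
  rw [e1, e2, show n + (N - 1) - -1 = n + N by ring, wakimoto_minus_mode, deriv_mode,
    inv_smul_eq_iff₀ hk, ← add_sub_assoc]
  push_cast
  module

end IsCCR

end WakimotoRelations

/-! ### The field `ρ` -/

section Rho

variable {U : Type*} [AddCommGroup U] [Module ℂ U]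

open QField

/-- The Leibniz rule when a bracket multiplies each mode by a scalar depending on its index: the
summand p receives a p + b (N - p). -/
theorem nsum_scale_add (a b : ℤ → ℂ) (A B : QField U) (c N : ℤ) (r : ℂ)
    (h : ∀ p, a p + b (N - p) = r) :
    nsum (A.scale a) B c N + nsum A (B.scale b) c N = r • nsum A B c N := by
  refine LinearMap.ext fun v => ?_
  rw [LinearMap.add_apply, LinearMap.smul_apply]
  simp only [nsum_apply]
  rw [← finsum_add_distrib (finite_nterm _ _ _ _ v) (finite_nterm _ _ _ _ v),
    smul_finsum' r (finite_nterm _ _ _ _ v)]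
  refine finsum_congr fun p => ?_
  simp only [nterm, scale_mode]
  split_ifs <;> simp only [LinearMap.smul_apply, map_smul, ← add_smul, h p]

/-- The product of a field of weight zero and a commuting field of weight one has weight one. -/
theorem lie_nprod_primary {X : Module.End ℂ U} {n : ℤ} {A B : QField U}
    (hA : ∀ p, ⁅X, A.mode p⁆ = (-((p : ℂ) + n + 1)) • A.mode (n + p))
    (hB : ∀ p, ⁅X, B.mode p⁆ = (-(p : ℂ)) • B.mode (n + p))
    (hAB : ∀ p q, ⁅A.mode p, B.mode q⁆ = 0) (N : ℤ) :
    ⁅X, (nprod A B).mode N⁆ = (-(N : ℂ)) • (nprod A B).mode (n + N) := by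
  rw [lie_nprod (A' := A.scale fun q => -((q : ℂ) + 1)) (B' := B.scale fun q => -((q : ℂ) - n))
    (fun p => by rw [hA, scale_mode]; congr 1; push_cast; ring)
    (fun p => by rw [hB, scale_mode]; congr 1; push_cast; ring), nprod_mode, nprod_mode,
    nsum_eq_of_lie_const (X := 0), smul_zero, add_zero]
  · refine nsum_scale_add _ _ _ _ _ _ _ fun p => ?_
    push_cast; ring
  · intro p
    rw [scale_mode, smul_lie, hAB, smul_zero]

/-- The free fields commute with the currents. -/
structure FieldsCommute (F : FreeFields U) (K : Currents U) : Prop where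
  gamma : ∀ a m n, ⁅F.gamma.mode m, (K a).mode n⁆ = 0
  beta : ∀ a m n, ⁅F.beta.mode m, (K a).mode n⁆ = 0
  dphi : ∀ a m n, ⁅F.dphi.mode m, (K a).mode n⁆ = 0

theorem FieldsCommute.wakimoto {F : FreeFields U} {K : Currents U} (h : FieldsCommute F K) (κ : ℂ) :
    CurrentsCommute (wakimoto κ F) K := by
  intro a b m n
  have h1 := nprod_lie_eq_zero (A := F.gamma) (B := F.beta) (fun p => h.gamma b p n)
    (fun p => h.beta b p n)
  cases a
  · exact h.beta b m n
  · rw [wakimoto_zero_mode, add_lie, smul_lie, h.dphi, h1, smul_zero, add_zero]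
  · rw [wakimoto_minus_mode, sub_lie, sub_lie, neg_lie, smul_lie, smul_lie, deriv_mode, smul_lie,
      h.gamma, nprod_lie_eq_zero (fun p => h.gamma b p n) h1,
      nprod_lie_eq_zero (fun p => h.gamma b p n) (fun p => h.dphi b p n)]
    simp

/-- `ρ = γ² K⁺ - 2 γ K⁰ - K⁻ - ∂γ` for a field `γ` and currents `K` on the same space. -/
def rhoField (γ : QField U) (K : Currents U) : QField U :=
  nprod γ (nprod γ (K .plus)) - (2 : ℂ) • nprod γ (K .zero) - K .minus - γ.deriv

theorem rhoField_mode (γ : QField U) (K : Currents U) (n : ℤ) : (rhoField γ K).mode n =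
    (nprod γ (nprod γ (K .plus))).mode n - (2 : ℂ) • (nprod γ (K .zero)).mode n
      - (K .minus).mode n - γ.deriv.mode n := by
  simp only [rhoField, sub_mode, smul_mode]

/-- An operator commuting with the Sugawara field of `K` or of `J`. -/
theorem lie_sugawara_eq_zero (k : ℂ) {J : Currents U} {X : Module.End ℂ U}
    (h : ∀ a n, ⁅X, (J a).mode n⁆ = 0) (N : ℤ) : ⁅X, (sugawara k J).mode N⁆ = 0 := by
  simp only [sugawara, smul_mode, add_mode, lie_smul, lie_add,
    lie_nprod_eq_zero (h _) (h _), smul_zero, add_zero]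

/-- No β occurs in ρ, and γ commutes with itself and with K. -/
theorem gamma_lie_rho {F : FreeFields U} {K : Currents U} (hF : IsCCR F)
    (hFK : FieldsCommute F K) (m n : ℤ) : ⁅F.gamma.mode m, (rhoField F.gamma K).mode n⁆ = 0 := by
  rw [rhoField_mode, lie_sub, lie_sub, lie_sub, lie_smul, deriv_mode, lie_smul, hF.gamma_gamma,
    hFK.gamma, lie_nprod_eq_zero (hF.gamma_gamma m) (hFK.gamma .zero m),
    lie_nprod_eq_zero (hF.gamma_gamma m)
      (lie_nprod_eq_zero (hF.gamma_gamma m) (hFK.gamma .plus m))]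
  simp

/-! ### Brackets of ρ with the total currents and with T^J + T^K -/

section

variable {F : FreeFields U} {K : Currents U} (hF : IsCCR F) (hK : IsAffine 1 K)
  (hFK : FieldsCommute F K) (κ : ℂ)
include hF hK hFK

/-- The mode of β differentiates in γ with a sign, and the mode of K^+ moves K^0 and K^- one step
up; the results cancel. The central terms, from ∂γ and from [K^+, K^-], cancel because K has level
one. -/
theorem plus_lie_rho (m n : ℤ) :
    ⁅F.beta.mode m + (K .plus).mode m, (rhoField F.gamma K).mode n⁆ = 0 := by
  have h0 : ∀ a p, ⁅F.beta.mode m, (K a).mode p⁆ = ((0 : ℂ) • K a).mode (m + p) :=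
    fun a p => by simp [hFK.beta]
  have hz : ∀ p, ⁅(K .plus).mode m, F.gamma.mode p⁆ = ((0 : ℂ) • F.gamma).mode (m + p) :=
    fun p => by simp [bracket_symm_zero (hFK.gamma .plus p m)]
  have hpp : ∀ p, ⁅(K .plus).mode m, (K .plus).mode p⁆ = 0 := hK.plus_plus m
  rw [rhoField_mode, lie_sub, lie_sub, lie_sub, lie_smul, add_lie, add_lie, add_lie, add_lie,
    hF.beta_lie_gamma_nprod m (X' := -K .plus) (fun p => by
      rw [hF.beta_lie_gamma_nprod m (h0 .plus), nprod_mode, nsum_smul_right]; simp),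
    hF.beta_lie_gamma_nprod m (h0 .zero), hFK.beta, hF.beta_lie_dgamma,
    lie_nprod_eq_zero (fun p => bracket_symm_zero (hFK.gamma .plus p m))
      (lie_nprod_eq_zero (fun p => bracket_symm_zero (hFK.gamma .plus p m)) hpp),
    lie_nprod (B' := -K .plus) hz (fun p => by rw [hK.plus_zero, neg_mode]), hK.plus_minus,
    deriv_mode, lie_smul, bracket_symm_zero (hFK.gamma .plus _ m)]
  simp only [nprod_mode _ _ (m + n), nsum_smul_right, nsum_smul_left, nsum_neg_right]
  module

/-- Every monomial of ρ has charge -1. The central term of [K^0, K^0] gives -m γ, which is what ∂γ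
needs for its index to pass from n to m + n; this again uses level one. -/
theorem zero_lie_rho (m n : ℤ) :
    ⁅(wakimoto κ F .zero).mode m + (K .zero).mode m, (rhoField F.gamma K).mode n⁆ =
      -(rhoField F.gamma K).mode (m + n) := by
  have hg : ∀ p, ⁅(wakimoto κ F .zero).mode m + (K .zero).mode m, F.gamma.mode p⁆ =
      (-F.gamma).mode (m + p) := fun p => by
    rw [add_lie, hF.zero_lie_gamma, bracket_symm_zero (hFK.gamma .zero p m), add_zero, neg_mode]
  have hp : ∀ p, ⁅(wakimoto κ F .zero).mode m + (K .zero).mode m, (K .plus).mode p⁆ =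
      (K .plus).mode (m + p) := fun p => by
    rw [add_lie, hFK.wakimoto, hK.zero_plus, zero_add]
  have hz : ∀ p, ⁅(wakimoto κ F .zero).mode m + (K .zero).mode m, (K .zero).mode p⁆ =
      (((m : ℂ) / 2) • delta 0).mode (m + p) := fun p => by
    rw [add_lie, hFK.wakimoto, hK.zero_zero, zero_add, smul_mode, one_mul]
  have hm : ⁅(wakimoto κ F .zero).mode m + (K .zero).mode m, (K .minus).mode n⁆ =
      -(K .minus).mode (m + n) := by
    rw [add_lie, hFK.wakimoto, hK.zero_minus, zero_add]
  have hgp : ∀ p, ⁅(wakimoto κ F .zero).mode m + (K .zero).mode m,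
      (nprod F.gamma (K .plus)).mode p⁆ = ((0 : ℂ) • K .plus).mode (m + p) := fun p => by
    rw [lie_nprod hg hp, nsum_neg_left, nsum_eq_of_comm (hFK.gamma .plus), sub_add_cancel]; simp
  rw [rhoField_mode, lie_sub, lie_sub, lie_sub, lie_smul, lie_nprod hg hgp, lie_nprod hg hz, hm,
    deriv_mode, lie_smul, hg]
  simp only [nsum_neg_left]
  rw [nsum_eq_of_comm (hFK.gamma .zero), sub_add_cancel, nsum_eq_of_comm (fun p q =>
      lie_nprod_eq_zero (hF.gamma_gamma p) (hFK.gamma .plus p) q), sub_add_cancel,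
    nprod_mode _ ((0 : ℂ) • K .plus), nsum_smul_right, nprod_mode _ (_ • delta 0), nsum_smul_right,
    nsum_delta_right, rhoField_mode, deriv_mode, neg_mode, sub_zero, ← add_sub_assoc]
  push_cast
  module

/-- The adjoint action sends γ to γ², K^+ to -2K^0 plus a central term, K^0 to K^-, and K^- to 0.
Collecting terms gives 2γ times the first three terms of ρ, together with (m + n) :γγ:, which equals
-2 :γ∂γ:. -/
theorem minus_lie_rho (m n : ℤ) :
    ⁅(wakimoto κ F .minus).mode m + (K .minus).mode m, (rhoField F.gamma K).mode n⁆ =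
      (2 : ℂ) • (nprod F.gamma (rhoField F.gamma K)).mode (m + n) := by
  have hg : ∀ p, ⁅(wakimoto κ F .minus).mode m + (K .minus).mode m, F.gamma.mode p⁆ =
      (nprod F.gamma F.gamma).mode (m + p) := fun p => by
    rw [add_lie, hF.minus_lie_gamma, bracket_symm_zero (hFK.gamma .minus p m), add_zero]
  have hp : ∀ p, ⁅(wakimoto κ F .minus).mode m + (K .minus).mode m, (K .plus).mode p⁆ =
      ((-2 : ℂ) • K .zero + (m : ℂ) • delta 0).mode (m + p) := fun p => by
    rw [add_lie, hFK.wakimoto, hK.minus_plus, zero_add, one_mul]; rfl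
  have hz : ∀ p, ⁅(wakimoto κ F .minus).mode m + (K .minus).mode m, (K .zero).mode p⁆ =
      (K .minus).mode (m + p) := fun p => by
    rw [add_lie, hFK.wakimoto, hK.minus_zero, zero_add]
  have hm : ⁅(wakimoto κ F .minus).mode m + (K .minus).mode m, (K .minus).mode n⁆ = 0 := by
    rw [add_lie, hFK.wakimoto, hK.minus_minus, zero_add]
  have cgg : ∀ a p q, ⁅(nprod F.gamma F.gamma).mode p, (K a).mode q⁆ = 0 := fun a p q =>
    nprod_lie_eq_zero (fun r => hFK.gamma a r q) (fun r => hFK.gamma a r q) p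
  have cggk : ∀ p q, ⁅(nprod F.gamma F.gamma).mode p, (nprod F.gamma (K .plus)).mode q⁆ = 0 :=
    fun p q => lie_nprod_eq_zero (fun r => bracket_symm_zero (hF.gamma_lie_gg r p)) (cgg _ p) q
  have hgp : ∀ p, ⁅(wakimoto κ F .minus).mode m + (K .minus).mode m,
      (nprod F.gamma (K .plus)).mode p⁆ = (nprod F.gamma (nprod F.gamma (K .plus))
        - (2 : ℂ) • nprod F.gamma (K .zero) + (m : ℂ) • F.gamma.shift 1).mode (m + p) := fun p => by
    rw [lie_nprod hg hp, nsum_eq_of_comm (cgg _), sub_add_cancel,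
      hF.nprod_gg_eq (hFK.beta _) (hFK.gamma _), nprod_mode _ (_ + _), nsum_add_right,
      nsum_smul_right, nsum_smul_right, nsum_delta_right, sub_zero, add_mode, sub_mode, smul_mode,
      smul_mode, shift_mode, nprod_mode F.gamma (K .zero)]
    module
  have e : (2 : ℂ) • nsum F.gamma F.gamma.deriv 0 (m + n - 1) =
      (-((m : ℂ) + n)) • nsum F.gamma F.gamma 0 (m + n - 1 - 1) := by
    rw [← nprod_mode, ← nprod_mode, hF.nprod_gamma_dgamma]; push_cast; rfl
  -- The shifted field carries the central term of [K^-, K^+] after it has been multiplied by γ,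
  -- where the total index drops by one.
  have e' : nsum F.gamma (F.gamma.shift 1) 0 (m + n - 1) =
      nsum F.gamma F.gamma 0 (m + n - 1 - 1) := by
    refine LinearMap.ext fun v => ?_
    simp only [nsum_apply, nterm, shift_mode]
    refine finsum_congr fun p => ?_
    rw [show m + n - 1 - p - 1 = m + n - 1 - 1 - p by ring]
  rw [rhoField_mode, lie_sub, lie_sub, lie_sub, lie_smul, lie_nprod hg hgp, lie_nprod hg hz, hm,
    deriv_mode, lie_smul, hg, nsum_eq_of_comm (cgg _), nsum_eq_of_comm cggk, sub_add_cancel,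
    hF.nprod_gg_eq (hFK.beta _) (hFK.gamma _), hF.nprod_gg_gamma_eq (hFK.beta _) (hFK.gamma _),
    rhoField]
  simp only [nprod_mode _ _ (m + n), nprod_mode _ _ (m + (n - 1)), nsum_add_right, nsum_sub_right,
    nsum_smul_right, e']
  rw [← add_sub_assoc m n 1]
  simp only [smul_sub, e]
  module

/-- Here γ has weight zero and K weight one, so each term of ρ is primary of weight one. Mode N of a
Sugawara field is L_{N-1}, hence the index N - 1 + n. -/
theorem rho_lie_sugawara (hκ : κ ≠ 0) (N n : ℤ) :
    ⁅(sugawara (level κ) (wakimoto κ F)).mode N + (sugawara 1 K).mode N,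
      (rhoField F.gamma K).mode n⁆ = (-(n : ℂ)) • (rhoField F.gamma K).mode (N - 1 + n) := by
  set X := (sugawara (level κ) (wakimoto κ F)).mode N + (sugawara 1 K).mode N with hX
  have hg : ∀ p, ⁅X, F.gamma.mode p⁆ =
      (-((p : ℂ) + (N - 1 : ℤ) + 1)) • F.gamma.mode (N - 1 + p) := fun p => by
    rw [hX, add_lie, bracket_symm_eq (hF.gamma_lie_sugawara κ hκ p N),
      bracket_symm_zero (lie_sugawara_eq_zero 1 (fun a q => hFK.gamma a p q) N), add_zero,
      show p + N - 1 = N - 1 + p by ring]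
    push_cast; module
  have hk : ∀ a p, ⁅X, (K a).mode p⁆ = (-(p : ℂ)) • (K a).mode (N - 1 + p) := fun a p => by
    rw [hX, add_lie, bracket_symm_eq (hK.lie_sugawara (by norm_num) a p N),
      bracket_symm_zero (lie_sugawara_eq_zero (level κ)
        (fun b q => bracket_symm_zero (hFK.wakimoto κ b a q p)) N), zero_add,
      show p + N - 1 = N - 1 + p by ring]
    module
  rw [rhoField_mode, lie_sub, lie_sub, lie_sub, lie_smul, hk, deriv_mode, lie_smul, hg,
    lie_nprod_primary hg (hk .zero) (hFK.gamma _),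
    lie_nprod_primary hg (lie_nprod_primary hg (hk .plus) (hFK.gamma _))
      (fun p q => lie_nprod_eq_zero (hF.gamma_gamma p) (hFK.gamma .plus p) q), rhoField_mode,
    deriv_mode, ← add_sub_assoc]
  push_cast
  module

end

end Rho

/-! ### Highest weight vectors generated by `ρ` -/

section Chain

variable {U : Type*} [AddCommGroup U] [Module ℂ U]

open QField

/-- The threshold c of annihilation for A may lie below 0. The normal ordering then leaves modes c ≤
p < 0 of A on the left although they annihilate v, and these need the separate hypothesis. -/
theorem nprod_apply_eq_zero {A B : QField U} {v : U} {c n : ℤ} (hc : c ≤ 0)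
    (hA : ∀ p, c ≤ p → A.mode p v = 0) (hB : ∀ p, n - c ≤ p → B.mode p v = 0)
    (hAB : ∀ p, c ≤ p → p < 0 → A.mode p (B.mode (n - 1 - p) v) = 0) :
    (nprod A B).mode n v = 0 := by
  rw [nprod_mode, nsum_apply]
  refine finsum_eq_zero_of_forall_eq_zero fun p => ?_
  rw [nterm]
  split_ifs with h
  · by_cases hp : c ≤ p
    · exact hAB p hp h
    · rw [hB _ (by omega), map_zero]
  · rw [hA _ (by omega), map_zero]

/-- `v` is a vacuum vector for the free fields, annihilated by `γₙ` for `n ≥ 1 - t` and by `βₙ`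
for `n ≥ t`. -/
structure IsVacuum (F : FreeFields U) (t : ℤ) (α : ℂ) (v : U) : Prop where
  gamma : ∀ p, -t ≤ p → F.gamma.mode p v = 0
  beta : ∀ p, t ≤ p → F.beta.mode p v = 0
  dphi : ∀ p, 0 < p → F.dphi.mode p v = 0
  dphi_zero : F.dphi.mode 0 v = α • v

theorem IsVacuum.isHighestWeight {F : FreeFields U} {α : ℂ} {v : U} (hv : IsVacuum F 0 α v)
    (κ : ℂ) : IsHighestWeight (wakimoto κ F) (κ * α) v := by
  have hgb : ∀ n, 0 ≤ n → (nprod F.gamma F.beta).mode n v = 0 := fun n hn =>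
    nprod_apply_eq_zero (c := 0) le_rfl (fun p hp => hv.gamma p (by omega))
      (fun p hp => hv.beta p (by omega)) (fun p hp hp' => by omega)
  refine ⟨fun a m hm => ?_, hv.beta 0 le_rfl, ?_⟩
  · cases a
    · exact hv.beta m hm.le
    · rw [wakimoto_zero_mode, LinearMap.add_apply, LinearMap.smul_apply, hgb m hm.le,
        hv.dphi m hm, smul_zero, add_zero]
    · rw [wakimoto_minus_mode]
      simp only [LinearMap.sub_apply, LinearMap.neg_apply, LinearMap.smul_apply, deriv_mode]
      rw [hv.gamma _ (by omega),
        nprod_apply_eq_zero (c := 0) le_rfl (fun p hp => hv.gamma p (by omega))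
          (fun p hp => hgb p (by omega)) (fun p hp hp' => by omega),
        nprod_apply_eq_zero (c := 0) le_rfl (fun p hp => hv.gamma p (by omega))
          (fun p hp => hv.dphi p (by omega)) (fun p hp hp' => by omega)]
      simp
  · rw [wakimoto_zero_mode, LinearMap.add_apply, LinearMap.smul_apply, hgb 0 le_rfl,
      hv.dphi_zero, zero_add, mul_smul]

/-- On this vacuum γ_0 annihilates but stands on the left in the normal ordering, being mode -1 of
the field. This adds 1 to the charge and so turns the momentum -κ⁻¹(j + 1) of the dual module into
the weight j. -/
theorem IsVacuum.isHighestWeight_swap {F : FreeFields U} (hF : IsCCR F) {α : ℂ} {v : U}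
    (hv : IsVacuum F 1 α v) (κ : ℂ) :
    IsHighestWeight (swap (wakimoto κ F)) (-(1 + κ * α)) v := by
  have hgb : ∀ n, 0 < n → (nprod F.gamma F.beta).mode n v = 0 := fun n hn =>
    nprod_apply_eq_zero (c := 0) le_rfl (fun p hp => hv.gamma p (by omega))
      (fun p hp => hv.beta p (by omega)) (fun p hp hp' => by omega)
  have hgb0 : (nprod F.gamma F.beta).mode 0 v = v := by
    -- Only the summand γ_0 β_0 survives, and it acts as the commutator [γ_0, β_0] = 1.
    rw [nprod_mode, nsum_apply, finsum_eq_single _ (-1)]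
    · rw [nterm, if_pos (by norm_num), apply_apply_eq, hv.gamma _ le_rfl, hF.gamma_beta]
      simp [delta_mode]
    · intro p hp
      rw [nterm]
      split_ifs with h
      · rw [hv.beta _ (by omega), map_zero]
      · rw [hv.gamma _ (by omega), map_zero]
  have hd : ∀ m, 0 ≤ m → F.gamma.mode (-1) (F.dphi.mode m v) = 0 := fun m hm => by
    rw [apply_comm_of_bracket_eq_zero (hF.gamma_dphi _ _), hv.gamma _ le_rfl, map_zero]
  have hgm : ∀ m, 0 ≤ m → F.gamma.mode (-1) ((nprod F.gamma F.beta).mode m v) = 0 := fun m hm => by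
    rcases hm.eq_or_lt with rfl | hm
    · rw [hgb0, hv.gamma _ le_rfl]
    · rw [hgb m hm, map_zero]
  have hm : ∀ m, 0 ≤ m → (wakimoto κ F .minus).mode m v = 0 := fun m hm => by
    rw [wakimoto_minus_mode]
    simp only [LinearMap.sub_apply, LinearMap.neg_apply, LinearMap.smul_apply, deriv_mode]
    rw [hv.gamma _ (by omega),
      -- The exceptional summand p = -1 has γ_0 on the left: `hgm` and `hd` dispose of it for the
      -- two products.
      nprod_apply_eq_zero (c := -1) (by norm_num) (fun p hp => hv.gamma p (by omega))
        (fun p hp => hgb p (by omega))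
        (fun p hp hp' => by obtain rfl : p = -1 := by omega
                            exact hgm _ (by omega)),
      nprod_apply_eq_zero (c := -1) (by norm_num) (fun p hp => hv.gamma p (by omega))
        (fun p hp => hv.dphi p (by omega))
        (fun p hp hp' => by obtain rfl : p = -1 := by omega
                            exact hd _ (by omega))]
    simp
  refine ⟨fun a m hm' => ?_, ?_, ?_⟩
  · cases a
    · simp [swap, hm m hm'.le]
    · simp [swap, wakimoto_zero_mode, hgb m hm', hv.dphi m hm']
    · simp [swap, wakimoto_plus_mode, hv.beta m hm']
  · simp [swap, hm 0 le_rfl]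
  · simp only [swap, neg_mode, wakimoto_zero_mode, LinearMap.neg_apply, LinearMap.add_apply,
      LinearMap.smul_apply, hgb0, hv.dphi_zero]
    module

/-- Highest weight conditions for the currents `J + K` and `T^J + T^K`, together with the vanishing
of the annihilation modes of `γ`. For `t = 0` the Borel subalgebra is the standard one, for `t = 1`
it is the one obtained by exchanging `+` and `-`. -/
structure IsTop (κ : ℂ) (F : FreeFields U) (K : Currents U) (t : ℤ) (l h : ℂ) (v : U) : Prop where
  gamma : ∀ p, -t ≤ p → F.gamma.mode p v = 0
  plus : ∀ m, t ≤ m → (F.beta.mode m + (K .plus).mode m) v = 0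
  zero : ∀ m, 0 < m → ((wakimoto κ F .zero).mode m + (K .zero).mode m) v = 0
  weight : ((wakimoto κ F .zero).mode 0 + (K .zero).mode 0) v = l • v
  minus : ∀ m, 1 - t ≤ m → ((wakimoto κ F .minus).mode m + (K .minus).mode m) v = 0
  vir : ∀ N, 1 < N →
    ((sugawara (level κ) (wakimoto κ F)).mode N + (sugawara 1 K).mode N) v = 0
  vir_weight : ((sugawara (level κ) (wakimoto κ F)).mode 1 + (sugawara 1 K).mode 1) v = h • v

variable {F : FreeFields U} {K : Currents U} (hF : IsCCR F) (hK : IsAffine 1 K)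
  (hFK : FieldsCommute F K) {κ : ℂ}
include hF hK

theorem isTop_of_isHighestWeight {α j ε : ℂ} {v : U} (hv : IsVacuum F 0 α v)
    (hj : κ * α = j) (hKv : IsHighestWeight K ε v) :
    IsTop κ F K 0 (j + ε) (j * (j + 1) / (level κ + 2) + ε * (ε + 1) / 3) v := by
  have hJv := hv.isHighestWeight κ
  rw [hj] at hJv
  have hJ := hF.isAffine κ
  have h3 : (1 : ℂ) + 2 = 3 := by norm_num
  have hp : ∀ {J : Currents U} {l : ℂ}, IsHighestWeight J l v → ∀ m, 0 ≤ m → (J .plus).mode m v = 0 :=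
    fun hJ m hm => by
      rcases hm.eq_or_lt with rfl | hm
      · exact hJ.plus
      · exact hJ.pos _ _ hm
  refine ⟨hv.gamma, fun m hm => ?_, fun m hm => ?_, ?_, fun m hm => ?_, fun N hN => ?_, ?_⟩ <;>
    rw [LinearMap.add_apply]
  · rw [hp hKv m hm, hv.beta m hm, add_zero]
  · rw [hJv.pos _ _ hm, hKv.pos _ _ hm, add_zero]
  · rw [hJv.zero, hKv.zero, add_smul]
  · rw [hJv.pos _ _ (by omega), hKv.pos _ _ (by omega), add_zero]
  · rw [hJv.sugawara_pos hJ hN, hKv.sugawara_pos hK hN, add_zero]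
  · rw [hJv.sugawara_zero hJ, hKv.sugawara_zero hK, add_smul, h3]

theorem isTop_of_isHighestWeight_swap {α j ε : ℂ} {v : U} (hv : IsVacuum F 1 α v)
    (hj : -(1 + κ * α) = j) (hKv : IsHighestWeight (swap K) ε v) :
    IsTop κ F K 1 (-(j + ε)) (j * (j + 1) / (level κ + 2) + ε * (ε + 1) / 3) v := by
  have hJv := hv.isHighestWeight_swap hF κ
  rw [hj] at hJv
  have hJ := (hF.isAffine κ).swap
  have h3 : (1 : ℂ) + 2 = 3 := by norm_num
  have hm' : ∀ {J : Currents U} {l : ℂ}, IsHighestWeight (swap J) l v →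
      ∀ m, 0 ≤ m → (J .minus).mode m v = 0 := fun {J l} hJ m hm => by
    rw [← neg_eq_zero, ← LinearMap.neg_apply, ← neg_mode]
    rcases hm.eq_or_lt with rfl | hm
    · exact hJ.plus
    · exact hJ.pos .plus _ hm
  have hz' : ∀ {J : Currents U} {l : ℂ}, IsHighestWeight (swap J) l v →
      ∀ m, 0 < m → (J .zero).mode m v = 0 := fun {J l} hJ m hm => by
    rw [← neg_eq_zero, ← LinearMap.neg_apply, ← neg_mode]
    exact hJ.pos .zero _ hm
  have hw' : ∀ {J : Currents U} {l : ℂ}, IsHighestWeight (swap J) l v →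
      (J .zero).mode 0 v = (-l) • v := fun {J l} hJ => by
    have := hJ.zero
    rw [show swap J .zero = -J .zero from rfl, neg_mode, LinearMap.neg_apply] at this
    rw [neg_smul, ← this, neg_neg]
  refine ⟨hv.gamma, fun m hm => ?_, fun m hm => ?_, ?_, fun m hm => ?_, fun N hN => ?_, ?_⟩ <;>
    rw [LinearMap.add_apply]
  · have := hKv.pos .minus m (by omega)
    rw [show swap K .minus = -K .plus from rfl, neg_mode, LinearMap.neg_apply, neg_eq_zero] at this
    rw [this, hv.beta m hm, add_zero]
  · rw [hz' hJv m hm, hz' hKv m hm, add_zero]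
  · rw [hw' hJv, hw' hKv]; module
  · rw [hm' hJv m (by omega), hm' hKv m (by omega), add_zero]
  · rw [← sugawara_swap, ← sugawara_swap 1 K, hJv.sugawara_pos hJ hN, hKv.sugawara_pos hK.swap hN,
      add_zero]
  · rw [← sugawara_swap, ← sugawara_swap 1 K, hJv.sugawara_zero hJ, hKv.sugawara_zero hK.swap,
      add_smul, h3]

include hFK

/-- Moving each annihilation operator past ρ_s leaves either nothing or a mode of ρ of index greater
than s, which kills v by `hs`. Only the two weights see the bracket at index s itself. -/
theorem IsTop.rho (hκ : κ ≠ 0) {t : ℤ} (ht : 0 ≤ t) {l h : ℂ} {v : U}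
    (hv : IsTop κ F K t l h v) {s : ℤ} (hs : ∀ m, s < m → (rhoField F.gamma K).mode m v = 0) :
    IsTop κ F K t (l - 1) (h - s) ((rhoField F.gamma K).mode s v) where
  gamma p hp := by
    rw [apply_comm_of_bracket_eq_zero (gamma_lie_rho hF hFK p s), hv.gamma p hp, map_zero]
  plus m hm := by
    rw [apply_comm_of_bracket_eq_zero (plus_lie_rho hF hK hFK m s), hv.plus m hm, map_zero]
  zero m hm := by
    rw [apply_apply_eq, zero_lie_rho hF hK hFK, hv.zero m hm, map_zero, LinearMap.neg_apply,
      hs _ (by omega), neg_zero, add_zero]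
  weight := by
    rw [apply_apply_eq, zero_lie_rho hF hK hFK, hv.weight, zero_add, map_smul,
      LinearMap.neg_apply]
    module
  -- The commutator is 2 :γρ:_{m+s}. Its γ-modes of index at least -t kill v, also from the left
  -- since γ commutes with ρ. The others are paired with ρ_p for p ≥ m + s + t, and m ≥ 1 - t makes
  -- p > s.
  minus m hm := by
    rw [apply_apply_eq, minus_lie_rho hF hK hFK, hv.minus m hm, map_zero, LinearMap.smul_apply,
      nprod_apply_eq_zero (c := -t) (by omega) hv.gamma (fun p hp => hs p (by omega)), smul_zero,
      add_zero]
    intro p hp _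
    rw [apply_comm_of_bracket_eq_zero (gamma_lie_rho hF hFK p _), hv.gamma p hp, map_zero]
  vir N hN := by
    rw [apply_apply_eq, rho_lie_sugawara hF hK hFK κ hκ, hv.vir N hN, map_zero,
      LinearMap.smul_apply, hs _ (by omega), smul_zero, add_zero]
  vir_weight := by
    rw [apply_apply_eq, rho_lie_sugawara hF hK hFK κ hκ, hv.vir_weight, map_smul, sub_self,
      zero_add, LinearMap.smul_apply]
    module

theorem IsTop.chain (hκ : κ ≠ 0) {t : ℤ} (ht : 0 ≤ t) {l h : ℂ} {v : U}
    (hv : IsTop κ F K t l h v) {s : ℕ → ℤ}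
    (hs : ∀ i m, s i < m →
      (rhoField F.gamma K).mode m (modeChain (rhoField F.gamma K) s v i) = 0) (n : ℕ) :
    IsTop κ F K t (l - n) (h - ∑ i ∈ Finset.range n, (s i : ℂ))
      (modeChain (rhoField F.gamma K) s v n) := by
  induction n with
  | zero => simpa [modeChain] using hv
  | succ n ih =>
    have := ih.rho hF hK hFK hκ ht (hs n)
    rwa [sub_sub, sub_sub, ← Finset.sum_range_succ, ← Nat.cast_succ] at this

end Chain

/-! ### Polynomials in commuting creation operators -/

section PolynomialMap

variable {V H : Type*} [AddCommGroup V] [Module ℂ V] [AddCommGroup H] [Module ℂ H]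

open MvPolynomial

/-- Commuting operators applied to a vector define a linear map on polynomials. -/
theorem exists_polynomial_map (g : ℕ → Module.End ℂ V) (hg : ∀ m n, ⁅g m, g n⁆ = 0) (w : V) :
    ∃ σ : MvPolynomial ℕ ℂ →ₗ[ℂ] V, σ 1 = w ∧ ∀ n p, σ (p * X n) = g n (σ p) := by
  -- Polynomial evaluation needs a commutative target, here the subalgebra generated by the
  -- operators.
  have : IsMulCommutative (Algebra.adjoin ℂ (Set.range g)) :=
    Algebra.isMulCommutative_adjoin ℂ (by
      rintro _ ⟨m, rfl⟩ _ ⟨n, rfl⟩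
      exact sub_eq_zero.1 (hg m n))
  let _ : CommSemiring (Algebra.adjoin ℂ (Set.range g)) :=
    { (Algebra.adjoin ℂ (Set.range g)).toSemiring with mul_comm := this.is_comm.comm }
  let e : MvPolynomial ℕ ℂ →ₐ[ℂ] Algebra.adjoin ℂ (Set.range g) :=
    aeval fun n => ⟨g n, Algebra.subset_adjoin ⟨n, rfl⟩⟩
  refine ⟨(LinearMap.applyₗ w).comp
    ((Algebra.adjoin ℂ (Set.range g)).val.toLinearMap.comp e.toLinearMap), ?_, fun n p => ?_⟩
  · change (Algebra.adjoin ℂ (Set.range g)).val (e 1) w = w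
    rw [map_one, map_one]; rfl
  · change (Algebra.adjoin ℂ (Set.range g)).val (e (p * X n)) w =
      g n ((Algebra.adjoin ℂ (Set.range g)).val (e p) w)
    rw [mul_comm, map_mul, map_mul, Module.End.mul_apply]
    congr 1
    simp [e]

/-- Creation operators `g n`, conjugate annihilation operators `b n`, a vacuum vector `w` and a
vacuum functional `φ`. -/
structure IsPolynomialVacuum (g b : ℕ → Module.End ℂ V) (φ : V →ₗ[ℂ] ℂ) (w : V) : Prop where
  comm : ∀ m n, ⁅g m, g n⁆ = 0
  conj : ∀ m n, ⁅b m, g n⁆ = if m = n then -1 else 0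
  vac : ∀ n, b n w = 0
  func : ∀ n v, φ (g n v) = 0
  one : φ w = 1

theorem polynomial_map_apply_eq_zero {g : ℕ → Module.End ℂ V} {w : V}
    {σ : MvPolynomial ℕ ℂ →ₗ[ℂ] V} (h1 : σ 1 = w) (hX : ∀ n p, σ (p * X n) = g n (σ p))
    {A : Module.End ℂ V} (hA : ∀ n, ⁅A, g n⁆ = 0) (hw : A w = 0) (p : MvPolynomial ℕ ℂ) :
    A (σ p) = 0 := by
  induction p using MvPolynomial.induction_on with
  | C a => rw [show (C a : MvPolynomial ℕ ℂ) = a • 1 by rw [← C_mul', mul_one], map_smul, map_smul,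
      h1, hw, smul_zero]
  | add p q hp hq => rw [map_add, map_add, hp, hq, add_zero]
  | mul_X p n ih => rw [hX, apply_comm_of_bracket_eq_zero (hA n), ih, map_zero]

namespace IsPolynomialVacuum

variable {g b : ℕ → Module.End ℂ V} {φ : V →ₗ[ℂ] ℂ} {w : V} (h : IsPolynomialVacuum g b φ w)
  {σ : MvPolynomial ℕ ℂ →ₗ[ℂ] V} (h1 : σ 1 = w) (hX : ∀ n p, σ (p * X n) = g n (σ p))
include h h1 hX

/-- By the canonical commutation relations and the annihilation of the vacuum, b_m is minus a
partial derivative in polynomial coordinates. -/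
theorem apply_polynomial_map (m : ℕ) (p : MvPolynomial ℕ ℂ) : b m (σ p) = -σ (pderiv m p) := by
  induction p using MvPolynomial.induction_on with
  | C a => rw [show (C a : MvPolynomial ℕ ℂ) = a • 1 by rw [← C_mul', mul_one], map_smul, map_smul,
      h1, h.vac, smul_zero, Derivation.map_smul, pderiv_one, smul_zero, map_zero, neg_zero]
  | add p q hp hq => rw [map_add, map_add, hp, hq, map_add, map_add, neg_add]
  | mul_X p n ih =>
    rw [hX, apply_apply_eq, ih, map_neg, ← hX, h.conj, pderiv_mul, map_add, pderiv_X]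
    split_ifs with e
    · subst e; simp [add_comm]
    · simp [e]

theorem functional_polynomial_map (p : MvPolynomial ℕ ℂ) : φ (σ p) = constantCoeff p := by
  induction p using MvPolynomial.induction_on with
  | C a => rw [show (C a : MvPolynomial ℕ ℂ) = a • 1 by rw [← C_mul', mul_one], map_smul, map_smul,
      h1, h.one, smul_eq_mul, mul_one]; simp
  | add p q hp hq => rw [map_add, map_add, hp, hq, map_add]
  | mul_X p n ih => rw [hX, h.func]; simp

/-- Taylor's formula: differentiating by the monomial α and taking the constant term recovers the
coefficient at α up to a factorial and a sign. Hence the annihilation operators and φ separate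
polynomials. -/
theorem exists_functional_eq_coeff (α : ℕ →₀ ℕ) : ∃ (l : List ℕ) (c : ℂ), c ≠ 0 ∧
    ∀ p, φ (l.foldr (fun n v => b n v) (σ p)) = c * coeff α p := by
  have step : ∀ (α : ℕ →₀ ℕ) (n : ℕ), (∃ (l : List ℕ) (c : ℂ), c ≠ 0 ∧
      ∀ p, φ (l.foldr (fun n v => b n v) (σ p)) = c * coeff α p) →
      ∃ (l : List ℕ) (c : ℂ), c ≠ 0 ∧
        ∀ p, φ (l.foldr (fun n v => b n v) (σ p)) = c * coeff (α + Finsupp.single n 1) p := by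
    rintro α n ⟨l, c, hc, hl⟩
    refine ⟨l ++ [n], -(c * (α n + 1)), neg_ne_zero.2 (mul_ne_zero hc (Nat.cast_add_one_ne_zero _)), fun p => ?_⟩
    rw [List.foldr_append, List.foldr_cons, List.foldr_nil, h.apply_polynomial_map h1 hX, ← map_neg,
      hl, coeff_neg, coeff_pderiv]
    ring
  induction α using Finsupp.induction with
  | zero => exact ⟨[], 1, one_ne_zero, fun p => by
      rw [List.foldr_nil, functional_polynomial_map h h1 hX, one_mul]; rfl⟩
  | single_add a k f ha hb ih =>
    clear hb
    induction k with
    | zero => rwa [Finsupp.single_zero, zero_add]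
    | succ k ihk =>
      rw [Finsupp.single_add, add_right_comm]
      exact step _ _ ihk

end IsPolynomialVacuum

/-- The map `φ ⊗ 1` from `V ⊗ H` to `H`. -/
def contractLeft (H : Type*) [AddCommGroup H] [Module ℂ H] (φ : V →ₗ[ℂ] ℂ) : V ⊗[ℂ] H →ₗ[ℂ] H :=
  (TensorProduct.lid ℂ H).toLinearMap.comp (LinearMap.rTensor H φ)

@[simp] theorem contractLeft_tmul (φ : V →ₗ[ℂ] ℂ) (v : V) (x : H) :
    contractLeft H φ (v ⊗ₜ x) = φ v • x := by simp [contractLeft]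

theorem contractLeft_lTensor (φ : V →ₗ[ℂ] ℂ) (A : Module.End ℂ H) (y : V ⊗[ℂ] H) :
    contractLeft H φ (LinearMap.lTensor V A y) = A (contractLeft H φ y) := by
  induction y using TensorProduct.induction_on with
  | zero => simp
  | tmul v x => simp
  | add x y hx hy => simp only [map_add, hx, hy]

theorem rTensor_lTensor (A : Module.End ℂ V) (B : Module.End ℂ H) (y : V ⊗[ℂ] H) :
    LinearMap.rTensor H A (LinearMap.lTensor V B y) =
      LinearMap.lTensor V B (LinearMap.rTensor H A y) := by
  rw [← LinearMap.comp_apply, ← LinearMap.comp_apply, LinearMap.rTensor_comp_lTensor,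
    LinearMap.lTensor_comp_rTensor]

theorem contractLeft_rTensor (φ : V →ₗ[ℂ] ℂ) (A : Module.End ℂ V) (y : V ⊗[ℂ] H) :
    contractLeft H φ (LinearMap.rTensor H A y) = contractLeft H (φ.comp A) y := by
  induction y using TensorProduct.induction_on with
  | zero => simp
  | tmul v x => simp
  | add x y hx hy => simp only [map_add, hx, hy]

/-- Monomials form a basis of the polynomial ring, so a tensor is determined by its H-valued
coefficients. -/
theorem eq_zero_of_contractLeft_lcoeff {z : MvPolynomial ℕ ℂ ⊗[ℂ] H}
    (hz : ∀ α, contractLeft H (lcoeff ℂ α) z = 0) : z = 0 := by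
  classical
  refine (TensorProduct.equivFinsuppOfBasisLeft (basisMonomials ℕ ℂ)).map_eq_zero_iff.1 ?_
  ext α
  rw [Finsupp.zero_apply, ← hz α]
  clear hz
  induction z using TensorProduct.induction_on with
  | zero => simp
  | tmul v x =>
    rw [TensorProduct.equivFinsuppOfBasisLeft_apply_tmul_apply, contractLeft_tmul]; rfl
  | add x y hx hy => simp only [map_add, hx, hy, Finsupp.add_apply]

/-- A vector built from the vacuum by polynomials in the creation operators and satisfying the
differential equations `(b n + K n) y = 0` is determined by its vacuum component. -/
theorem IsPolynomialVacuum.eq_zero_of_contractLeft {g b : ℕ → Module.End ℂ V} {φ : V →ₗ[ℂ] ℂ}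
    {w : V} (h : IsPolynomialVacuum g b φ w) {σ : MvPolynomial ℕ ℂ →ₗ[ℂ] V} (h1 : σ 1 = w)
    (hX : ∀ n p, σ (p * X n) = g n (σ p)) (K : ℕ → Module.End ℂ H) {y : V ⊗[ℂ] H}
    (hy : y ∈ LinearMap.range (LinearMap.rTensor H σ))
    (hb : ∀ n, LinearMap.rTensor H (b n) y + LinearMap.lTensor V (K n) y = 0)
    (h0 : contractLeft H φ y = 0) : y = 0 := by
  -- The rightmost b_n acts first and may be traded for -K_n, which commutes with the remaining b's
  -- and with φ ⊗ 1. So the vanishing of the vacuum component propagates to all Taylor coefficients.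
  have key : ∀ l : List ℕ,
      contractLeft H φ (LinearMap.rTensor H (l.foldr (fun n A => b n * A) 1) y) = 0 := by
    intro l
    induction l using List.reverseRecOn with
    | nil => rw [List.foldr_nil, Module.End.one_eq_id, LinearMap.rTensor_id]; exact h0
    | append_singleton l n ih =>
      have e : l.foldr (fun n A => b n * A) (b n) = l.foldr (fun n A => b n * A) 1 * b n := by
        clear ih
        induction l with
        | nil => simp
        | cons a l ih => rw [List.foldr_cons, List.foldr_cons, ih, mul_assoc]
      rw [List.foldr_append, List.foldr_cons, List.foldr_nil, mul_one, e,
        Module.End.mul_eq_comp, LinearMap.rTensor_comp, LinearMap.comp_apply,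
        eq_neg_of_add_eq_zero_left (hb n), map_neg, map_neg, rTensor_lTensor, contractLeft_lTensor, ih, map_zero, neg_zero]
  obtain ⟨z, rfl⟩ := hy
  rw [eq_zero_of_contractLeft_lcoeff (z := z) fun α => ?_, map_zero]
  obtain ⟨l, c, hc, hl⟩ := h.exists_functional_eq_coeff h1 hX α
  have hl' : (φ.comp (l.foldr (fun n A => b n * A) 1)).comp σ = c • lcoeff ℂ α := by
    refine LinearMap.ext fun p => ?_
    have e : (l.foldr (fun n A => b n * A) 1) (σ p) = l.foldr (fun n v => b n v) (σ p) := by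
      clear hl
      induction l with
      | nil => rfl
      | cons a l ih => rw [List.foldr_cons, List.foldr_cons, ← ih]; rfl
    rw [LinearMap.comp_apply, LinearMap.comp_apply, e, hl]; rfl
  have := key l
  rw [contractLeft_rTensor] at this
  have e2 : ∀ z : MvPolynomial ℕ ℂ ⊗[ℂ] H, contractLeft H
      (φ.comp (l.foldr (fun n A => b n * A) 1)) (LinearMap.rTensor H σ z) =
        c • contractLeft H (lcoeff ℂ α) z := by
    intro z
    induction z using TensorProduct.induction_on with
    | zero => simp
    | tmul p x =>
      have := LinearMap.congr_fun hl' p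
      rw [LinearMap.comp_apply] at this
      rw [LinearMap.rTensor_tmul, contractLeft_tmul, this, contractLeft_tmul, LinearMap.smul_apply,
        smul_assoc]
    | add x y hx hy => simp only [map_add, hx, hy, smul_add]
  rw [e2] at this
  exact (smul_eq_zero.1 this).resolve_left hc

end PolynomialMap

/-! ### Fields on tensor products -/

section Tensor

variable {V H : Type*} [AddCommGroup V] [Module ℂ V] [AddCommGroup H] [Module ℂ H]

open QField

namespace QField

theorem onLeft_mode (A : QField V) (n : ℤ) :
    (A.onLeft H).mode n = LinearMap.rTensor H (A.mode n) := rfl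

theorem onRight_mode (A : QField H) (n : ℤ) :
    (A.onRight V).mode n = LinearMap.lTensor V (A.mode n) := rfl

theorem rTensor_lie (A B : Module.End ℂ V) :
    ⁅LinearMap.rTensor H A, LinearMap.rTensor H B⁆ = LinearMap.rTensor H ⁅A, B⁆ := by
  rw [Ring.lie_def, Ring.lie_def, LinearMap.rTensor_sub, Module.End.mul_eq_comp,
    Module.End.mul_eq_comp, Module.End.mul_eq_comp, Module.End.mul_eq_comp, LinearMap.rTensor_comp,
    LinearMap.rTensor_comp]

theorem lTensor_lie (A B : Module.End ℂ H) :
    ⁅LinearMap.lTensor V A, LinearMap.lTensor V B⁆ = LinearMap.lTensor V ⁅A, B⁆ := by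
  rw [Ring.lie_def, Ring.lie_def, LinearMap.lTensor_sub, Module.End.mul_eq_comp,
    Module.End.mul_eq_comp, Module.End.mul_eq_comp, Module.End.mul_eq_comp, LinearMap.lTensor_comp,
    LinearMap.lTensor_comp]

theorem rTensor_lie_lTensor (A : Module.End ℂ V) (B : Module.End ℂ H) :
    ⁅LinearMap.rTensor H A, LinearMap.lTensor V B⁆ = 0 := by
  refine LinearMap.ext fun y => ?_
  rw [bracket_apply, rTensor_lTensor, sub_self, LinearMap.zero_apply]

theorem onLeft_lie (A B : QField V) (m n : ℤ) : ⁅(A.onLeft H).mode m, (B.onLeft H).mode n⁆ =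
    LinearMap.rTensor H ⁅A.mode m, B.mode n⁆ := rTensor_lie _ _

theorem onRight_lie (A B : QField H) (m n : ℤ) : ⁅(A.onRight V).mode m, (B.onRight V).mode n⁆ =
    LinearMap.lTensor V ⁅A.mode m, B.mode n⁆ := lTensor_lie _ _

theorem rTensor_delta (q n : ℤ) :
    LinearMap.rTensor H ((delta q : QField V).mode n) = (delta q).mode n := by
  rw [delta_mode, delta_mode]
  split_ifs
  · rw [Module.End.one_eq_id, LinearMap.rTensor_id, Module.End.one_eq_id]
  · rw [LinearMap.rTensor_zero]

theorem lTensor_delta (q n : ℤ) :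
    LinearMap.lTensor V ((delta q : QField H).mode n) = (delta q).mode n := by
  rw [delta_mode, delta_mode]
  split_ifs
  · rw [Module.End.one_eq_id, LinearMap.lTensor_id, Module.End.one_eq_id]
  · rw [LinearMap.lTensor_zero]

theorem onLeft_add (A B : QField V) : (A + B).onLeft H = A.onLeft H + B.onLeft H := by
  ext1; funext n
  simp only [onLeft_mode, add_mode, LinearMap.rTensor_add]

theorem onLeft_smul (c : ℂ) (A : QField V) : (c • A).onLeft H = c • A.onLeft H := by
  ext1; funext n
  simp only [onLeft_mode, smul_mode, LinearMap.rTensor_smul]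

theorem onLeft_neg (A : QField V) : (-A).onLeft H = -A.onLeft H := onLeft_smul (-1) A

theorem onLeft_sub (A B : QField V) : (A - B).onLeft H = A.onLeft H - B.onLeft H := by
  change (A + -B).onLeft H = _
  rw [onLeft_add, onLeft_neg]; rfl

theorem onLeft_deriv (A : QField V) : A.deriv.onLeft H = (A.onLeft H).deriv := by
  ext1; funext n
  simp only [onLeft_mode, deriv_mode, LinearMap.rTensor_smul]

theorem onRight_neg (A : QField H) : (-A).onRight V = -A.onRight V := by
  ext1; funext n
  simp only [onRight_mode, neg_mode, LinearMap.lTensor_neg]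

theorem onLeft_nprod (A B : QField V) :
    (nprod A B).onLeft H = nprod (A.onLeft H) (B.onLeft H) := by
  ext1; funext n
  refine TensorProduct.ext' fun v x => ?_
  rw [onLeft_mode, LinearMap.rTensor_tmul, nprod_mode, nprod_mode, nsum_apply, nsum_apply]
  have := (TensorProduct.mk ℂ V H).flip x |>.toAddMonoidHom.map_finsum
    (finite_nterm A B 0 (n - 1) v)
  refine this.trans (finsum_congr fun p => ?_)
  simp only [LinearMap.toAddMonoidHom_coe, LinearMap.flip_apply, TensorProduct.mk_apply, nterm,
    onLeft_mode]
  split_ifs <;> simp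

end QField

/-- The free fields on the first factor of a tensor product. -/
def FreeFields.onLeft (F : FreeFields V) (H : Type*) [AddCommGroup H] [Module ℂ H] :
    FreeFields (V ⊗[ℂ] H) where
  dphi := F.dphi.onLeft H
  beta := F.beta.onLeft H
  gamma := F.gamma.onLeft H

theorem IsCCR.onLeft {F : FreeFields V} (hF : IsCCR F) : IsCCR (F.onLeft H) where
  gamma_beta m n := by
    simp only [FreeFields.onLeft, onLeft_lie, hF.gamma_beta, rTensor_delta]
  gamma_gamma m n := by
    simp only [FreeFields.onLeft, onLeft_lie, hF.gamma_gamma, LinearMap.rTensor_zero]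
  beta_beta m n := by
    simp only [FreeFields.onLeft, onLeft_lie, hF.beta_beta, LinearMap.rTensor_zero]
  dphi_gamma m n := by
    simp only [FreeFields.onLeft, onLeft_lie, hF.dphi_gamma, LinearMap.rTensor_zero]
  dphi_beta m n := by
    simp only [FreeFields.onLeft, onLeft_lie, hF.dphi_beta, LinearMap.rTensor_zero]
  dphi_dphi m n := by
    simp only [FreeFields.onLeft, onLeft_lie, hF.dphi_dphi, LinearMap.rTensor_smul, rTensor_delta]

/-- Currents on the second factor of a tensor product. -/
abbrev Currents.onRight (K : Currents H) (V : Type*) [AddCommGroup V] [Module ℂ V] :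
    Currents (V ⊗[ℂ] H) := fun a => (K a).onRight V

theorem IsAffine.onRight {k : ℂ} {K : Currents H} (hK : IsAffine k K) :
    IsAffine k (K.onRight V) where
  plus_plus m n := by rw [onRight_lie, hK.plus_plus, LinearMap.lTensor_zero]
  minus_minus m n := by rw [onRight_lie, hK.minus_minus, LinearMap.lTensor_zero]
  zero_plus m n := by rw [onRight_lie, hK.zero_plus]; rfl
  zero_minus m n := by rw [onRight_lie, hK.zero_minus, LinearMap.lTensor_neg]; rfl
  zero_zero m n := by rw [onRight_lie, hK.zero_zero, LinearMap.lTensor_smul, lTensor_delta]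
  plus_minus m n := by
    rw [onRight_lie, hK.plus_minus, LinearMap.lTensor_add, LinearMap.lTensor_smul,
      LinearMap.lTensor_smul, lTensor_delta]; rfl

theorem swap_onRight (K : Currents H) : (swap K).onRight V = swap (K.onRight V) := by
  funext a; cases a <;> exact onRight_neg _

theorem fieldsCommute_onLeft_onRight (F : FreeFields V) (K : Currents H) :
    FieldsCommute (F.onLeft H) (K.onRight V) :=
  ⟨fun _ _ _ => rTensor_lie_lTensor _ _, fun _ _ _ => rTensor_lie_lTensor _ _,
    fun _ _ _ => rTensor_lie_lTensor _ _⟩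

theorem wakimoto_onLeft (κ : ℂ) (F : FreeFields V) :
    (fun a => (wakimoto κ F a).onLeft H) = wakimoto κ (F.onLeft H) := by
  funext a
  cases a
  · rfl
  · simp only [wakimoto, onLeft_add, onLeft_smul, onLeft_nprod]; rfl
  · simp only [wakimoto, onLeft_sub, onLeft_neg, onLeft_smul, onLeft_nprod, onLeft_deriv]; rfl

/-- With `rhoTilde_eq`, this reduces the dual module to the calculus of the Wakimoto currents. -/
theorem dualWakimoto_eq (κ : ℂ) (F : FreeFields V) : dualWakimoto κ F = swap (wakimoto κ F) := by
  funext a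
  ext1; funext n
  cases a
  · simp only [dualWakimoto, swap, neg_mode, add_mode, smul_mode, wakimoto_minus_mode]; abel
  · simp only [dualWakimoto, swap, neg_mode, sub_mode, smul_mode, wakimoto_zero_mode]; abel
  · rfl

theorem swap_onLeft (J : Currents V) :
    (fun a => (swap J a).onLeft H) = swap (fun a => (J a).onLeft H) := by
  funext a; cases a <;> exact onLeft_neg _

theorem swap_swap (J : Currents V) : swap (swap J) = J := by
  funext a
  ext1; funext n
  cases a <;> simp [swap]

theorem rho_eq (γ : QField V) (K : Currents H) : rho γ K = rhoField (γ.onLeft H) (K.onRight V) := by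
  simp only [rho, rhoField, onLeft_deriv]

/-- The overall sign is harmless: it multiplies the chain by a power of -1. -/
theorem rhoTilde_eq (γ : QField V) (K : Currents H) :
    rhoTilde γ K = -rhoField (γ.onLeft H) ((swap K).onRight V) := by
  rw [swap_onRight]
  ext1; funext n
  simp only [rhoTilde, rhoField, onLeft_deriv, swap, neg_mode, add_mode, sub_mode,
    smul_mode, nprod_mode, nsum_neg_right]
  have : nsum (γ.onLeft H) (nprod (γ.onLeft H) (-(K .minus).onRight V)) 0 (n - 1) =
      -nsum (γ.onLeft H) (nprod (γ.onLeft H) ((K .minus).onRight V)) 0 (n - 1) := by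
    rw [← nsum_neg_right]
    congr 1
    ext1; funext m
    rw [neg_mode, nprod_mode, nprod_mode, nsum_neg_right]
  rw [this]
  module

/-- A subspace stable under the modes of two fields is stable under those of their product. -/
theorem nprod_mem {A B : QField V} {S : Submodule ℂ V} (hA : ∀ n, ∀ v ∈ S, A.mode n v ∈ S)
    (hB : ∀ n, ∀ v ∈ S, B.mode n v ∈ S) (n : ℤ) (v : V) (hv : v ∈ S) :
    (nprod A B).mode n v ∈ S := by
  rw [nprod_mode, nsum_apply]
  refine finsum_induction (· ∈ S) S.zero_mem (fun _ _ => S.add_mem) fun p => ?_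
  rw [nterm]
  split_ifs
  · exact hA _ _ (hB _ _ hv)
  · exact hB _ _ (hA _ _ hv)

theorem rhoField_mem {γ : QField V} {K : Currents V} {S : Submodule ℂ V}
    (hγ : ∀ n, ∀ v ∈ S, γ.mode n v ∈ S) (hK : ∀ a n, ∀ v ∈ S, (K a).mode n v ∈ S) (n : ℤ) (v : V)
    (hv : v ∈ S) : (rhoField γ K).mode n v ∈ S := by
  rw [rhoField_mode]
  simp only [LinearMap.sub_apply, LinearMap.smul_apply, deriv_mode]
  refine S.sub_mem (S.sub_mem (S.sub_mem ?_ (S.smul_mem _ ?_)) (hK _ _ _ hv))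
    (S.smul_mem _ (hγ _ _ hv))
  · exact nprod_mem hγ (nprod_mem hγ (hK _)) n v hv
  · exact nprod_mem hγ (hK _) n v hv

end Tensor

/-! ### Vacuum components of the vectors generated by ρ -/

section RhoChain

variable {V H : Type*} [AddCommGroup V] [Module ℂ V] [AddCommGroup H] [Module ℂ H]

open QField

/-- Each summand contains a mode of γ. A creation mode stands on the left and is killed by φ; an
annihilation mode commutes with X and kills y. -/
theorem contractLeft_gamma_nprod {F : FreeFields V} {t : ℤ} {φ : V →ₗ[ℂ] ℂ} (ht : 0 ≤ t)
    (hφ : ∀ p, p < -t → ∀ v, φ (F.gamma.mode p v) = 0) {X : QField (V ⊗[ℂ] H)}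
    (hX : ∀ p q, ⁅(F.onLeft H).gamma.mode p, X.mode q⁆ = 0) {y : V ⊗[ℂ] H}
    (hy : ∀ p, -t ≤ p → (F.onLeft H).gamma.mode p y = 0) (n : ℤ) :
    contractLeft H φ ((nprod (F.onLeft H).gamma X).mode n y) = 0 := by
  have hφ' : ∀ p, p < -t → ∀ y, contractLeft H φ ((F.onLeft H).gamma.mode p y) = 0 :=
    fun p hp y => by
      rw [FreeFields.onLeft, onLeft_mode, contractLeft_rTensor,
        show φ.comp (F.gamma.mode p) = 0 from LinearMap.ext (hφ p hp)]
      simp [contractLeft]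
  rw [nprod_mode, nsum_apply]
  refine ((contractLeft H φ).toAddMonoidHom.map_finsum (finite_nterm _ _ _ _ y)).trans
    (finsum_eq_zero_of_forall_eq_zero fun p => ?_)
  rw [LinearMap.toAddMonoidHom_coe, nterm]
  split_ifs
  · by_cases hp : p < -t
    · exact hφ' p hp _
    · rw [apply_comm_of_bracket_eq_zero (hX _ _), hy p (not_lt.1 hp), map_zero, map_zero]
  · rw [hy p (by omega), map_zero, map_zero]

/-- Every term of ρ except -K^- has a factor γ or ∂γ, whose contribution to the vacuum component is
zero. -/
theorem contractLeft_rhoField {F : FreeFields V} (hF : IsCCR F) (K : Currents H) {t : ℤ}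
    {φ : V →ₗ[ℂ] ℂ} (ht : 0 ≤ t) (hφ : ∀ p, p < -t → ∀ v, φ (F.gamma.mode p v) = 0)
    {y : V ⊗[ℂ] H} (hy : ∀ p, -t ≤ p → (F.onLeft H).gamma.mode p y = 0) (n : ℤ) :
    contractLeft H φ ((rhoField (F.onLeft H).gamma (K.onRight V)).mode n y) =
      -(K .minus).mode n (contractLeft H φ y) := by
  have hc := fieldsCommute_onLeft_onRight F K
  have hg := hF.onLeft (H := H)
  have hφ' : ∀ p, p < -t → ∀ y, contractLeft H φ ((F.onLeft H).gamma.mode p y) = 0 :=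
    fun p hp y => by
      rw [FreeFields.onLeft, onLeft_mode, contractLeft_rTensor,
        show φ.comp (F.gamma.mode p) = 0 from LinearMap.ext (hφ p hp)]
      simp [contractLeft]
  have hd : contractLeft H φ ((F.onLeft H).gamma.mode (n - 1) y) = 0 := by
    by_cases hp : n - 1 < -t
    · exact hφ' _ hp _
    · rw [hy _ (not_lt.1 hp), map_zero]
  rw [rhoField_mode]
  simp only [LinearMap.sub_apply, LinearMap.smul_apply, deriv_mode, map_sub, map_smul]
  rw [contractLeft_gamma_nprod ht hφ (hc.gamma .zero) hy, contractLeft_gamma_nprod ht hφ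
    (fun p q => lie_nprod_eq_zero (hg.gamma_gamma p) (hc.gamma .plus p) q) hy, hd, onRight_mode,
    contractLeft_lTensor]
  simp

variable {F : FreeFields V} {K : Currents H} (hF : IsCCR F) (hK : IsAffine 1 K) {t : ℤ} {α : ℂ}
  {w : V} (hw : IsVacuum F t α w) (ht : 0 ≤ t) {φ : V →ₗ[ℂ] ℂ}
  (hφ : ∀ p, p < -t → ∀ v, φ (F.gamma.mode p v) = 0) (hφw : φ w = 1) {f : H} (s : ℕ → ℤ)
include hF hw

theorem gamma_rhoChain (K : Currents H) (i : ℕ) (p : ℤ) (hp : -t ≤ p) : (F.onLeft H).gamma.mode p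
    (modeChain (rhoField (F.onLeft H).gamma (K.onRight V)) s (w ⊗ₜ f) i) = 0 := by
  induction i with
  | zero => simp [modeChain, FreeFields.onLeft, onLeft_mode, hw.gamma p hp]
  | succ i ih =>
    rw [modeChain, apply_comm_of_bracket_eq_zero
      (gamma_lie_rho hF.onLeft (fieldsCommute_onLeft_onRight F K) p _), ih, map_zero]

include ht hφ hφw

theorem contractLeft_rhoChain (i : ℕ) : contractLeft H φ
    (modeChain (rhoField (F.onLeft H).gamma (K.onRight V)) s (w ⊗ₜ f) i) =
      (-1 : ℂ) ^ i • modeChain (K .minus) s f i := by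
  induction i with
  | zero => simp [modeChain, hφw]
  | succ i ih =>
    rw [modeChain, contractLeft_rhoField hF K ht hφ (gamma_rhoChain hF hw s K i), ih, modeChain,
      map_smul, pow_succ]
    module

include hK

/-- The vanishing of modes of `ρ` on the vectors obtained from a vacuum vector follows from the
corresponding property of `K⁻`. -/
theorem rho_rhoChain_eq_zero (hf : ∀ m, t ≤ m → (K .plus).mode m f = 0)
    (hs : ∀ i m, s i < m → (K .minus).mode m (modeChain (K .minus) s f i) = 0) (i : ℕ) (m : ℤ)
    (hm : s i < m) : (rhoField (F.onLeft H).gamma (K.onRight V)).mode m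
      (modeChain (rhoField (F.onLeft H).gamma (K.onRight V)) s (w ⊗ₜ f) i) = 0 := by
  -- Field modes below -t are the creation operators of γ; the conjugate β-modes have indices
  -- summing with them to -1.
  let g : ℕ → Module.End ℂ V := fun n => F.gamma.mode (-t - 1 - n)
  let b : ℕ → Module.End ℂ V := fun n => F.beta.mode (t + n)
  have hP : IsPolynomialVacuum g b φ w :=
    { comm := fun m n => hF.gamma_gamma _ _
      conj := fun m n => by
        rw [hF.beta_gamma, neg_mode, delta_mode]
        by_cases e : m = n
        · rw [if_pos (by omega), if_pos e]
        · rw [if_neg (by omega), if_neg e, neg_zero]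
      vac := fun n => hw.beta _ (by omega)
      func := fun n v => hφ _ (by omega) v
      one := hφw }
  obtain ⟨σ, h1, hX⟩ := exists_polynomial_map g hP.comm w
  -- Vectors polynomial in the creation modes of γ. No creation mode of β or of ∂φ is involved,
  -- because ρ contains neither field.
  let S : Submodule ℂ (V ⊗[ℂ] H) := LinearMap.range (LinearMap.rTensor H σ)
  have hSγ : ∀ n, ∀ y ∈ S, (F.onLeft H).gamma.mode n y ∈ S := by
    rintro n _ ⟨z, rfl⟩
    induction z using TensorProduct.induction_on with
    | zero => simp
    | tmul p x =>
      rw [LinearMap.rTensor_tmul, FreeFields.onLeft, onLeft_mode, LinearMap.rTensor_tmul]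
      by_cases hn : n < -t
      · obtain ⟨r, rfl⟩ : ∃ r : ℕ, n = -t - 1 - r := ⟨(-t - 1 - n).toNat, by omega⟩
        exact ⟨(p * MvPolynomial.X r) ⊗ₜ x, by rw [LinearMap.rTensor_tmul, hX]⟩
      · rw [polynomial_map_apply_eq_zero h1 hX (fun r => hF.gamma_gamma _ _)
          (hw.gamma n (not_lt.1 hn)), TensorProduct.zero_tmul]
        exact S.zero_mem
    | add x y hx hy => rw [map_add, map_add]; exact S.add_mem hx hy
  have hSK : ∀ a n, ∀ y ∈ S, (K.onRight V a).mode n y ∈ S := by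
    rintro a n _ ⟨z, rfl⟩
    refine ⟨LinearMap.lTensor _ ((K a).mode n) z, ?_⟩
    rw [onRight_mode, ← LinearMap.comp_apply, ← LinearMap.comp_apply,
      LinearMap.rTensor_comp_lTensor, LinearMap.lTensor_comp_rTensor]
  have hSρ := rhoField_mem hSγ hSK
  have hmem : ∀ i, modeChain (rhoField (F.onLeft H).gamma (K.onRight V)) s (w ⊗ₜ f) i ∈ S := by
    intro i
    induction i with
    | zero => exact ⟨1 ⊗ₜ f, by rw [LinearMap.rTensor_tmul, h1]; rfl⟩
    | succ i ih => exact hSρ _ _ ih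
  have hKU := hK.onRight (V := V)
  have hc := fieldsCommute_onLeft_onRight F K
  -- The sum of β and K^+ kills the initial vector and commutes with ρ, hence it kills the whole
  -- chain. These are the differential equations that determine the vectors.
  have hplus : ∀ i n, t ≤ n → ((F.onLeft H).beta.mode n + (K.onRight V .plus).mode n)
      (modeChain (rhoField (F.onLeft H).gamma (K.onRight V)) s (w ⊗ₜ f) i) = 0 := by
    intro i n hn
    induction i with
    | zero =>
      simp [modeChain, FreeFields.onLeft, onLeft_mode, onRight_mode, hw.beta n hn, hf n hn]
    | succ i ih =>
      rw [modeChain, apply_comm_of_bracket_eq_zero (plus_lie_rho hF.onLeft hKU hc n _), ih,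
        map_zero]
  refine hP.eq_zero_of_contractLeft h1 hX (fun n => (K .plus).mode (t + n)) (hSρ _ _ (hmem i))
    (fun n => ?_) ?_
  · rw [← LinearMap.add_apply]
    change ((F.onLeft H).beta.mode (t + n) + (K.onRight V .plus).mode (t + n)) _ = 0
    rw [apply_comm_of_bracket_eq_zero (plus_lie_rho hF.onLeft hKU hc _ _), hplus i _ (by omega),
      map_zero]
  -- The vacuum component is, up to sign, K^-_m applied to the corresponding chain in H, and this is
  -- zero by hypothesis.
  · rw [contractLeft_rhoField hF K ht hφ (gamma_rhoChain hF hw s K i),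
      contractLeft_rhoChain hF hw ht hφ hφw, map_smul, hs i m hm, smul_zero, neg_zero]

end RhoChain

/-! ### Irreducible modules of level one -/

section Irreducible

variable {H : Type*} [AddCommGroup H] [Module ℂ H]

open QField

/-- There is no proper nonzero subspace stable under the modes of the currents. -/
def IsIrr (K : Currents H) : Prop :=
  ∀ S : Submodule ℂ H, (∀ a m, ∀ v ∈ S, (K a).mode m v ∈ S) → S = ⊥ ∨ S = ⊤

theorem IsIrr.swap {K : Currents H} (h : IsIrr K) : IsIrr (swap K) := by
  refine fun S hS => h S fun a m v hv => ?_
  rw [← swap_swap K]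
  cases a
  · exact S.neg_mem (hS .minus m v hv) |> fun h => by simpa [AffineCoset.swap] using h
  · exact S.neg_mem (hS .zero m v hv) |> fun h => by simpa [AffineCoset.swap] using h
  · exact S.neg_mem (hS .plus m v hv) |> fun h => by simpa [AffineCoset.swap] using h

theorem IsAffine.bracket_mem {k : ℂ} {K : Currents H} (hK : IsAffine k K) {S : Submodule ℂ H}
    {y : H} (hy : y ∈ S) (h : ∀ a m, (K a).mode m y ∈ S) (a b : SlIdx) (m n : ℤ) :
    ⁅(K a).mode m, (K b).mode n⁆ y ∈ S := by
  have hd : ∀ q p, (delta q : QField H).mode p y ∈ S := fun q p => by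
    rw [delta_mode]; split_ifs
    · exact hy
    · exact S.zero_mem
  cases a <;> cases b
  · rw [hK.plus_plus]; exact S.zero_mem
  · rw [hK.plus_zero]; exact S.neg_mem (h _ _)
  · rw [hK.plus_minus]; exact S.add_mem (S.smul_mem _ (h _ _)) (S.smul_mem _ (hd _ _))
  · rw [hK.zero_plus]; exact h _ _
  · rw [hK.zero_zero]; exact S.smul_mem _ (hd _ _)
  · rw [hK.zero_minus]; exact S.neg_mem (h _ _)
  · rw [hK.minus_plus]; exact S.add_mem (S.smul_mem _ (h _ _)) (S.smul_mem _ (hd _ _))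
  · rw [hK.minus_zero]; exact h _ _
  · rw [hK.minus_minus]; exact S.zero_mem

/-- The vectors obtained from `v` by applying modes of nonnegative degree `d`. -/
inductive Lowered (K : Currents H) (d : SlIdx → ℤ → ℤ) (v : H) : H → Prop
  | base : Lowered K d v v
  | step (y : H) (a : SlIdx) (m : ℤ) : 0 ≤ d a m → Lowered K d v y →
      Lowered K d v ((K a).mode m y)

/-- If `v` is annihilated by the modes of negative degree, the modes of nonnegative degree applied
to `v` span a stable subspace. -/
theorem span_lowered_stable {k : ℂ} {K : Currents H} (hK : IsAffine k K) {d : SlIdx → ℤ → ℤ} {v : H}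
    (hv : ∀ a m, d a m < 0 → (K a).mode m v = 0) (a : SlIdx) (m : ℤ) (y : H)
    (hy : y ∈ Submodule.span ℂ {y | Lowered K d v y}) :
    (K a).mode m y ∈ Submodule.span ℂ {y | Lowered K d v y} := by
  have hnn : ∀ a m, 0 ≤ d a m → ∀ y ∈ Submodule.span ℂ {y | Lowered K d v y},
      (K a).mode m y ∈ Submodule.span ℂ {y | Lowered K d v y} := fun a m h y hy => by
    induction hy using Submodule.span_induction with
    | mem y hy => exact Submodule.subset_span (Lowered.step y a m h hy)
    | zero => rw [map_zero]; exact Submodule.zero_mem _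
    | add x y _ _ hx hy => rw [map_add]; exact Submodule.add_mem _ hx hy
    | smul c x _ hx => rw [map_smul]; exact Submodule.smul_mem _ c hx
  induction hy using Submodule.span_induction with
  | zero => rw [map_zero]; exact Submodule.zero_mem _
  | add x y _ _ hx hy => rw [map_add]; exact Submodule.add_mem _ hx hy
  | smul c x _ hx => rw [map_smul]; exact Submodule.smul_mem _ c hx
  | mem y hy =>
    induction hy generalizing a m with
    | base =>
      by_cases h : d a m < 0
      · rw [hv a m h]; exact Submodule.zero_mem _
      · exact hnn a m (not_lt.1 h) v (Submodule.subset_span Lowered.base)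
    | step y b p hb hy ih =>
      rw [apply_apply_eq]
      exact Submodule.add_mem _ (hnn b p hb _ (ih a m))
        (hK.bracket_mem (Submodule.subset_span hy) ih a b m p)

theorem exists_eigenvalue_of_lowered {K : Currents H} {D : Module.End ℂ H} {d : SlIdx → ℤ → ℤ}
    (hD : ∀ a m, ⁅D, (K a).mode m⁆ = (d a m : ℂ) • (K a).mode m) {v : H} {μ : ℂ}
    (hv : D v = μ • v) {y : H} (hy : Lowered K d v y) : ∃ n : ℕ, D y = (μ + n) • y := by
  induction hy with
  | base => exact ⟨0, by simpa using hv⟩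
  | step y a m h _ ih =>
    obtain ⟨n, hn⟩ := ih
    refine ⟨n + (d a m).toNat, ?_⟩
    rw [apply_apply_eq, hn, hD, map_smul, LinearMap.smul_apply, ← add_smul]
    congr 1
    have : ((d a m).toNat : ℂ) = (d a m : ℂ) := by exact_mod_cast Int.toNat_of_nonneg h
    push_cast
    rw [this]; ring

/-- In an irreducible module a vector annihilated by all modes of negative degree vanishes if the
eigenvalue of some other vector does not lie above its own. -/
theorem eq_zero_of_singular {k : ℂ} {K : Currents H} (hK : IsAffine k K) (hirr : IsIrr K)
    {D : Module.End ℂ H} {d : SlIdx → ℤ → ℤ}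
    (hD : ∀ a m, ⁅D, (K a).mode m⁆ = (d a m : ℂ) • (K a).mode m) {f : H} (hf0 : f ≠ 0) {δ : ℂ}
    (hf : D f = δ • f) {v : H} {μ : ℂ} (hv : D v = μ • v) (hμ : ∀ n : ℕ, δ ≠ μ + n)
    (hs : ∀ a m, d a m < 0 → (K a).mode m v = 0) : v = 0 := by
  rcases hirr _ (span_lowered_stable hK hs) with h | h
  · have : v ∈ Submodule.span ℂ {y | Lowered K d v y} := Submodule.subset_span Lowered.base
    rwa [h, Submodule.mem_bot] at this
  · exfalso
    -- If the subspace generated by v were everything, f would lie in a sum of eigenspaces with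
    -- eigenvalues μ + n ≠ δ, against the independence of eigenspaces.
    have hle : Submodule.span ℂ {y | Lowered K d v y} ≤
        ⨆ μ', ⨆ (_ : μ' ≠ δ), Module.End.eigenspace D μ' := by
      refine Submodule.span_le.2 fun y hy => ?_
      obtain ⟨n, hn⟩ := exists_eigenvalue_of_lowered hD hv hy
      exact Submodule.mem_iSup_of_mem (μ + n) (Submodule.mem_iSup_of_mem (hμ n).symm
        (Module.End.mem_eigenspace_iff.2 hn))
    refine hf0 ((Submodule.disjoint_def.1 (Module.End.eigenspaces_iSupIndep D δ)) f
      (Module.End.mem_eigenspace_iff.2 hf) (hle ?_))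
    rw [h]; trivial

/-- Iterated commutators of `K⁻₀` with the modes of `:K⁺K⁺:`. -/
def plusMultiplet (K : Currents H) : ℕ → ℤ → Module.End ℂ H
  | 0, N => (nprod (K .plus) (K .plus)).mode N
  | i + 1, N => ⁅(K .minus).mode 0, plusMultiplet K i N⁆

/-! ### The level-one relation :K^+K^+: = 0 and extremal vectors -/

section

variable {K : Currents H} (hK : IsAffine 1 K)
include hK

/-- In [K^-_m, :K^+K^+:] the central terms give 2m K^+ and the displaced ordering gives -2m K^+.
They cancel at level one, so the result depends only on m + N and the modes of K^- act as K^-_0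
does. -/
theorem minus_lie_plusMultiplet (m N : ℤ) (i : ℕ) :
    ⁅(K .minus).mode m, plusMultiplet K i N⁆ = plusMultiplet K (i + 1) (m + N) := by
  induction i with
  | zero =>
    have key : ∀ m N, ⁅(K .minus).mode m, (nprod (K .plus) (K .plus)).mode N⁆ =
        (-2 : ℂ) • nsum (K .zero) (K .plus) 0 (m + N - 1) +
          (-2 : ℂ) • nsum (K .plus) (K .zero) 0 (m + N - 1) := fun m N => by
      have h : ∀ p, ⁅(K .minus).mode m, (K .plus).mode p⁆ =
          ((-2 : ℂ) • K .zero + (m : ℂ) • delta 0).mode (m + p) := fun p => by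
        rw [hK.minus_plus, one_mul]; rfl
      rw [lie_nprod h h, nprod_mode]
      simp only [nsum_add_left, nsum_add_right, nsum_smul_left, nsum_smul_right, nsum_delta_left,
        nsum_delta_right]
      rw [nsum_eq_of_lie_const (A := K .zero) (B := K .plus) (X := (K .plus).mode (m + N - 1))
        (fun p => by rw [hK.zero_plus, add_sub_cancel]) m, sub_zero]
      module
    rw [plusMultiplet, plusMultiplet, plusMultiplet, key, key, zero_add]
  | succ i ih =>
    rw [plusMultiplet, leibniz_lie, hK.minus_minus, zero_lie, zero_add, ih, plusMultiplet,
      plusMultiplet, plusMultiplet]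

theorem zero_lie_plusMultiplet (m N : ℤ) (i : ℕ) :
    ⁅(K .zero).mode m, plusMultiplet K i N⁆ = ((2 : ℂ) - i) • plusMultiplet K i (m + N) := by
  induction i with
  | zero =>
    rw [plusMultiplet, lie_nprod (hK.zero_plus m) (hK.zero_plus m), nsum_eq_of_comm hK.plus_plus,
      sub_add_cancel, plusMultiplet]
    push_cast
    module
  | succ i ih =>
    rw [plusMultiplet, leibniz_lie, hK.zero_minus, neg_lie, minus_lie_plusMultiplet hK, ih, lie_smul,
      add_zero, plusMultiplet]
    push_cast
    module

/-- The coefficients are those of raising in the spin-two representation of sl₂. At i = 0 the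
truncated index i - 1 does not matter, since the coefficient is zero. -/
theorem plus_lie_plusMultiplet (m N : ℤ) (i : ℕ) :
    ⁅(K .plus).mode m, plusMultiplet K i N⁆ =
      ((i : ℂ) * (5 - i)) • plusMultiplet K (i - 1) (m + N) := by
  induction i with
  | zero =>
    rw [plusMultiplet, lie_nprod_eq_zero (hK.plus_plus m) (hK.plus_plus m)]
    simp
  | succ i ih =>
    rw [plusMultiplet, leibniz_lie, hK.plus_minus, add_lie, smul_lie, smul_lie, delta_lie,
      zero_lie_plusMultiplet hK, ih, lie_smul, add_zero, Nat.add_sub_cancel]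
    rcases i with _ | i
    · push_cast; module
    · rw [Nat.add_sub_cancel, plusMultiplet]
      push_cast
      module

theorem lie_plusMultiplet_mem (a : SlIdx) (m N : ℤ) (i : ℕ) :
    ∃ (c : ℂ) (j : ℕ), ⁅(K a).mode m, plusMultiplet K i N⁆ = c • plusMultiplet K j (m + N) := by
  cases a
  · exact ⟨_, _, plus_lie_plusMultiplet hK m N i⟩
  · exact ⟨_, _, zero_lie_plusMultiplet hK m N i⟩
  · exact ⟨1, _, by rw [one_smul]; exact minus_lie_plusMultiplet hK m N i⟩

theorem sugawara_lie (a : SlIdx) (m : ℤ) : ⁅(sugawara 1 K).mode 1, (K a).mode m⁆ =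
    ((-m : ℤ) : ℂ) • (K a).mode m := by
  rw [bracket_symm_eq (hK.lie_sugawara (by norm_num) a m 1), add_sub_cancel_right]
  push_cast; module

/-- A product of two weight-one fields has weight two, so mode N shifts L_0 by 1 - N. The brackets
with K^-_0 do not change this. -/
theorem sugawara_lie_plusMultiplet (N : ℤ) (i : ℕ) :
    ⁅(sugawara 1 K).mode 1, plusMultiplet K i N⁆ = (1 - (N : ℂ)) • plusMultiplet K i N := by
  induction i with
  | zero =>
    have h : ∀ p, ⁅(sugawara 1 K).mode 1, (K .plus).mode p⁆ =
        ((K .plus).scale fun p => -(p : ℂ)).mode (0 + p) := fun p => by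
      rw [sugawara_lie hK, scale_mode, zero_add]; push_cast; rfl
    rw [plusMultiplet, lie_nprod h h, nprod_mode, zero_add,
      nsum_scale_add _ _ _ _ _ _ (1 - (N : ℂ)) (fun p => by push_cast; ring), nprod_mode]
  | succ i ih =>
    rw [plusMultiplet, leibniz_lie, sugawara_lie hK, ih, lie_smul]
    simp

/-- At level one, `:K⁺K⁺: = 0` on an irreducible module with a suitable top component. -/
theorem nprod_plus_plus_eq_zero (hirr : IsIrr K) {f : H} (hf0 : f ≠ 0) {h c : ℂ}
    (hpos : ∀ a m, 0 < m → (K a).mode m f = 0) (hp : (K .plus).mode 0 f = 0)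
    (hmm : (K .minus).mode 0 ((K .minus).mode 0 f) = 0)
    (hpm : (K .plus).mode 0 ((K .minus).mode 0 f) = c • f)
    (hD : (sugawara 1 K).mode 1 f = h • f) (N : ℤ) :
    (nprod (K .plus) (K .plus)).mode N = 0 := by
  have hp' : ∀ m, 0 ≤ m → (K .plus).mode m f = 0 := fun m hm => by
    rcases hm.eq_or_lt with rfl | hm
    · exact hp
    · exact hpos _ _ hm
  have hpm' : ∀ m, 0 < m → (K .plus).mode m ((K .minus).mode 0 f) = 0 := fun m hm => by
    rw [apply_apply_eq, hp' m hm.le, hK.plus_minus, map_zero, zero_add, LinearMap.add_apply,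
      LinearMap.smul_apply, LinearMap.smul_apply, hpos _ _ (by omega), delta_mode,
      if_neg (by omega)]
    simp
  -- Modes N ≥ 1 do not raise L_0. They are checked on f and K^-_0 f together because the brackets
  -- with K^-_0 mix these two vectors.
  have top : ∀ N, 1 ≤ N → ∀ i, plusMultiplet K i N f = 0 ∧
      plusMultiplet K i N ((K .minus).mode 0 f) = 0 := by
    intro N hN i
    induction i with
    | zero =>
      refine ⟨nprod_apply_eq_zero (c := 0) le_rfl hp' (fun p hp => hp' p (by omega))
        (fun p _ _ => by omega), ?_⟩
      rw [plusMultiplet, nprod_mode, nsum_apply]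
      refine finsum_eq_zero_of_forall_eq_zero fun p => ?_
      rw [nterm]
      split_ifs with hpn
      · rw [hpm' _ (by omega), map_zero]
      · rcases (not_lt.1 hpn).eq_or_lt with rfl | hpn
        · rw [hpm, map_smul, hp' _ (by omega), smul_zero]
        · rw [hpm' p hpn, map_zero]
    | succ i ih =>
      rw [plusMultiplet, bracket_apply, bracket_apply, ih.1, ih.2, hmm]
      simp
  -- Mode 1 - n raises L_0 by n. A mode of a current with m > 0 turns it into a mode that raises L_0
  -- less, which kills f by induction. The image of f is thus singular, and for n > 0 it lies
  -- strictly above f, so it vanishes.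
  have all : ∀ (n : ℕ) (i : ℕ), plusMultiplet K i (1 - n) f = 0 := by
    intro n
    induction n using Nat.strong_induction_on with
    | _ n ih =>
      have ih' : ∀ N, 1 - (n : ℤ) < N → ∀ i, plusMultiplet K i N f = 0 := fun N hN i => by
        by_cases h1 : 1 ≤ N
        · exact (top N h1 i).1
        · have := ih (1 - N).toNat (by omega) i
          rwa [show (1 : ℤ) - ((1 - N).toNat : ℤ) = N by omega] at this
      intro i
      rcases Nat.eq_zero_or_pos n with rfl | hn
      · exact (top _ (by simp) i).1
      refine eq_zero_of_singular hK hirr (sugawara_lie hK) hf0 hD (μ := h + n) ?_ ?_ ?_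
      · rw [apply_apply_eq, hD, map_smul, sugawara_lie_plusMultiplet hK, LinearMap.smul_apply,
          ← add_smul]
        congr 1; push_cast; ring
      · intro r hr
        have : ((n + r : ℕ) : ℂ) = 0 := by push_cast; linear_combination -hr
        have := Nat.cast_eq_zero.1 this
        omega
      · intro a m hm
        obtain ⟨c, j, hc⟩ := lie_plusMultiplet_mem hK a m (1 - n) i
        rw [apply_apply_eq, hpos a m (by omega), map_zero, zero_add, hc, LinearMap.smul_apply,
          ih' _ (by omega), smul_zero]
  -- The common kernel of the multiplet is stable under the currents because brackets stay in the
  -- multiplet; it contains f, so it is the whole module.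
  let S : Submodule ℂ H :=
    { carrier := {v | ∀ i N, plusMultiplet K i N v = 0}
      zero_mem' := fun i N => map_zero _
      add_mem' := fun ha hb i N => by rw [map_add, ha, hb, add_zero]
      smul_mem' := fun c a ha i N => by rw [map_smul, ha, smul_zero] }
  have hS : S = ⊤ := by
    refine (hirr S fun a m v hv i N => ?_).resolve_left fun h0 => hf0 ?_
    · obtain ⟨c, j, hc⟩ := lie_plusMultiplet_mem hK a m N i
      have := apply_apply_eq ((K a).mode m) (plusMultiplet K i N) v
      rw [hv, map_zero, hc, LinearMap.smul_apply, hv, smul_zero, add_zero] at this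
      exact this.symm
    · have : f ∈ S := fun i N => by
        by_cases h1 : 1 ≤ N
        · exact (top N h1 i).1
        · have := all (1 - N).toNat i
          rwa [show (1 : ℤ) - ((1 - N).toNat : ℤ) = N by omega] at this
      rwa [h0, Submodule.mem_bot] at this
  refine LinearMap.ext fun v => ?_
  have hv : v ∈ S := by rw [hS]; trivial
  exact hv 0 N

/-- Extremal vectors: the successive images of `f` under modes of `K⁻`. -/
theorem extremal_chain (hR : ∀ N, (nprod (K .minus) (K .minus)).mode N = 0) {f : H} (hf0 : f ≠ 0)
    {q : ℂ} {s : ℕ → ℤ} (hs : ∀ i, s (i + 1) = s i - 2)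
    (hq : 2 * q - s 0 = 1) (hz : ∀ m, 0 < m → (K .zero).mode m f = 0)
    (hz0 : (K .zero).mode 0 f = q • f) (hp : ∀ m, -s 0 ≤ m → (K .plus).mode m f = 0)
    (hm : ∀ m, s 0 < m → (K .minus).mode m f = 0) (i : ℕ) :
    modeChain (K .minus) s f i ≠ 0 ∧
      ∀ m, s i < m → (K .minus).mode m (modeChain (K .minus) s f i) = 0 := by
  -- The induction carries the conditions of a highest weight vector for a Borel subalgebra moved by
  -- s i. The last one, 2(q - i) - s i = 1, says that the sl₂ spanned by K^-_{s i} and K^+_{-s i}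
  -- sees the vector with weight 1.
  suffices h : modeChain (K .minus) s f i ≠ 0 ∧
      (∀ m, s i < m → (K .minus).mode m (modeChain (K .minus) s f i) = 0) ∧
      (∀ m, 0 < m → (K .zero).mode m (modeChain (K .minus) s f i) = 0) ∧
      (K .zero).mode 0 (modeChain (K .minus) s f i) = (q - i) • modeChain (K .minus) s f i ∧
      (∀ m, -s i ≤ m → (K .plus).mode m (modeChain (K .minus) s f i) = 0) ∧
      2 * (q - i) - s i = 1 from ⟨h.1, h.2.1⟩
  induction i with
  | zero => exact ⟨hf0, hm, hz, by simpa [modeChain] using hz0, hp, by simpa using hq⟩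
  | succ i ih =>
    obtain ⟨h0, hm, hz, hz0, hp, hq⟩ := ih
    rw [modeChain]
    set x := modeChain (K .minus) s f i with hx
    have hc : ∀ m n (v : H), (K .minus).mode m ((K .minus).mode n v) =
        (K .minus).mode n ((K .minus).mode m v) := fun m n v =>
      apply_comm_of_bracket_eq_zero (hK.minus_minus m n) v
    have hterm : ∀ N p, nterm (K .minus) (K .minus) 0 N p x =
        (K .minus).mode p ((K .minus).mode (N - p) x) := fun N p => by
      rw [nterm]; split_ifs
      · rfl
      · exact hc _ _ _
    -- In total index 2 s i the relation :K^-K^-: = 0 retains only the square of K^-_{s i}, as modes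
    -- above s i kill x. The field mode is one higher than the total index.
    have hss : (K .minus).mode (s i) ((K .minus).mode (s i) x) = 0 := by
      have h1 := LinearMap.congr_fun (hR (2 * s i + 1)) x
      rw [nprod_mode, nsum_apply, finsum_eq_single _ (s i), hterm] at h1
      · rwa [show 2 * s i + 1 - 1 - s i = s i by ring] at h1
      · intro p hp
        rw [hterm]
        rcases lt_or_gt_of_ne hp with h | h
        · rw [hm _ (by omega), map_zero]
        · rw [hc, hm _ h, map_zero]
    -- In total index 2 s i - 1 two equal summands remain, so the product itself is zero. This is
    -- why the next index drops by 2.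
    have hss' : (K .minus).mode (s i - 1) ((K .minus).mode (s i) x) = 0 := by
      have h1 := LinearMap.congr_fun (hR (2 * s i)) x
      rw [nprod_mode, nsum_apply, finsum_eq_sum_of_support_subset (s := {s i - 1, s i}),
        Finset.sum_pair (by omega), hterm, hterm, show 2 * s i - 1 - (s i - 1) = s i by ring,
        show 2 * s i - 1 - s i = s i - 1 by ring, hc (s i), ← two_smul ℂ, LinearMap.zero_apply,
        smul_eq_zero] at h1
      · exact h1.resolve_left two_ne_zero
      · intro p hp
        simp only [Function.mem_support, hterm] at hp
        by_contra h
        simp only [Finset.coe_pair, Set.mem_insert_iff, Set.mem_singleton_iff, not_or] at h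
        rcases lt_or_gt_of_ne h.2 with h' | h'
        · exact hp (by rw [hm _ (by omega), map_zero])
        · exact hp (by rw [hc, hm _ h', map_zero])
    have hpx : ∀ m, -s i ≤ m → (K .plus).mode m ((K .minus).mode (s i) x) =
        (2 : ℂ) • (K .zero).mode (m + s i) x + (m : ℂ) • (delta 0).mode (m + s i) x :=
      fun m hm' => by
        rw [apply_apply_eq, hp m hm', map_zero, zero_add, hK.plus_minus, one_mul]; rfl
    refine ⟨fun h => h0 ?_, fun m hm' => ?_, fun m hm' => ?_, ?_, fun m hm' => ?_, ?_⟩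
    -- Nonvanishing: K^+_{-s i} returns K^-_{s i} x to (2(q - i) - s i) x = x.
    · have := hpx (-s i) le_rfl
      rw [h, map_zero, neg_add_cancel, hz0, delta_mode, if_pos rfl, Module.End.one_apply,
        smul_smul, ← add_smul, Int.cast_neg, ← sub_eq_add_neg, hq, one_smul] at this
      exact this.symm
    · rw [hs] at hm'
      rcases lt_or_ge (s i) m with h | h
      · rw [hc, hm m h, map_zero]
      · rcases h.eq_or_lt with rfl | h
        · exact hss
        · rw [show m = s i - 1 by omega, hss']
    · rw [apply_apply_eq, hz m hm', map_zero, hK.zero_minus, LinearMap.neg_apply, hm _ (by omega)]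
      simp
    · rw [apply_apply_eq, hz0, map_smul, hK.zero_minus, LinearMap.neg_apply, zero_add]
      push_cast; module
    · rw [hs] at hm'
      rw [hpx m (by omega), hz _ (by omega), delta_mode, if_neg (by omega)]
      simp
    · rw [hs]; push_cast; linear_combination hq

end

end Irreducible

/-! ### Cyclic modules over enveloping algebras -/

section Cyclic

variable {L : Type*} [LieRing L] [LieAlgebra ℂ L]

/-- A left ideal that annihilates a vector of a representation gives a map from the cyclic module
to the representation. -/
theorem exists_cyclic_map {M : Type*} [AddCommGroup M] [Module ℂ M] (ψ : L →ₗ⁅ℂ⁆ Module.End ℂ M)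
    (w : M) (S : Set (UniversalEnvelopingAlgebra ℂ L))
    (hS : ∀ u ∈ S, UniversalEnvelopingAlgebra.lift ℂ ψ u w = 0) :
    ∃ f : (UniversalEnvelopingAlgebra ℂ L ⧸ Ideal.span S) →ₗ[ℂ] M,
      f (Submodule.Quotient.mk 1) = w ∧
        ∀ x v, f (act (UniversalEnvelopingAlgebra ℂ L ⧸ Ideal.span S) x v) = ψ x (f v) := by
  let _ : Module (UniversalEnvelopingAlgebra ℂ L) M :=
    Module.compHom M (UniversalEnvelopingAlgebra.lift ℂ ψ).toRingHom
  have hsm : ∀ (u : UniversalEnvelopingAlgebra ℂ L) (m : M),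
      u • m = UniversalEnvelopingAlgebra.lift ℂ ψ u m := fun _ _ => rfl
  have _ : IsScalarTower ℂ (UniversalEnvelopingAlgebra ℂ L) M := ⟨fun c u m => by
    rw [hsm, hsm, map_smul, LinearMap.smul_apply]⟩
  let f := (Ideal.span S).liftQ
    (LinearMap.toSpanSingleton (UniversalEnvelopingAlgebra ℂ L) M w)
    (Ideal.span_le.2 fun u hu => by
      rw [SetLike.mem_coe, LinearMap.mem_ker, LinearMap.toSpanSingleton_apply, hsm, hS u hu])
  refine ⟨f.restrictScalars ℂ, ?_, fun x v => ?_⟩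
  · change (LinearMap.toSpanSingleton (UniversalEnvelopingAlgebra ℂ L) M w) 1 = w
    rw [LinearMap.toSpanSingleton_apply, one_smul]
  · change f (UniversalEnvelopingAlgebra.ι ℂ x • v) = _
    rw [map_smul, hsm, UniversalEnvelopingAlgebra.lift_ι_apply]
    rfl

theorem act_lie {M : Type*} [AddCommGroup M] [Module ℂ M]
    [Module (UniversalEnvelopingAlgebra ℂ L) M] [IsScalarTower ℂ (UniversalEnvelopingAlgebra ℂ L) M]
    (x y : L) : ⁅act M x, act M y⁆ = act M ⁅x, y⁆ :=
  LinearMap.ext fun m => by rw [bracket_apply, act_act, add_sub_cancel_left]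

theorem act_mk_one_eq_smul (I : Ideal (UniversalEnvelopingAlgebra ℂ L)) (x : L) (c : ℂ)
    (hx : UniversalEnvelopingAlgebra.ι ℂ x - algebraMap ℂ _ c ∈ I) :
    act (UniversalEnvelopingAlgebra ℂ L ⧸ I) x (Submodule.Quotient.mk 1) =
      c • (Submodule.Quotient.mk 1 : UniversalEnvelopingAlgebra ℂ L ⧸ I) := by
  simp only [act, Algebra.lsmul_coe]
  rw [← Submodule.Quotient.mk_smul, ← Submodule.Quotient.mk_smul, smul_eq_mul, mul_one,
    Algebra.smul_def, mul_one]
  exact (Submodule.Quotient.eq I).2 hx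

/-- A central element acts on a cyclic module by the scalar by which it acts on the generator. -/
theorem act_eq_smul_of_central (I : Ideal (UniversalEnvelopingAlgebra ℂ L)) (x : L) (c : ℂ)
    (hc : ∀ y : L, ⁅y, x⁆ = 0) (hx : UniversalEnvelopingAlgebra.ι ℂ x - algebraMap ℂ _ c ∈ I)
    (v : UniversalEnvelopingAlgebra ℂ L ⧸ I) :
    act (UniversalEnvelopingAlgebra ℂ L ⧸ I) x v = c • v := by
  have h := cyclic_induction I
    (LinearMap.ker (act (UniversalEnvelopingAlgebra ℂ L ⧸ I) x - c • LinearMap.id)) ?_ ?_ v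
  · rwa [LinearMap.mem_ker, LinearMap.sub_apply, sub_eq_zero] at h
  · rw [LinearMap.mem_ker, LinearMap.sub_apply, sub_eq_zero]
    exact act_mk_one_eq_smul I x c hx
  · intro y m hm
    rw [LinearMap.mem_ker, LinearMap.sub_apply, sub_eq_zero, LinearMap.smul_apply,
      LinearMap.id_apply] at hm ⊢
    rw [act_act, hm, map_smul, ← lie_skew, hc, neg_zero, act_zero_apply, add_zero]

end Cyclic

/-! ### Modules over the affine Lie algebra -/

section AffineModules

open QField

theorem slElt_lie_plus_plus : ⁅slElt .plus, slElt .plus⁆ = 0 := lie_self _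

theorem slElt_lie_minus_minus : ⁅slElt .minus, slElt .minus⁆ = 0 := lie_self _

theorem slElt_lie_zero_plus : ⁅slElt .zero, slElt .plus⁆ = slElt .plus := by
  apply Subtype.ext
  ext i j
  fin_cases i <;> fin_cases j <;> simp [slElt, Ring.lie_def]; norm_num

theorem slElt_lie_zero_minus : ⁅slElt .zero, slElt .minus⁆ = -slElt .minus := by
  apply Subtype.ext
  ext i j
  fin_cases i <;> fin_cases j <;> simp [slElt, Ring.lie_def]; norm_num

theorem slElt_lie_plus_minus : ⁅slElt .plus, slElt .minus⁆ = (2 : ℂ) • slElt .zero := by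
  apply Subtype.ext
  ext i j
  fin_cases i <;> fin_cases j <;> simp [slElt, Ring.lie_def]; norm_num

theorem sl2Form_zero_zero : sl2Form (slElt .zero) (slElt .zero) = 1 / 2 := by
  simp [sl2Form, slElt, Matrix.trace_fin_two]; norm_num

theorem sl2Form_plus_minus : sl2Form (slElt .plus) (slElt .minus) = 1 := by
  simp [sl2Form, slElt, Matrix.trace_fin_two]

theorem sl2Form_plus_plus : sl2Form (slElt .plus) (slElt .plus) = 0 := by
  simp [sl2Form, slElt, Matrix.trace_fin_two]

theorem sl2Form_minus_minus : sl2Form (slElt .minus) (slElt .minus) = 0 := by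
  simp [sl2Form, slElt, Matrix.trace_fin_two]

theorem sl2Form_zero_plus : sl2Form (slElt .zero) (slElt .plus) = 0 := by
  simp [sl2Form, slElt, Matrix.trace_fin_two]

theorem sl2Form_zero_minus : sl2Form (slElt .zero) (slElt .minus) = 0 := by
  simp [sl2Form, slElt, Matrix.trace_fin_two]

theorem centralElt_eq_smul (c : ℂ) : centralElt c = c • Kelt := by
  rw [Kelt, centralElt, centralElt, ← LieAlgebra.of_smul, Prod.smul_mk, smul_zero, ← map_smul,
    smul_eq_mul, mul_one]

variable {M : Type*} [AddCommGroup M] [Module ℂ M] [Module UAffine M] [IsScalarTower ℂ UAffine M]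

theorem isAffine_of_act {k : ℂ} {J : Currents M} (hJ : ∀ a n, (J a).mode n = act M (Jelt a n))
    (hk : ∀ v, act M Kelt v = k • v) : IsAffine k J := by
  have hk' : act M Kelt = k • (1 : Module.End ℂ M) := LinearMap.ext hk
  have key : ∀ a b m n, ⁅(J a).mode m, (J b).mode n⁆ =
      act M (loopElt ⁅slElt a, slElt b⁆ (m + n)) +
        (m * sl2Form (slElt a) (slElt b) * k) • (delta 0).mode (m + n) := fun a b m n => by
    rw [hJ, hJ, act_lie, Jelt, Jelt, loopElt_lie, act_add, centralElt_eq_smul, act_smul, hk',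
      delta_mode]
    split_ifs <;> simp [smul_smul]
  have hz : ∀ n : ℤ, act M (loopElt 0 n) = 0 := fun n => by
    rw [← zero_smul ℂ (0 : Sl2), loopElt_smul, act_smul, zero_smul]
  constructor <;> intro m n <;> rw [key]
  · rw [slElt_lie_plus_plus, sl2Form_plus_plus, hz]; simp
  · rw [slElt_lie_minus_minus, sl2Form_minus_minus, hz]; simp
  · rw [slElt_lie_zero_plus, sl2Form_zero_plus, hJ, Jelt]; simp
  · rw [slElt_lie_zero_minus, sl2Form_zero_minus, hJ, Jelt, ← neg_one_smul ℂ (slElt .minus),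
      loopElt_smul, act_smul]
    simp
  · rw [lie_self, hz, sl2Form_zero_zero, zero_add]; congr 1; ring
  · rw [slElt_lie_plus_minus, loopElt_smul, act_smul, sl2Form_plus_minus, hJ, Jelt]
    congr 2; ring

/-- A subspace stable under the `Jᵃₙ` is stable under the affine Lie algebra. -/
theorem act_mem_of_act_Jelt_mem {k : ℂ} (hk : ∀ v : M, act M Kelt v = k • v) {S : Submodule ℂ M}
    (hS : ∀ a n, ∀ v ∈ S, act M (Jelt a n) v ∈ S) (x : AffineSl2) (v : M) (hv : v ∈ S) :
    act M x v ∈ S := by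
  induction x using affine_induction with
  | hadd x y hx hy => rw [act_add, LinearMap.add_apply]; exact S.add_mem hx hy
  | hloop x n =>
    rw [slElt_span x]
    simp only [loopElt_add, loopElt_smul, act_add, act_smul, LinearMap.add_apply,
      LinearMap.smul_apply]
    exact S.add_mem (S.add_mem (S.smul_mem _ (hS _ _ _ hv)) (S.smul_mem _ (hS _ _ _ hv)))
      (S.smul_mem _ (hS _ _ _ hv))
  | hcent c =>
    rw [centralElt_eq_smul, act_smul, LinearMap.smul_apply, hk]
    exact S.smul_mem _ (S.smul_mem _ hv)

/-- A subspace stable under the `Jᵃₙ`, as a submodule. -/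
def stableSubmodule {k : ℂ} (hk : ∀ v, act M Kelt v = k • v) (S : Submodule ℂ M)
    (hS : ∀ a n, ∀ v ∈ S, act M (Jelt a n) v ∈ S) : Submodule UAffine M where
  carrier := S
  zero_mem' := S.zero_mem
  add_mem' := S.add_mem
  smul_mem' u _ hv := smul_mem_of_stable S (act_mem_of_act_Jelt_mem hk hS) u hv

theorem Kelt_smul_verma (k j : ℂ) (v : Verma k j) : act (Verma k j) Kelt v = k • v :=
  act_eq_smul_of_central _ _ _ (lie_centralElt 1)
    (Ideal.subset_span (Or.inr (Or.inl rfl))) v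

theorem mk_act_verma (k j : ℂ) (x : AffineSl2) (v : Verma k j) :
    (Submodule.Quotient.mk (act (Verma k j) x v) : IrrHW k j) =
      act (IrrHW k j) x (Submodule.Quotient.mk v) := rfl

theorem Kelt_smul_irrHW (k j : ℂ) (v : IrrHW k j) : act (IrrHW k j) Kelt v = k • v := by
  obtain ⟨w, rfl⟩ := Submodule.Quotient.mk_surjective _ v
  rw [← mk_act_verma, Kelt_smul_verma]
  rfl

theorem isAffine_irrCurrents (k j : ℂ) : IsAffine k (irrCurrents k j) :=
  isAffine_of_act (fun _ _ => rfl) (Kelt_smul_irrHW k j)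

/-- The currents acting on the Verma module. -/
def vermaCurrents (k j : ℂ) : Currents (Verma k j) := fun a =>
  { mode := fun n => act (Verma k j) (Jelt a n)
    trunc := fun v => (verma_trunc k j v).imp fun _ h n hn => h n hn (slElt a) }

theorem isAffine_vermaCurrents (k j : ℂ) : IsAffine k (vermaCurrents k j) :=
  isAffine_of_act (fun _ _ => rfl) (Kelt_smul_verma k j)

theorem isHighestWeight_verma (k j : ℂ) :
    IsHighestWeight (vermaCurrents k j) j (Submodule.Quotient.mk 1) where
  pos a m hm := act_mk_one _ _ (Ideal.subset_span (Or.inl (Or.inr ⟨a, m, by omega, rfl⟩)))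
  plus := act_mk_one _ _ (Ideal.subset_span (Or.inl (Or.inl rfl)))
  zero := act_mk_one_eq_smul _ _ _ (Ideal.subset_span (Or.inr (Or.inr rfl)))

theorem isHighestWeight_irrVec (k j : ℂ) :
    IsHighestWeight (irrCurrents k j) j (irrVec k j) where
  pos a m hm := congrArg (Submodule.Quotient.mk (p := vermaRad k j))
    ((isHighestWeight_verma k j).pos a m hm)
  plus := congrArg (Submodule.Quotient.mk (p := vermaRad k j)) (isHighestWeight_verma k j).plus
  zero := congrArg (Submodule.Quotient.mk (p := vermaRad k j)) (isHighestWeight_verma k j).zero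

/-- The preimage in the Verma module of a stable subspace is a submodule; if it is proper it lies in
the sum of the proper submodules, which is zero in the quotient. -/
theorem isIrr_irrCurrents (k j : ℂ) : IsIrr (irrCurrents k j) := by
  intro S hS
  let N := stableSubmodule (Kelt_smul_irrHW k j) S hS
  by_cases h : N.comap (vermaRad k j).mkQ = ⊤
  · right
    refine eq_top_iff.2 fun v _ => ?_
    obtain ⟨w, rfl⟩ := Submodule.Quotient.mk_surjective _ v
    exact Submodule.mem_comap.1 (h ▸ Submodule.mem_top : w ∈ N.comap (vermaRad k j).mkQ)
  · left
    refine eq_bot_iff.2 fun v hv => ?_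
    obtain ⟨w, rfl⟩ := Submodule.Quotient.mk_surjective _ v
    have hw : w ∈ N.comap (vermaRad k j).mkQ := hv
    exact (Submodule.Quotient.mk_eq_zero _).2 (le_sSup (a := N.comap (vermaRad k j).mkQ) h hw)

/-- The modes of level `k` currents satisfying the affine relations define a representation. -/
theorem IsAffine.exists_rep {V : Type*} [AddCommGroup V] [Module ℂ V] {k : ℂ} {J : Currents V}
    (hJ : IsAffine k J) : ∃ ψ : AffineSl2 →ₗ⁅ℂ⁆ Module.End ℂ V,
      (∀ a n, ψ (Jelt a n) = (J a).mode n) ∧ ψ Kelt = k • 1 := by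
  -- The coefficients are the coordinates of a traceless matrix in the basis e, h/2, f; the factor 2
  -- comes from J^0 = h/2.
  let o : ℤ → Sl2 →ₗ[ℂ] Module.End ℂ V := fun n =>
    { toFun := fun x => (x.1 0 1) • (J .plus).mode n + (2 * x.1 0 0) • (J .zero).mode n +
        (x.1 1 0) • (J .minus).mode n
      map_add' := fun x y => by simp; module
      map_smul' := fun c x => by simp; module }
  let l : LieAlgebra.loopAlgebra ℂ ℤ Sl2 →ₗ[ℂ] Module.End ℂ V :=
    (Finsupp.lsum ℂ o) ∘ₗ (LieAlgebra.LoopAlgebra.toFinsupp ℂ ℤ Sl2).toLinearMap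
  let p : AffineSl2 →ₗ[ℂ] Module.End ℂ V :=
    { toFun := fun y => l ((LieAlgebra.ofProd affineCocycle).symm y).1 +
        (k * TrivialLieModule.equiv ℂ _ ℂ ((LieAlgebra.ofProd affineCocycle).symm y).2) • 1
      map_add' := fun x y => by simp; module
      map_smul' := fun c x => by simp; module }
  have hp1 : ∀ x n, p (loopElt x n) = (x.1 0 1) • (J .plus).mode n +
      (2 * x.1 0 0) • (J .zero).mode n + (x.1 1 0) • (J .minus).mode n := fun x n => by
    change l (AddMonoidAlgebra.single n 1 ⊗ₜ[ℂ] x) +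
      (k * TrivialLieModule.equiv ℂ (LieAlgebra.loopAlgebra ℂ ℤ Sl2) ℂ 0) • (1 : Module.End ℂ V) = _
    rw [map_zero, mul_zero, zero_smul, add_zero, LinearMap.comp_apply, LinearEquiv.coe_coe,
      LieAlgebra.LoopAlgebra.toFinsupp_single_tmul, Finsupp.lsum_single]
    rfl
  have hp2 : ∀ c, p (centralElt c) = (k * c) • 1 := fun c => by
    simp [p, l, centralElt]
  have hp : ∀ x y, p ⁅x, y⁆ = ⁅p x, p y⁆ := by
    intro x y
    induction x using affine_induction with
    | hadd x x' hx hx' => rw [add_lie, map_add, hx, hx', map_add, add_lie]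
    | hcent c =>
      rw [← lie_skew, lie_centralElt, neg_zero, map_zero, hp2, smul_lie, Ring.lie_def, one_mul,
        mul_one, sub_self, smul_zero]
    | hloop x n =>
      induction y using affine_induction with
      | hadd y y' hy hy' => rw [lie_add, map_add, hy, hy', map_add, lie_add]
      | hcent c =>
        rw [lie_centralElt, map_zero, hp2, lie_smul, Ring.lie_def, one_mul, mul_one, sub_self,
          smul_zero]
      | hloop y m =>
        have hx : x.1 1 1 = -x.1 0 0 := by
          have : x.1 0 0 + x.1 1 1 = 0 := by
            simpa [LieAlgebra.SpecialLinear.sl, Matrix.trace_fin_two] using x.2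
          linear_combination this
        have hy : y.1 1 1 = -y.1 0 0 := by
          have : y.1 0 0 + y.1 1 1 = 0 := by
            simpa [LieAlgebra.SpecialLinear.sl, Matrix.trace_fin_two] using y.2
          linear_combination this
        have hd : (if n + m = 0 then (n : ℂ) * sl2Form x y else 0) • (1 : Module.End ℂ V) =
            (n * sl2Form x y) • (delta 0).mode (n + m) := by
          rw [delta_mode]; split_ifs <;> simp
        rw [loopElt_lie, map_add, hp1, hp1, hp1, hp2, mul_smul k, hd]
        simp only [add_lie, lie_add, smul_lie, lie_smul, hJ.plus_plus, hJ.plus_zero, hJ.plus_minus,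
          hJ.zero_plus, hJ.zero_zero, hJ.zero_minus, hJ.minus_plus, hJ.minus_zero, hJ.minus_minus]
        simp only [sl2Form, LinearMap.mk₂_apply, LieSubalgebra.coe_bracket, Ring.lie_def,
          Matrix.sub_apply, Matrix.mul_apply, Fin.sum_univ_two, Matrix.trace_fin_two, hx, hy]
        module
  refine ⟨{ p with map_lie' := fun {x y} => hp x y }, fun a n => ?_, ?_⟩
  · change p (loopElt (slElt a) n) = _
    rw [hp1]
    cases a <;> simp [slElt]
  · exact (hp2 1).trans (by rw [mul_one])

/-- A highest weight vector in a representation of level `k` is the image of the generator of the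
Verma module. -/
theorem verma_ne_zero {V : Type*} [AddCommGroup V] [Module ℂ V] {k j : ℂ} {J : Currents V}
    (hJ : IsAffine k J) {u : V} (hu : IsHighestWeight J j u) (hu0 : u ≠ 0) :
    (Submodule.Quotient.mk 1 : Verma k j) ≠ 0 := by
  obtain ⟨ψ, h1, h2⟩ := hJ.exists_rep
  obtain ⟨f, hf, -⟩ := exists_cyclic_map ψ u
    ({UniversalEnvelopingAlgebra.ι ℂ (Jelt .plus 0)}
      ∪ {u | ∃ (a : SlIdx) (n : ℤ), 1 ≤ n ∧ u = UniversalEnvelopingAlgebra.ι ℂ (Jelt a n)}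
      ∪ {UniversalEnvelopingAlgebra.ι ℂ Kelt - algebraMap ℂ UAffine k,
          UniversalEnvelopingAlgebra.ι ℂ (Jelt .zero 0) - algebraMap ℂ UAffine j}) (by
    rintro u ((rfl | ⟨a, n, hn, rfl⟩) | (rfl | rfl))
    · rw [UniversalEnvelopingAlgebra.lift_ι_apply, h1, hu.plus]
    · rw [UniversalEnvelopingAlgebra.lift_ι_apply, h1, hu.pos a n (by omega)]
    · rw [map_sub, UniversalEnvelopingAlgebra.lift_ι_apply, h2, AlgHom.commutes,
        Algebra.algebraMap_eq_smul_one, sub_self, LinearMap.zero_apply]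
    · rw [map_sub, UniversalEnvelopingAlgebra.lift_ι_apply, h1, AlgHom.commutes,
        Algebra.algebraMap_eq_smul_one, LinearMap.sub_apply, hu.zero, LinearMap.smul_apply,
        Module.End.one_apply, sub_self])
  intro h0
  apply hu0
  rw [← hf]
  exact (congrArg f h0).trans (map_zero f)

end AffineModules

/-! ### Fock modules -/

section FockModules

open QField

theorem oscElt_lie (x y : Osc) : ⁅oscElt x, oscElt y⁆ = oscPairing x y • oscI := by
  refine Prod.ext ?_ ?_
  · exact (smul_zero (oscPairing x y)).symm
  · change oscForm (Finsupp.single x 1) (Finsupp.single y 1) = oscPairing x y • (1 : ℂ)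
    simp [oscForm]

theorem lie_oscI (y : OscLie) : ⁅y, oscI⁆ = 0 :=
  Prod.ext rfl (map_zero (oscForm y.1))

variable {I : Ideal UOsc} (hI : ∀ n : ℤ, 1 ≤ n →
  UniversalEnvelopingAlgebra.ι ℂ (oscElt (.a n)) ∈ I ∧
    UniversalEnvelopingAlgebra.ι ℂ (oscElt (.β n)) ∈ I ∧
    UniversalEnvelopingAlgebra.ι ℂ (oscElt (.γ n)) ∈ I)

theorem isCCR_oscFields (h1 : UniversalEnvelopingAlgebra.ι ℂ oscI - 1 ∈ I) :
    IsCCR (oscFields I hI) := by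
  have hone : act (UOsc ⧸ I) oscI = 1 := LinearMap.ext fun v =>
    (act_eq_smul_of_central I oscI 1 lie_oscI (by rwa [map_one]) v).trans (one_smul ℂ v)
  have key : ∀ x y, ⁅act (UOsc ⧸ I) (oscElt x), act (UOsc ⧸ I) (oscElt y)⁆ =
      oscPairing x y • 1 := fun x y => by
    rw [act_lie, oscElt_lie, act_smul, hone]
  constructor <;> intro m n <;> refine (key _ _).trans ?_
  · rw [delta_mode, oscPairing]
    by_cases h : m + n = -1
    · rw [if_pos h, if_pos (by omega), one_smul]
    · rw [if_neg h, if_neg (by omega), zero_smul]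
  · exact zero_smul _ _
  · exact zero_smul _ _
  · exact zero_smul _ _
  · exact zero_smul _ _
  · rw [delta_mode, oscPairing]
    split_ifs <;> simp

/-- The oscillators `aₙ`, `βₙ`, `γₙ` that act as creation operators. -/
def Osc.IsCreation (t : ℤ) : Osc → Prop
  | .a n => n < 0
  | .β n => n < t
  | .γ n => n < 1 - t

theorem oscPairing_eq_zero_of_creation {t : ℤ} {x y : Osc} (hx : x.IsCreation t)
    (hy : y.IsCreation t) : oscPairing x y = 0 := by
  cases x <;> cases y <;> simp only [Osc.IsCreation] at hx hy <;> simp only [oscPairing] <;>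
    exact if_neg (by omega)

theorem oscPairing_eq_zero_of_not_creation {t : ℤ} {x y : Osc} (hx : ¬ x.IsCreation t)
    (hy : ¬ y.IsCreation t) : oscPairing x y = 0 := by
  cases x <;> cases y <;> simp only [Osc.IsCreation, not_lt] at hx hy <;> simp only [oscPairing]
  case a.a m n =>
    split_ifs with h
    -- Two non-creation modes of ∂φ with indices adding to 0 are both a_0, and the bracket m/2 is
    -- zero there.
    · rw [show m = 0 by omega]; simp
    · rfl
  all_goals exact if_neg (by omega)

open Classical in
/-- The polynomial by which the multiplicative part of an oscillator acts. -/
def fockMul (t : ℤ) (α : ℂ) (x : Osc) : MvPolynomial Osc ℂ :=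
  if x.IsCreation t then MvPolynomial.X x else if x = .a 0 then MvPolynomial.C α else 0

open Classical in
/-- The derivation by which an annihilation operator acts. -/
def fockDer (t : ℤ) (x : Osc) : Derivation ℂ (MvPolynomial Osc ℂ) (MvPolynomial Osc ℂ) :=
  MvPolynomial.mkDerivation ℂ fun y =>
    MvPolynomial.C (if x.IsCreation t then 0 else oscPairing x y)

/-- The action of the oscillators on polynomials. -/
def fockOp (t : ℤ) (α : ℂ) (x : Osc) : Module.End ℂ (MvPolynomial Osc ℂ) :=
  LinearMap.mulLeft ℂ (fockMul t α x) + (fockDer t x).toLinearMap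

theorem fockOp_apply (t : ℤ) (α : ℂ) (x : Osc) (p : MvPolynomial Osc ℂ) :
    fockOp t α x p = fockMul t α x * p + fockDer t x p := rfl

/-- These derivations send the variables to constants, so their commutator kills every variable. -/
theorem fockDer_comm (t : ℤ) (x y : Osc) (p : MvPolynomial Osc ℂ) :
    fockDer t x (fockDer t y p) = fockDer t y (fockDer t x p) := by
  have h : ⁅fockDer t x, fockDer t y⁆ = 0 := MvPolynomial.derivation_ext fun z => by
    simp [Derivation.commutator_apply, fockDer, MvPolynomial.mkDerivation_X]
  have := DFunLike.congr_fun h p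
  rwa [Derivation.commutator_apply, Derivation.zero_apply, sub_eq_zero] at this

/-- Two creation operators pair to zero, as do two annihilation operators. The pairing is thus
produced entirely by the derivation of one factor acting on the variable of the other. -/
theorem fockDer_fockMul_sub (t : ℤ) (α : ℂ) (x y : Osc) :
    fockDer t x (fockMul t α y) - fockDer t y (fockMul t α x) =
      MvPolynomial.C (oscPairing x y) := by
  have hd : ∀ x y, ¬ y.IsCreation t → fockDer t x (fockMul t α y) = 0 := fun x y hy => by
    rw [fockMul, if_neg hy]
    split_ifs
    · exact (fockDer t x).map_algebraMap α
    · rw [map_zero]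
  have hX : ∀ x y, y.IsCreation t → fockDer t x (fockMul t α y) =
      MvPolynomial.C (oscPairing x y) := fun x y hy => by
    rw [fockMul, if_pos hy, fockDer, MvPolynomial.mkDerivation_X]
    split_ifs with hx
    · rw [oscPairing_eq_zero_of_creation hx hy]
    · rfl
  by_cases hx : x.IsCreation t <;> by_cases hy : y.IsCreation t
  · rw [hX x y hy, hX y x hx, oscPairing_eq_zero_of_creation hx hy,
      oscPairing_eq_zero_of_creation hy hx, sub_self, map_zero]
  · rw [hd x y hy, hX y x hx, oscPairing_skew y x, map_neg, zero_sub, neg_neg]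
  · rw [hX x y hy, hd y x hx, sub_zero]
  · rw [hd x y hy, hd y x hx, oscPairing_eq_zero_of_not_creation hx hy, sub_self, map_zero]

theorem fockOp_lie (t : ℤ) (α : ℂ) (x y : Osc) :
    ⁅fockOp t α x, fockOp t α y⁆ = oscPairing x y • 1 := by
  refine LinearMap.ext fun p => ?_
  rw [bracket_apply]
  simp only [fockOp_apply, map_add, Derivation.leibniz, smul_eq_mul, LinearMap.smul_apply,
    Module.End.one_apply]
  rw [MvPolynomial.smul_eq_C_mul, ← fockDer_fockMul_sub t α x y, fockDer_comm t x y]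
  ring

/-- The polynomial representation of the oscillator algebra. -/
def fockRep (t : ℤ) (α : ℂ) : OscLie →ₗ⁅ℂ⁆ Module.End ℂ (MvPolynomial Osc ℂ) where
  toFun x := Finsupp.linearCombination ℂ (fockOp t α) x.1 + x.2 • 1
  map_add' x y := by
    change Finsupp.linearCombination ℂ (fockOp t α) (x.1 + y.1) + (x.2 + y.2) • 1 = _
    rw [map_add]
    module
  map_smul' c x := by
    change Finsupp.linearCombination ℂ (fockOp t α) (c • x.1) + (c * x.2) • 1 = _
    rw [map_smul, RingHom.id_apply]
    module
  map_lie' {x y} := by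
    obtain ⟨f, c⟩ := x
    obtain ⟨g, d⟩ := y
    change Finsupp.linearCombination ℂ (fockOp t α) 0 + oscForm f g • 1 =
      ⁅Finsupp.linearCombination ℂ (fockOp t α) f + c • 1,
        Finsupp.linearCombination ℂ (fockOp t α) g + d • 1⁆
    have h (A B : Module.End ℂ (MvPolynomial Osc ℂ)) : ⁅A + c • 1, B + d • 1⁆ = ⁅A, B⁆ := by
      simp only [Ring.lie_def, add_mul, mul_add, mul_smul_comm, smul_mul_assoc, mul_one, one_mul]
      module
    refine Eq.trans ?_ (h _ _).symm
    rw [map_zero, zero_add]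
    induction f using Finsupp.induction_linear with
    | zero => rw [map_zero, map_zero, LinearMap.zero_apply, zero_smul, zero_lie]
    | add f f' hf hf' => rw [map_add, map_add, LinearMap.add_apply, add_smul, hf, hf', add_lie]
    | single x r =>
      induction g using Finsupp.induction_linear with
      | zero => rw [map_zero, map_zero, zero_smul, lie_zero]
      | add g g' hg hg' => rw [map_add, map_add, add_smul, hg, hg', lie_add]
      | single y s =>
        rw [Finsupp.linearCombination_single, Finsupp.linearCombination_single, smul_lie, lie_smul,
          fockOp_lie]
        simp [oscForm, smul_smul]

theorem fockRep_oscElt (t : ℤ) (α : ℂ) (x : Osc) : fockRep t α (oscElt x) = fockOp t α x := by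
  change Finsupp.linearCombination ℂ (fockOp t α) (Finsupp.single x 1) + (0 : ℂ) • 1 = _
  simp

theorem fockRep_oscI (t : ℤ) (α : ℂ) : fockRep t α oscI = 1 := by
  change Finsupp.linearCombination ℂ (fockOp t α) 0 + (1 : ℂ) • 1 = _
  simp

theorem fockOp_one_of_not_creation {t : ℤ} {α : ℂ} {x : Osc} (hx : ¬ x.IsCreation t)
    (h0 : x ≠ .a 0) : fockOp t α x 1 = 0 := by
  rw [fockOp_apply, Derivation.map_one_eq_zero, fockMul, if_neg hx, if_neg h0, zero_mul, add_zero]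

/-- The derivation part of a creation operator is zero, and multiplication by a variable has no
constant term. -/
theorem constantCoeff_fockOp_of_creation {t : ℤ} {α : ℂ} {x : Osc} (hx : x.IsCreation t)
    (p : MvPolynomial Osc ℂ) : MvPolynomial.constantCoeff (fockOp t α x p) = 0 := by
  have h : fockDer t x = 0 := MvPolynomial.derivation_ext fun z => by
    simp [fockDer, MvPolynomial.mkDerivation_X, hx]
  rw [fockOp_apply, h, Derivation.zero_apply, add_zero, fockMul, if_pos hx, map_mul,
    MvPolynomial.constantCoeff_X, zero_mul]

/-- The functional on a cyclic module of the oscillator algebra that takes the value `1` on the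
generator and vanishes on the image of the creation operators. -/
theorem exists_vacuum_functional (t : ℤ) (α : ℂ) (S : Set UOsc)
    (hS : ∀ u ∈ S, UniversalEnvelopingAlgebra.lift ℂ (fockRep t α) u 1 = 0) :
    ∃ φ : (UOsc ⧸ Ideal.span S) →ₗ[ℂ] ℂ, φ (Submodule.Quotient.mk 1) = 1 ∧
      ∀ x : Osc, x.IsCreation t → ∀ v, φ (act (UOsc ⧸ Ideal.span S) (oscElt x) v) = 0 := by
  obtain ⟨f, hf1, hf⟩ := exists_cyclic_map (fockRep t α) 1 S hS
  refine ⟨(MvPolynomial.aeval (fun _ => (0 : ℂ))).toLinearMap ∘ₗ f, ?_, fun x hx v => ?_⟩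
  · rw [LinearMap.comp_apply, hf1]; simp
  · rw [LinearMap.comp_apply, hf, fockRep_oscElt]
    simpa using constantCoeff_fockOp_of_creation (α := α) hx (f v)

theorem isCCR_fockFields (κ j : ℂ) : IsCCR (fockFields κ j) :=
  isCCR_oscFields _ (Ideal.subset_span (Or.inl (Or.inr rfl)))

theorem isCCR_dualFockFields (κ j : ℂ) : IsCCR (dualFockFields κ j) :=
  isCCR_oscFields _ (Ideal.subset_span (Or.inl (Or.inr rfl)))

theorem isVacuum_fockVec (κ j : ℂ) : IsVacuum (fockFields κ j) 0 (κ⁻¹ * j) (fockVec κ j) where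
  gamma p hp := act_mk_one _ _
    (Ideal.subset_span (Or.inr ⟨p, by omega, Or.inr (Or.inl rfl)⟩))
  beta p hp := act_mk_one _ _ (Ideal.subset_span (Or.inr ⟨p, hp, Or.inl rfl⟩))
  dphi p hp := act_mk_one _ _ (fockIdeal_mem κ j p (by omega)).1
  dphi_zero := act_mk_one_eq_smul _ _ _ (Ideal.subset_span (Or.inl (Or.inl rfl)))

theorem isVacuum_dualFockVec (κ j : ℂ) :
    IsVacuum (dualFockFields κ j) 1 (-(κ⁻¹ * (j + 1))) (dualFockVec κ j) where
  gamma p hp := act_mk_one _ _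
    (Ideal.subset_span (Or.inr ⟨p + 1, by omega, Or.inr (Or.inl rfl)⟩))
  beta p hp := act_mk_one _ _ (dualFockIdeal_mem κ j p hp).2.1
  dphi p hp := act_mk_one _ _ (dualFockIdeal_mem κ j p (by omega)).1
  dphi_zero := act_mk_one_eq_smul _ _ _
    (Ideal.subset_span (Or.inl (Or.inl (by rw [map_neg, sub_neg_eq_add]))))

theorem exists_fock_functional (κ j : ℂ) : ∃ φ : Fock κ j →ₗ[ℂ] ℂ,
    (∀ p, p < -0 → ∀ v, φ ((fockFields κ j).gamma.mode p v) = 0) ∧ φ (fockVec κ j) = 1 := by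
  obtain ⟨φ, h1, h2⟩ := exists_vacuum_functional 0 (κ⁻¹ * j)
    ({UniversalEnvelopingAlgebra.ι ℂ (oscElt (.a 0)) - algebraMap ℂ UOsc (κ⁻¹ * j),
        UniversalEnvelopingAlgebra.ι ℂ oscI - 1}
      ∪ {u | ∃ n : ℤ, 0 ≤ n ∧
          (u = UniversalEnvelopingAlgebra.ι ℂ (oscElt (.β n))
            ∨ u = UniversalEnvelopingAlgebra.ι ℂ (oscElt (.γ (n + 1)))
            ∨ u = UniversalEnvelopingAlgebra.ι ℂ (oscElt (.a (n + 1))))}) (by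
    rintro u ((rfl | rfl) | ⟨n, hn, rfl | rfl | rfl⟩)
    · rw [map_sub, UniversalEnvelopingAlgebra.lift_ι_apply, fockRep_oscElt, AlgHom.commutes,
        Algebra.algebraMap_eq_smul_one, LinearMap.sub_apply, fockOp_apply,
        Derivation.map_one_eq_zero, fockMul, if_neg (by simp [Osc.IsCreation]), if_pos rfl]
      simp [MvPolynomial.smul_eq_C_mul]
    · rw [map_sub, UniversalEnvelopingAlgebra.lift_ι_apply, fockRep_oscI, map_one (UniversalEnvelopingAlgebra.lift ℂ _),
        sub_self, LinearMap.zero_apply]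
    all_goals
      rw [UniversalEnvelopingAlgebra.lift_ι_apply, fockRep_oscElt]
      refine fockOp_one_of_not_creation (by simp only [Osc.IsCreation]; omega) ?_
      simp <;> omega)
  exact ⟨φ, fun p hp v => h2 (.γ (p + 1)) (by simp only [Osc.IsCreation]; omega) v, h1⟩

theorem exists_dualFock_functional (κ j : ℂ) : ∃ φ : DualFock κ j →ₗ[ℂ] ℂ,
    (∀ p, p < -1 → ∀ v, φ ((dualFockFields κ j).gamma.mode p v) = 0) ∧
      φ (dualFockVec κ j) = 1 := by
  obtain ⟨φ, h1, h2⟩ := exists_vacuum_functional 1 (-(κ⁻¹ * (j + 1)))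
    ({UniversalEnvelopingAlgebra.ι ℂ (oscElt (.a 0)) + algebraMap ℂ UOsc (κ⁻¹ * (j + 1)),
        UniversalEnvelopingAlgebra.ι ℂ oscI - 1}
      ∪ {u | ∃ n : ℤ, 0 ≤ n ∧
          (u = UniversalEnvelopingAlgebra.ι ℂ (oscElt (.β (n + 1)))
            ∨ u = UniversalEnvelopingAlgebra.ι ℂ (oscElt (.γ n))
            ∨ u = UniversalEnvelopingAlgebra.ι ℂ (oscElt (.a (n + 1))))}) (by
    rintro u ((rfl | rfl) | ⟨n, hn, rfl | rfl | rfl⟩)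
    · rw [map_add, UniversalEnvelopingAlgebra.lift_ι_apply, fockRep_oscElt, AlgHom.commutes,
        Algebra.algebraMap_eq_smul_one, LinearMap.add_apply, fockOp_apply,
        Derivation.map_one_eq_zero, fockMul, if_neg (by simp [Osc.IsCreation]), if_pos rfl]
      simp [MvPolynomial.smul_eq_C_mul]
    · rw [map_sub, UniversalEnvelopingAlgebra.lift_ι_apply, fockRep_oscI, map_one (UniversalEnvelopingAlgebra.lift ℂ _),
        sub_self, LinearMap.zero_apply]
    all_goals
      rw [UniversalEnvelopingAlgebra.lift_ι_apply, fockRep_oscElt]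
      refine fockOp_one_of_not_creation (by simp only [Osc.IsCreation]; omega) ?_
      simp <;> omega)
  exact ⟨φ, fun p hp v => h2 (.γ (p + 1)) (by simp only [Osc.IsCreation]; omega) v, h1⟩

theorem fockVec_ne_zero (κ j : ℂ) : fockVec κ j ≠ 0 := by
  obtain ⟨φ, -, h⟩ := exists_fock_functional κ j
  intro h0
  rw [h0, map_zero] at h
  exact zero_ne_one h

end FockModules

/-! ### The irreducible modules of level one are nonzero -/

section Grading

open QField

/-- The degree of `Jᵃₘ` for twice the conformal grading minus the charge. -/
def slDegree : SlIdx → ℤ → ℤ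
  | .plus, m => -2 * m - 1
  | .zero, m => -2 * m
  | .minus, m => -2 * m + 1

variable {H : Type*} [AddCommGroup H] [Module ℂ H]

/-- The operator `2 L₀ - K⁰₀`. -/
def gradingOp (K : Currents H) : Module.End ℂ H :=
  (2 : ℂ) • (sugawara 1 K).mode 1 - (K .zero).mode 0

theorem gradingOp_lie {K : Currents H} (hK : IsAffine 1 K) (a : SlIdx) (m : ℤ) :
    ⁅gradingOp K, (K a).mode m⁆ = (slDegree a m : ℂ) • (K a).mode m := by
  rw [gradingOp, sub_lie, smul_lie, sugawara_lie hK]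
  cases a
  · rw [hK.zero_plus, zero_add, slDegree]; push_cast; module
  · rw [hK.zero_zero, slDegree]; push_cast; simp; module
  · rw [hK.zero_minus, zero_add, slDegree]; push_cast; module

theorem IsHighestWeight.gradingOp_apply {K : Currents H} (hK : IsAffine 1 K) {l : ℂ} {v : H}
    (hv : IsHighestWeight K l v) : gradingOp K v = (2 * (l * (l + 1) / (1 + 2)) - l) • v := by
  rw [gradingOp, LinearMap.sub_apply, LinearMap.smul_apply, hv.sugawara_zero hK,
    hv.zero]
  module

/-- This is the advantage of 2L_0 - K^0_0 over L_0: its modes of negative degree are exactly those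
killing a highest weight vector, and only K^0_0 has degree zero. -/
theorem IsHighestWeight.apply_of_slDegree_neg {K : Currents H} {l : ℂ} {v : H}
    (hv : IsHighestWeight K l v) {a : SlIdx} {m : ℤ} (h : slDegree a m < 0) :
    (K a).mode m v = 0 := by
  by_cases hm : 0 < m
  · exact hv.pos a m hm
  · cases a <;> simp only [slDegree] at h
    · rw [show m = 0 by omega]; exact hv.plus
    · omega
    · omega

/-- The span of eigenvectors whose eigenvalue exceeds `δ` by a positive integer. -/
def upperSpan (D : Module.End ℂ H) (δ : ℂ) : Submodule ℂ H :=
  Submodule.span ℂ {y | ∃ n : ℕ, D y = (δ + (n + 1)) • y}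

/-- A product of factors X - (δ + n + 1) kills a sum of the eigenvectors and does not vanish at δ.
Such a polynomial isolates the component along the δ-eigenvector. -/
theorem exists_aeval_eq_zero_of_mem_upperSpan {D : Module.End ℂ H} {δ : ℂ} {p : H}
    (hp : p ∈ upperSpan D δ) :
    ∃ q : Polynomial ℂ, Polynomial.aeval D q p = 0 ∧ q.eval δ ≠ 0 := by
  induction hp using Submodule.span_induction with
  | mem y hy =>
    obtain ⟨n, hn⟩ := hy
    refine ⟨Polynomial.X - Polynomial.C (δ + (n + 1)), ?_, ?_⟩
    · rw [map_sub, Polynomial.aeval_X, Polynomial.aeval_C, LinearMap.sub_apply, hn,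
        Module.algebraMap_end_apply, sub_self]
    · rw [Polynomial.eval_sub, Polynomial.eval_X, Polynomial.eval_C, sub_add_cancel_left, neg_ne_zero]
      exact_mod_cast n.succ_ne_zero
  | zero => exact ⟨1, map_zero _, by simp⟩
  | add x y _ _ hx hy =>
    obtain ⟨q, hq, hq'⟩ := hx
    obtain ⟨r, hr, hr'⟩ := hy
    refine ⟨q * r, ?_, by rw [Polynomial.eval_mul]; exact mul_ne_zero hq' hr'⟩
    rw [map_add, map_mul, Module.End.mul_apply, Module.End.mul_apply, hr, map_zero, add_zero,
      ← Module.End.mul_apply, ← map_mul, mul_comm, map_mul, Module.End.mul_apply, hq, map_zero]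
  | smul c x _ hx =>
    obtain ⟨q, hq, hq'⟩ := hx
    exact ⟨q, by rw [map_smul, hq, smul_zero], hq'⟩

theorem aeval_apply_of_eigenvector {D : Module.End ℂ H} {δ : ℂ} {f : H} (hf : D f = δ • f)
    (q : Polynomial ℂ) : Polynomial.aeval D q f = q.eval δ • f := by
  induction q using Polynomial.induction_on' with
  | add p q hp hq => rw [map_add, LinearMap.add_apply, hp, hq, Polynomial.eval_add, add_smul]
  | monomial n a =>
    have : ∀ n : ℕ, (D ^ n) f = δ ^ n • f := fun n => by
      induction n with
      | zero => simp
      | succ n ih => rw [pow_succ, Module.End.mul_apply, hf, map_smul, ih, smul_smul, pow_succ,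
          mul_comm]
    rw [Polynomial.aeval_monomial, Polynomial.eval_monomial, Module.End.mul_apply, this,
      Module.algebraMap_end_apply, smul_smul]

theorem aeval_mem {D : Module.End ℂ H} {S : Submodule ℂ H} (hS : ∀ v ∈ S, D v ∈ S)
    (q : Polynomial ℂ) {v : H} (hv : v ∈ S) : Polynomial.aeval D q v ∈ S := by
  induction q using Polynomial.induction_on' with
  | add p q hp hq => rw [map_add, LinearMap.add_apply]; exact S.add_mem hp hq
  | monomial n a =>
    have : ∀ n : ℕ, (D ^ n) v ∈ S := fun n => by
      induction n with
      | zero => simpa using hv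
      | succ n ih => rw [pow_succ', Module.End.mul_apply]; exact hS _ ih
    rw [Polynomial.aeval_monomial, Module.End.mul_apply, Module.algebraMap_end_apply]
    exact S.smul_mem _ (this n)

theorem not_mem_upperSpan {D : Module.End ℂ H} {δ : ℂ} {f : H} (hf : D f = δ • f) (hf0 : f ≠ 0) :
    f ∉ upperSpan D δ := fun h => by
  obtain ⟨q, hq, hq'⟩ := exists_aeval_eq_zero_of_mem_upperSpan h
  rw [aeval_apply_of_eigenvector hf, smul_eq_zero] at hq
  exact hq.elim hq' hf0

/-- A subspace stable under `D` that does not contain the eigenvector `f` lies in the span of the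
higher eigenvectors. -/
theorem le_upperSpan {D : Module.End ℂ H} {δ : ℂ} {f : H} (hf : D f = δ • f)
    (htop : ∀ v, ∃ c : ℂ, v - c • f ∈ upperSpan D δ) {S : Submodule ℂ H}
    (hS : ∀ v ∈ S, D v ∈ S) (hfS : f ∉ S) : S ≤ upperSpan D δ := by
  intro v hv
  obtain ⟨c, hc⟩ := htop v
  obtain ⟨q, hq, hq'⟩ := exists_aeval_eq_zero_of_mem_upperSpan hc
  have h := aeval_mem hS q hv
  -- Applying q(D) to v removes the upper part and puts c q(δ) f into S, so c must vanish.
  rw [map_sub, sub_eq_zero, map_smul, aeval_apply_of_eigenvector hf, smul_smul] at hq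
  rw [hq] at h
  by_cases hc0 : c = 0
  · rwa [hc0, zero_smul, sub_zero] at hc
  · refine absurd ?_ hfS
    have := S.smul_mem (c * q.eval δ)⁻¹ h
    rwa [smul_smul, inv_mul_cancel₀ (mul_ne_zero hc0 hq'), one_smul] at this

/-- A word of total degree zero uses only K^0_0 and gives a multiple of f; any other word has
strictly positive degree. -/
theorem lowered_decomposition {K : Currents H} (hK : IsAffine 1 K) {l : ℂ} {f : H}
    (hf : IsHighestWeight K l f) {δ : ℂ} (hδ : gradingOp K f = δ • f) {y : H}
    (hy : Lowered K slDegree f y) :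
    (∃ c : ℂ, y = c • f) ∨ ∃ n : ℕ, gradingOp K y = (δ + (n + 1)) • y := by
  have key : ∀ (z : H) (e : ℂ) (a : SlIdx) (m : ℤ), 0 ≤ slDegree a m → gradingOp K z = e • z →
      gradingOp K ((K a).mode m z) = (e + ((slDegree a m).toNat : ℂ)) • (K a).mode m z :=
    fun z e a m h hz => by
      have h' : ((slDegree a m).toNat : ℂ) = (slDegree a m : ℂ) := by
        exact_mod_cast Int.toNat_of_nonneg h
      rw [apply_apply_eq, hz, gradingOp_lie hK, map_smul, LinearMap.smul_apply, ← add_smul, h']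
  induction hy with
  | base => exact Or.inl ⟨1, (one_smul _ _).symm⟩
  | step y a m h hy ih =>
    rcases ih with ⟨c, rfl⟩ | ⟨n, hn⟩
    · by_cases h0 : slDegree a m = 0
      · left
        cases a <;> simp only [slDegree] at h0
        · omega
        · rw [show m = 0 by omega, map_smul, hf.zero, smul_smul]
          exact ⟨_, rfl⟩
        · omega
      · right
        refine ⟨(slDegree a m).toNat - 1, ?_⟩
        rw [key _ δ a m h (by rw [map_smul, hδ, smul_comm])]
        congr 2
        have : ((slDegree a m).toNat - 1) + 1 = (slDegree a m).toNat := by omega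
        exact_mod_cast this.symm
    · right
      refine ⟨n + (slDegree a m).toNat, ?_⟩
      rw [key _ _ a m h hn]
      congr 1
      push_cast
      ring

theorem sugawara_mem {k : ℂ} {K : Currents H} {S : Submodule ℂ H}
    (hS : ∀ a m, ∀ v ∈ S, (K a).mode m v ∈ S) (n : ℤ) (v : H) (hv : v ∈ S) :
    (sugawara k K).mode n v ∈ S := by
  simp only [sugawara, smul_mode, add_mode, LinearMap.smul_apply, LinearMap.add_apply]
  exact S.smul_mem _ (S.add_mem (S.add_mem (nprod_mem (hS _) (hS _) n v hv)
    (S.smul_mem _ (nprod_mem (hS _) (hS _) n v hv)))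
    (S.smul_mem _ (nprod_mem (hS _) (hS _) n v hv)))

/-- A proper submodule is stable under the grading operator and does not contain the generator, so
it lies in the span of the higher eigenvectors. So does the sum of all proper submodules, and the
generator is not in that span. -/
theorem irrVec_ne_zero_of_verma {j : ℂ} (h0 : (Submodule.Quotient.mk 1 : Verma 1 j) ≠ 0) :
    irrVec 1 j ≠ 0 := by
  have hK := isAffine_vermaCurrents 1 j
  have hf := isHighestWeight_verma 1 j
  have hD := hf.gradingOp_apply hK
  have hspan : Submodule.span ℂ {y | Lowered (vermaCurrents 1 j) slDegree
      (Submodule.Quotient.mk 1) y} = ⊤ := by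
    refine eq_top_iff.2 fun v _ => cyclic_induction _ _ (Submodule.subset_span Lowered.base)
      (act_mem_of_act_Jelt_mem (Kelt_smul_verma 1 j) fun a m v hv => ?_) v
    exact span_lowered_stable hK (fun a m h => hf.apply_of_slDegree_neg h) a m v hv
  have htop : ∀ v : Verma 1 j, ∃ c : ℂ, v - c • (Submodule.Quotient.mk 1 : Verma 1 j) ∈
      upperSpan (gradingOp (vermaCurrents 1 j)) (2 * (j * (j + 1) / (1 + 2)) - j) := by
    intro v
    have hv : v ∈ Submodule.span ℂ {y | Lowered (vermaCurrents 1 j) slDegree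
      (Submodule.Quotient.mk 1) y} := hspan ▸ Submodule.mem_top
    induction hv using Submodule.span_induction with
    | mem y hy =>
      rcases lowered_decomposition hK hf hD hy with ⟨c, hc⟩ | hn
      · exact ⟨c, by rw [hc, sub_self]; exact Submodule.zero_mem _⟩
      · exact ⟨0, by rw [zero_smul, sub_zero]; exact Submodule.subset_span hn⟩
    | zero => exact ⟨0, by rw [zero_smul, sub_zero]; exact Submodule.zero_mem _⟩
    | add x y _ _ hx hy =>
      obtain ⟨c, hc⟩ := hx
      obtain ⟨d, hd⟩ := hy
      refine ⟨c + d, ?_⟩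
      rw [add_smul, add_sub_add_comm]
      exact Submodule.add_mem _ hc hd
    | smul r x _ hx =>
      obtain ⟨c, hc⟩ := hx
      refine ⟨r * c, ?_⟩
      rw [mul_smul, ← smul_sub]
      exact Submodule.smul_mem _ r hc
  have hle : ∀ N : Submodule UAffine (Verma 1 j), N ≠ ⊤ → N.restrictScalars ℂ ≤
      upperSpan (gradingOp (vermaCurrents 1 j)) (2 * (j * (j + 1) / (1 + 2)) - j) := by
    intro N hN
    have hs : ∀ a m, ∀ v ∈ N.restrictScalars ℂ, (vermaCurrents 1 j a).mode m v ∈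
        N.restrictScalars ℂ := fun a m v hv => N.smul_mem _ hv
    refine le_upperSpan hD htop (fun v hv => ?_) fun h1 => hN ?_
    · exact Submodule.sub_mem _ (Submodule.smul_mem _ _ (sugawara_mem hs 1 v hv)) (hs _ _ v hv)
    · refine eq_top_iff.2 fun v _ => ?_
      obtain ⟨u, rfl⟩ := Submodule.Quotient.mk_surjective _ v
      have := N.smul_mem u h1
      rwa [← Submodule.Quotient.mk_smul, smul_eq_mul, mul_one] at this
  intro h
  have hmem : (Submodule.Quotient.mk 1 : Verma 1 j) ∈ vermaRad 1 j :=
    (Submodule.Quotient.mk_eq_zero _).1 h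
  rw [vermaRad, sSup_eq_iSup'] at hmem
  refine not_mem_upperSpan hD h0 ?_
  refine Submodule.iSup_induction _ (motive := fun v => v ∈
    upperSpan (gradingOp (vermaCurrents 1 j)) (2 * (j * (j + 1) / (1 + 2)) - j)) hmem
    (fun N v hv => hle N.1 N.2 hv) (Submodule.zero_mem _) fun _ _ => Submodule.add_mem _

/-- A square root of 3 makes the Wakimoto currents a level-one representation with a nonzero highest
weight vector of any given weight. -/
theorem irrVec_ne_zero (j : ℂ) : irrVec 1 j ≠ 0 := by
  obtain ⟨κ, hκ⟩ := IsAlgClosed.exists_pow_nat_eq (3 : ℂ) (n := 2) two_pos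
  have hκ0 : κ ≠ 0 := by
    rintro rfl
    norm_num at hκ
  have hl : level κ = 1 := by rw [level, hκ]; norm_num
  have hv := (isVacuum_fockVec κ j).isHighestWeight κ
  have hJ := (isCCR_fockFields κ j).isAffine κ
  rw [mul_inv_cancel_left₀ hκ0] at hv
  rw [hl] at hJ
  exact irrVec_ne_zero_of_verma (verma_ne_zero hJ hv (fockVec_ne_zero κ j))

end Grading

/-! ### Extremal vectors in the irreducible modules of level one -/

section LevelOne

open QField

variable {H : Type*} [AddCommGroup H] [Module ℂ H]

theorem IsHighestWeight.plus_of_nonneg {K : Currents H} {l : ℂ} {f : H} (hf : IsHighestWeight K l f)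
    (m : ℤ) (hm : 0 ≤ m) : (K .plus).mode m f = 0 := by
  rcases hm.eq_or_lt with rfl | hm
  · exact hf.plus
  · exact hf.pos _ _ hm

variable {K : Currents H} (hK : IsAffine 1 K) {l : ℂ} {f : H} (hf : IsHighestWeight K l f)
include hK hf

theorem IsHighestWeight.plus_minus (m : ℤ) (hm : 0 ≤ m) :
    (K .plus).mode m ((K .minus).mode 0 f) = (2 : ℂ) • (K .zero).mode m f := by
  rw [apply_apply_eq, hf.plus_of_nonneg m hm, map_zero, zero_add, hK.plus_minus, add_zero, one_mul,
    LinearMap.add_apply, LinearMap.smul_apply, LinearMap.smul_apply, delta_mode]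
  split_ifs with h
  · rw [h]; simp
  · simp

theorem IsHighestWeight.zero_minus (m : ℤ) (hm : 0 < m) :
    (K .zero).mode m ((K .minus).mode 0 f) = 0 := by
  rw [apply_apply_eq, hf.pos _ m hm, map_zero, zero_add, hK.zero_minus, add_zero,
    LinearMap.neg_apply, hf.pos _ m hm, neg_zero]

theorem IsHighestWeight.minus_minus (m : ℤ) (hm : 0 < m) :
    (K .minus).mode m ((K .minus).mode 0 f) = 0 := by
  rw [apply_comm_of_bracket_eq_zero (hK.minus_minus m 0), hf.pos _ m hm, map_zero]

omit hf in
theorem gradingOp_apply_mode {μ : ℂ} {v : H} (hv : gradingOp K v = μ • v) (a : SlIdx) (m : ℤ) :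
    gradingOp K ((K a).mode m v) = (μ + slDegree a m) • (K a).mode m v := by
  rw [apply_apply_eq, hv, gradingOp_lie hK, map_smul, LinearMap.smul_apply, add_smul]

variable (hirr : IsIrr K) (hf0 : f ≠ 0)
include hirr hf0

theorem IsHighestWeight.eq_zero_of_singular {v : H} {r : ℕ} (hr : 0 < r)
    (hv : gradingOp K v = (2 * (l * (l + 1) / (1 + 2)) - l + r) • v)
    (hs : ∀ a m, slDegree a m < 0 → (K a).mode m v = 0) : v = 0 := by
  refine AffineCoset.eq_zero_of_singular hK hirr (gradingOp_lie hK) hf0 (hf.gradingOp_apply hK) hv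
    (fun n hn => ?_) hs
  have : ((r + n : ℕ) : ℂ) = 0 := by push_cast; linear_combination -hn
  have := Nat.cast_eq_zero.1 this
  omega

/-- K^-_0 f is singular because K^+_0 K^-_0 f = 2l f = 0. -/
theorem IsHighestWeight.minus_eq_zero (hl : l = 0) : (K .minus).mode 0 f = 0 := by
  refine hf.eq_zero_of_singular hK hirr hf0 (r := 1) one_pos ?_ fun a m hm => ?_
  · rw [gradingOp_apply_mode hK (hf.gradingOp_apply hK)]
    simp [slDegree]
  · cases a <;> simp only [slDegree] at hm
    · rw [hf.plus_minus hK m (by omega)]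
      rcases (show 0 ≤ m by omega).eq_or_lt with rfl | hm
      · rw [hf.zero, hl, zero_smul, smul_zero]
      · rw [hf.pos _ m hm, smul_zero]
    · exact hf.zero_minus hK m (by omega)
    · exact hf.minus_minus hK m (by omega)

/-- The vector is singular: K^+_0 sends it to 2(2l - 1) K^-_0 f, which is 0. -/
theorem IsHighestWeight.minus_minus_eq_zero (hl : l = 1 / 2) :
    (K .minus).mode 0 ((K .minus).mode 0 f) = 0 := by
  refine hf.eq_zero_of_singular hK hirr hf0 (r := 2) two_pos ?_ fun a m hm => ?_
  · rw [gradingOp_apply_mode hK (gradingOp_apply_mode hK (hf.gradingOp_apply hK) _ _)]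
    simp [slDegree]
    module
  · cases a <;> simp only [slDegree] at hm
    · rw [apply_apply_eq, hf.plus_minus hK m (by omega), hK.plus_minus, add_zero, one_mul,
        LinearMap.add_apply, LinearMap.smul_apply, LinearMap.smul_apply]
      rcases (show 0 ≤ m by omega).eq_or_lt with rfl | hm
      · rw [apply_apply_eq ((K .zero).mode 0), hf.zero, hK.zero_minus, hl, add_zero]
        simp
        module
      · rw [hf.pos _ m hm, hf.zero_minus hK m hm, delta_mode, if_neg hm.ne']
        simp
    · rw [apply_apply_eq, hf.zero_minus hK m (by omega), hK.zero_minus, add_zero,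
        LinearMap.neg_apply, hf.minus_minus hK m (by omega), map_zero, neg_zero, add_zero]
    · rw [apply_comm_of_bracket_eq_zero (hK.minus_minus m 0), hf.minus_minus hK m (by omega),
        map_zero]

/-- The vector is singular: K^-_1 K^+_{-1} f = (1 - 2l) f = 0. The dual chain for ε = 1/2 starts at
index -2 for this reason. -/
theorem IsHighestWeight.plus_neg_one_eq_zero (hl : l = 1 / 2) : (K .plus).mode (-1) f = 0 := by
  refine hf.eq_zero_of_singular hK hirr hf0 (r := 1) one_pos ?_ fun a m hm => ?_
  · rw [gradingOp_apply_mode hK (hf.gradingOp_apply hK)]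
    simp [slDegree]
  · cases a <;> simp only [slDegree] at hm
    · rw [apply_comm_of_bracket_eq_zero (hK.plus_plus m _), hf.plus_of_nonneg m (by omega), map_zero]
    · rw [apply_apply_eq, hf.pos _ m (by omega), hK.zero_plus, map_zero, zero_add,
        hf.plus_of_nonneg _ (by omega)]
    · rw [apply_apply_eq, hf.pos _ m (by omega), hK.minus_plus, map_zero, zero_add,
        LinearMap.add_apply, LinearMap.smul_apply, LinearMap.smul_apply, delta_mode]
      rcases (show 1 ≤ m by omega).eq_or_lt with rfl | hm
      · rw [add_neg_cancel, hf.zero, hl]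
        simp
      · rw [hf.pos _ _ (by omega), if_neg (by omega)]
        simp

theorem IsHighestWeight.nprod_plus_plus_eq_zero (hl : l = 0 ∨ l = 1 / 2) (N : ℤ) :
    (nprod (K .plus) (K .plus)).mode N = 0 := by
  refine AffineCoset.nprod_plus_plus_eq_zero hK hirr hf0 (c := 2 * l) hf.pos hf.plus ?_ ?_
    (hf.sugawara_zero hK) N
  · rcases hl with hl | hl
    · rw [hf.minus_eq_zero hK hirr hf0 hl, map_zero]
    · exact hf.minus_minus_eq_zero hK hirr hf0 hl
  · rw [hf.plus_minus hK 0 le_rfl, hf.zero, smul_smul]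

omit hK hirr hf0 in
theorem IsHighestWeight.swap_of_eq_zero (hl : l = 0) (hm : (K .minus).mode 0 f = 0) :
    IsHighestWeight (swap K) l f where
  pos a m hm := by cases a <;> simp [swap, hf.pos _ m hm]
  plus := by simp [swap, hm]
  zero := by simp [swap, hf.zero, hl]

/-- The relation for K^+ is applied to the swapped currents. Their highest weight vector is the
other end of the top component: f itself for l = 0, and K^-_0 f for l = 1/2. -/
theorem IsHighestWeight.nprod_minus_minus_eq_zero (hl : l = 0 ∨ l = 1 / 2) (N : ℤ) :
    (nprod (K .minus) (K .minus)).mode N = 0 := by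
  have key : ∀ g : H, g ≠ 0 → IsHighestWeight (swap K) l g →
      (nprod (K .minus) (K .minus)).mode N = 0 := fun g hg0 hg => by
    have := hg.nprod_plus_plus_eq_zero hK.swap hirr.swap hg0 hl N
    rwa [show swap K .plus = -K .minus from rfl, neg_nprod_neg] at this
  rcases hl with h | h
  · exact key f hf0 (hf.swap_of_eq_zero h (hf.minus_eq_zero hK hirr hf0 h))
  · have hpm : (K .plus).mode 0 ((K .minus).mode 0 f) = f := by
      rw [hf.plus_minus hK 0 le_rfl, hf.zero, h, smul_smul]
      norm_num
    refine key ((K .minus).mode 0 f) (fun h0 => hf0 ?_) ⟨fun a m hm => ?_, ?_, ?_⟩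
    · rw [← hpm, h0, map_zero]
    · cases a
      · simp [swap, hf.minus_minus hK m hm]
      · simp [swap, hf.zero_minus hK m hm]
      · simp [swap, hf.plus_minus hK m hm.le, hf.pos _ m hm]
    · simp [swap, hf.minus_minus_eq_zero hK hirr hf0 h]
    · rw [show swap K .zero = -K .zero from rfl, neg_mode, LinearMap.neg_apply, apply_apply_eq,
        hf.zero, hK.zero_minus, LinearMap.neg_apply, map_smul, add_zero, h]
      module

theorem IsHighestWeight.chain_zero (hl : l = 0) (i : ℕ) :
    modeChain (K .minus) (fun i => -2 * (i : ℤ) - 1) f i ≠ 0 ∧ ∀ m, -2 * (i : ℤ) - 1 < m →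
      (K .minus).mode m (modeChain (K .minus) (fun i => -2 * (i : ℤ) - 1) f i) = 0 := by
  refine extremal_chain hK (hf.nprod_minus_minus_eq_zero hK hirr hf0 (Or.inl hl)) hf0
    (q := l) (fun i => by push_cast; ring) (by simp [hl]) (hf.pos _) hf.zero
    (fun m hm => hf.plus_of_nonneg m (by push_cast at hm; omega)) (fun m hm => ?_) i
  rcases (show 0 ≤ m by push_cast at hm; omega).eq_or_lt with rfl | hm
  · exact hf.minus_eq_zero hK hirr hf0 hl
  · exact hf.pos _ m hm

theorem IsHighestWeight.chain_half (hl : l = 1 / 2) (i : ℕ) :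
    modeChain (K .minus) (fun i => -2 * (i : ℤ)) f i ≠ 0 ∧ ∀ m, -2 * (i : ℤ) < m →
      (K .minus).mode m (modeChain (K .minus) (fun i => -2 * (i : ℤ)) f i) = 0 :=
  extremal_chain hK (hf.nprod_minus_minus_eq_zero hK hirr hf0 (Or.inr hl)) hf0
    (q := l) (fun i => by push_cast; ring) (by simp [hl]) (hf.pos _) hf.zero
    (fun m hm => hf.plus_of_nonneg m (by push_cast at hm; omega))
    (fun m hm => hf.pos _ m (by push_cast at hm; omega)) i

theorem IsHighestWeight.chain_zero_swap (hl : l = 0) (i : ℕ) :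
    modeChain (swap K .minus) (fun i => -2 * (i : ℤ) - 1) f i ≠ 0 ∧ ∀ m, -2 * (i : ℤ) - 1 < m →
      (swap K .minus).mode m (modeChain (swap K .minus) (fun i => -2 * (i : ℤ) - 1) f i) = 0 :=
  (hf.swap_of_eq_zero hl (hf.minus_eq_zero hK hirr hf0 hl)).chain_zero hK.swap hirr.swap hf0 hl i

/-- For the swapped currents f has weight -1/2, so the condition 2q - s 0 = 1 forces s 0 = -2. The
corresponding vanishing of K^+_m f begins at m = -1. -/
theorem IsHighestWeight.chain_half_swap (hl : l = 1 / 2) (i : ℕ) :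
    modeChain (swap K .minus) (fun i => -2 * (i : ℤ) - 2) f i ≠ 0 ∧ ∀ m, -2 * (i : ℤ) - 2 < m →
      (swap K .minus).mode m (modeChain (swap K .minus) (fun i => -2 * (i : ℤ) - 2) f i) = 0 := by
  refine extremal_chain hK.swap (fun N => ?_) hf0 (q := -l) (fun i => by push_cast; ring)
    (by simp [hl]; norm_num) (fun m hm => by simp [swap, hf.pos _ m hm]) (by simp [swap, hf.zero])
    (fun m hm => by simp [swap, hf.pos _ m (show 0 < m by push_cast at hm; omega)])
    (fun m hm => ?_) i
  · rw [show swap K .minus = -K .plus from rfl, neg_nprod_neg]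
    exact hf.nprod_plus_plus_eq_zero hK hirr hf0 (Or.inr hl) N
  · rw [show swap K .minus = -K .plus from rfl, neg_mode, LinearMap.neg_apply, neg_eq_zero]
    rcases (show -1 ≤ m by push_cast at hm; omega).eq_or_lt with rfl | hm
    · exact hf.plus_neg_one_eq_zero hK hirr hf0 hl
    · exact hf.plus_of_nonneg m (by omega)

end LevelOne

/-! ### The coset Virasoro field -/

section CosetVectors

open QField

variable {V H : Type*} [AddCommGroup V] [Module ℂ V] [AddCommGroup H] [Module ℂ H]

/-- Nonzero highest weight vectors for the total currents and the coset Virasoro field. -/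
structure IsCosetVector (k : ℂ) (J : Currents V) (K : Currents H) (l h : ℂ) (x : V ⊗[ℂ] H) :
    Prop where
  ne_zero : x ≠ 0
  hw : IsHighestWeight (totalCurrents J K) l x
  vir : ∀ m, 0 < m → cosetL k J K m x = 0
  weight : cosetL k J K 0 x = h • x

theorem IsCosetVector.smul {k : ℂ} {J : Currents V} {K : Currents H} {l h : ℂ} {x : V ⊗[ℂ] H}
    (hx : IsCosetVector k J K l h x) {c : ℂ} (hc : c ≠ 0) : IsCosetVector k J K l h (c • x) where
  ne_zero := smul_ne_zero hc hx.ne_zero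
  hw := ⟨fun a m hm => by rw [map_smul, hx.hw.pos a m hm, smul_zero],
    by rw [map_smul, hx.hw.plus, smul_zero], by rw [map_smul, hx.hw.zero, smul_comm]⟩
  vir m hm := by rw [map_smul, hx.vir m hm, smul_zero]
  weight := by rw [map_smul, hx.weight, smul_comm]

theorem cosetL_apply (k : ℂ) (J : Currents V) (K : Currents H) (n : ℤ) (x : V ⊗[ℂ] H) :
    cosetL k J K n x = ((sugawara k fun a => (J a).onLeft H).mode (n + 1) +
      (sugawara 1 (K.onRight V)).mode (n + 1)) x -
        (sugawara (k + 1) (totalCurrents J K)).mode (n + 1) x := by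
  rw [cosetL, cosetT, sub_mode, add_mode]
  rfl

theorem totalCurrents_swap (J : Currents V) (K : Currents H) :
    totalCurrents (swap J) (swap K) = swap (totalCurrents J K) := by
  funext a
  ext1; funext n
  cases a <;> simp [totalCurrents, swap, onLeft_neg, onRight_neg, add_comm]

theorem cosetL_swap (k : ℂ) (J : Currents V) (K : Currents H) (n : ℤ) :
    cosetL k (swap J) (swap K) n = cosetL k J K n := by
  refine LinearMap.ext fun x => ?_
  rw [cosetL_apply, cosetL_apply, totalCurrents_swap, sugawara_swap, swap_onLeft, sugawara_swap,
    swap_onRight, sugawara_swap]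

variable {F : FreeFields V} {K : Currents H} (hF : IsCCR F) (hK : IsAffine 1 K) {κ : ℂ}

include hF hK in
theorem isAffine_totalCurrents : IsAffine (level κ + 1) (totalCurrents (wakimoto κ F) K) := by
  have h := ((hF.onLeft (H := H)).isAffine κ).add (hK.onRight (V := V))
    ((fieldsCommute_onLeft_onRight F K).wakimoto κ)
  rw [← wakimoto_onLeft] at h
  exact h

theorem totalCurrents_wakimoto_mode (a : SlIdx) (m : ℤ) :
    (totalCurrents (wakimoto κ F) K a).mode m =
      (wakimoto κ (F.onLeft H) a).mode m + (K.onRight V a).mode m := by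
  rw [← wakimoto_onLeft]
  rfl

/-- L_n is mode n + 1 of the Sugawara fields. T^J + T^K is known on top vectors, and the total
Sugawara field acts by its highest weight value, with denominator (k + 1) + 2. -/
theorem IsTop.cosetL_apply {t : ℤ} {l h l' : ℂ} {x : V ⊗[ℂ] H}
    (hx : IsTop κ (F.onLeft H) (K.onRight V) t l h x)
    (hpos : ∀ N, 1 < N → (sugawara (level κ + 1) (totalCurrents (wakimoto κ F) K)).mode N x = 0)
    (hzero : (sugawara (level κ + 1) (totalCurrents (wakimoto κ F) K)).mode 1 x =
      (l' * (l' + 1) / (level κ + 1 + 2)) • x) :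
    (∀ m, 0 < m → cosetL (level κ) (wakimoto κ F) K m x = 0) ∧
      cosetL (level κ) (wakimoto κ F) K 0 x = (h - l' * (l' + 1) / (level κ + 3)) • x := by
  constructor
  · intro m hm
    rw [AffineCoset.cosetL_apply, hpos _ (by omega), wakimoto_onLeft, hx.vir _ (by omega), sub_zero]
  · rw [AffineCoset.cosetL_apply, zero_add, hzero, wakimoto_onLeft, hx.vir_weight, ← sub_smul,
      show level κ + 1 + 2 = level κ + 3 by ring]

include hF hK

theorem IsTop.isCosetVector {l h : ℂ} {x : V ⊗[ℂ] H}
    (hx : IsTop κ (F.onLeft H) (K.onRight V) 0 l h x) (hx0 : x ≠ 0) :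
    IsCosetVector (level κ) (wakimoto κ F) K l (h - l * (l + 1) / (level κ + 3)) x := by
  have hw : IsHighestWeight (totalCurrents (wakimoto κ F) K) l x := by
    refine ⟨fun a m hm => ?_, ?_, ?_⟩
    · rw [totalCurrents_wakimoto_mode]
      cases a
      · exact hx.plus m hm.le
      · exact hx.zero m hm
      · exact hx.minus m (by omega)
    · rw [totalCurrents_wakimoto_mode]; exact hx.plus 0 le_rfl
    · rw [totalCurrents_wakimoto_mode]; exact hx.weight
  have hA := isAffine_totalCurrents hF hK (κ := κ)
  obtain ⟨h1, h2⟩ := hx.cosetL_apply (fun N hN => hw.sugawara_pos hA hN) (hw.sugawara_zero hA)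
  exact ⟨hx0, hw, h1, h2⟩

theorem IsTop.isCosetVector_swap {l h : ℂ} {x : V ⊗[ℂ] H}
    (hx : IsTop κ (F.onLeft H) (K.onRight V) 1 l h x) (hx0 : x ≠ 0) :
    IsCosetVector (level κ) (swap (wakimoto κ F)) (swap K) (-l)
      (h - -l * (-l + 1) / (level κ + 3)) x := by
  have hw : IsHighestWeight (swap (totalCurrents (wakimoto κ F) K)) (-l) x := by
    refine ⟨fun a m hm => ?_, ?_, ?_⟩
    · cases a <;> simp only [swap, neg_mode, totalCurrents_wakimoto_mode, LinearMap.neg_apply,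
        neg_eq_zero]
      · exact hx.minus m (by omega)
      · exact hx.zero m hm
      · exact hx.plus m (by omega)
    · simp only [swap, neg_mode, totalCurrents_wakimoto_mode]
      rw [LinearMap.neg_apply, hx.minus 0 (by omega), neg_zero]
    · simp only [swap, neg_mode, totalCurrents_wakimoto_mode]
      rw [LinearMap.neg_apply, hx.weight, neg_smul]
  have hA := (isAffine_totalCurrents hF hK (κ := κ)).swap
  obtain ⟨h1, h2⟩ := hx.cosetL_apply
    (fun N hN => by rw [← sugawara_swap]; exact hw.sugawara_pos hA hN)
    (by rw [← sugawara_swap]; exact hw.sugawara_zero hA)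
  refine ⟨hx0, by rwa [totalCurrents_swap], ?_, ?_⟩
  · simpa only [cosetL_swap] using h1
  · simpa only [cosetL_swap] using h2

/-- The vectors generated by `ρ` from a highest weight vector. -/
theorem IsTop.rhoChain (hκ : κ ≠ 0) {t : ℤ} (ht : 0 ≤ t) {α l h : ℂ} {w : V} {f : H}
    (hw : IsVacuum F t α w)
    (hφ : ∃ φ : V →ₗ[ℂ] ℂ, (∀ p, p < -t → ∀ v, φ (F.gamma.mode p v) = 0) ∧ φ w = 1)
    (hx : IsTop κ (F.onLeft H) (K.onRight V) t l h (w ⊗ₜ f)) {s : ℕ → ℤ}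
    (hf : ∀ m, t ≤ m → (K .plus).mode m f = 0)
    (hs : ∀ i, modeChain (K .minus) s f i ≠ 0 ∧
      ∀ m, s i < m → (K .minus).mode m (modeChain (K .minus) s f i) = 0) (n : ℕ) :
    IsTop κ (F.onLeft H) (K.onRight V) t (l - n) (h - ∑ i ∈ Finset.range n, (s i : ℂ))
        (modeChain (rhoField (F.gamma.onLeft H) (K.onRight V)) s (w ⊗ₜ f) n) ∧
      modeChain (rhoField (F.gamma.onLeft H) (K.onRight V)) s (w ⊗ₜ f) n ≠ 0 := by
  obtain ⟨φ, hφ, hφw⟩ := hφ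
  refine ⟨hx.chain hF.onLeft hK.onRight (fieldsCommute_onLeft_onRight F K) hκ ht
    (rho_rhoChain_eq_zero hF hK hw ht hφ hφw s hf fun i => (hs i).2) n, fun h0 => ?_⟩
  have := contractLeft_rhoChain hF (K := K) hw ht hφ hφw s (f := f) n
  have h0' : modeChain (rhoField (F.onLeft H).gamma (K.onRight V)) s (w ⊗ₜ f) n = 0 := h0
  rw [h0', map_zero] at this
  exact smul_ne_zero (pow_ne_zero n (neg_ne_zero.2 one_ne_zero)) (hs n).1 this.symm

end CosetVectors

/-! ### The initial vectors and the final weights -/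

theorem modeChain_neg {V : Type*} [AddCommGroup V] [Module ℂ V] (R : QField V) (s : ℕ → ℤ) (v : V)
    (n : ℕ) : modeChain (-R) s v n = (-1 : ℂ) ^ n • modeChain R s v n := by
  induction n with
  | zero => simp [modeChain]
  | succ n ih =>
    rw [modeChain, modeChain, ih, map_smul, QField.neg_mode, LinearMap.neg_apply, pow_succ]
    module

theorem IsVacuum.onLeft {V : Type*} [AddCommGroup V] [Module ℂ V] {F : FreeFields V} {t : ℤ} {α : ℂ}
    {w : V} (hw : IsVacuum F t α w) {H : Type*} [AddCommGroup H] [Module ℂ H] (f : H) :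
    IsVacuum (F.onLeft H) t α (w ⊗ₜ f) where
  gamma p hp := by simp [FreeFields.onLeft, QField.onLeft_mode, hw.gamma p hp]
  beta p hp := by simp [FreeFields.onLeft, QField.onLeft_mode, hw.beta p hp]
  dphi p hp := by simp [FreeFields.onLeft, QField.onLeft_mode, hw.dphi p hp]
  dphi_zero := by
    simp [FreeFields.onLeft, QField.onLeft_mode, hw.dphi_zero, TensorProduct.smul_tmul']

theorem IsHighestWeight.onRight {H : Type*} [AddCommGroup H] [Module ℂ H] {K : Currents H} {l : ℂ}
    {f : H} (hf : IsHighestWeight K l f) {V : Type*} [AddCommGroup V] [Module ℂ V] (w : V) :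
    IsHighestWeight (K.onRight V) l (w ⊗ₜ f) where
  pos a m hm := by simp [QField.onRight_mode, hf.pos a m hm]
  plus := by simp [QField.onRight_mode, hf.plus]
  zero := by simp [QField.onRight_mode, hf.zero]

theorem sum_range_neg_two_mul_sub (c : ℤ) (n : ℕ) :
    ∑ i ∈ Finset.range n, ((-2 * (i : ℤ) - c : ℤ) : ℂ) = -(n * (n - 1)) - n * c := by
  induction n with
  | zero => simp
  | succ n ih => rw [Finset.sum_range_succ, ih]; push_cast; ring

theorem isCosetVector_wVec {κ : ℂ} (hκ : κ ≠ 0) (j : ℂ) (ε : Eps) (n : ℕ) :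
    IsCosetVector (level κ) (wakimoto κ (fockFields κ j)) (irrCurrents 1 ε.val) (j + ε.val - n)
      (cosetWeight (level κ) j ε.val (-n)) (wVec κ j ε n) := by
  have hF := isCCR_fockFields κ j
  have hw := isVacuum_fockVec κ j
  have hK := isAffine_irrCurrents 1 ε.val
  have hirr := isIrr_irrCurrents 1 ε.val
  have hf := isHighestWeight_irrVec 1 ε.val
  have hf0 := irrVec_ne_zero ε.val
  have htop := isTop_of_isHighestWeight hF.onLeft hK.onRight (hw.onLeft (irrVec 1 ε.val))
    (mul_inv_cancel_left₀ hκ j) (hf.onRight (fockVec κ j))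
  cases ε
  · obtain ⟨h1, h2⟩ := htop.rhoChain hF hK hκ le_rfl hw (exists_fock_functional κ j)
      hf.plus_of_nonneg (hf.chain_zero hK hirr hf0 rfl) n
    have h := h1.isCosetVector hF hK h2
    rw [wVec, rho_eq]
    convert h using 1
    -- The term ε(ε + 1)/3 from T^K equals ε² for both values of ε. Together with the sum of the -s
    -- i it completes the square (ε - n)², here n².
    rw [sum_range_neg_two_mul_sub, cosetWeight, Eps.val]
    push_cast
    ring
  · obtain ⟨h1, h2⟩ := htop.rhoChain hF hK hκ le_rfl hw (exists_fock_functional κ j)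
      hf.plus_of_nonneg (hf.chain_half hK hirr hf0 rfl) n
    have h := h1.isCosetVector hF hK h2
    rw [wVec, rho_eq]
    refine IsCosetVector.smul ?_ (pow_ne_zero n (neg_ne_zero.2 one_ne_zero))
    convert h using 1
    have hsum := sum_range_neg_two_mul_sub 0 n
    simp only [sub_zero] at hsum
    rw [hsum, cosetWeight, Eps.val]
    push_cast
    ring

theorem isCosetVector_wVecDual {κ : ℂ} (hκ : κ ≠ 0) (j : ℂ) (ε : Eps) (n : ℕ) :
    IsCosetVector (level κ) (dualWakimoto κ (dualFockFields κ j)) (irrCurrents 1 ε.val)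
      (j + ε.val + n) (cosetWeight (level κ) j ε.val n) (wVecDual κ j ε n) := by
  have hF := isCCR_dualFockFields κ j
  have hw := isVacuum_dualFockVec κ j
  have hK := isAffine_irrCurrents 1 ε.val
  have hirr := isIrr_irrCurrents 1 ε.val
  have hf := isHighestWeight_irrVec 1 ε.val
  have hf0 := irrVec_ne_zero ε.val
  have hp : ∀ m, 1 ≤ m → (swap (irrCurrents 1 ε.val) .plus).mode m (irrVec 1 ε.val) = 0 :=
    fun m hm => by simp [swap, hf.pos _ m (show 0 < m by omega)]
  -- The dual case runs with the swapped K as level-one currents; swapping once more gives back K,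
  -- for which f is a highest weight vector.
  have hKv : IsHighestWeight (swap ((swap (irrCurrents 1 ε.val)).onRight (DualFock κ j))) ε.val
      (dualFockVec κ j ⊗ₜ irrVec 1 ε.val) := by
    rw [← swap_onRight, swap_swap]
    exact hf.onRight _
  have htop := isTop_of_isHighestWeight_swap hF.onLeft hK.swap.onRight
    (hw.onLeft (irrVec 1 ε.val)) (j := j) (by field_simp; ring) hKv
  rw [dualWakimoto_eq]
  cases ε
  · obtain ⟨h1, h2⟩ := htop.rhoChain hF hK.swap hκ zero_le_one hw (exists_dualFock_functional κ j)
      hp (hf.chain_zero_swap hK hirr hf0 rfl) n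
    have h := h1.isCosetVector_swap hF hK.swap h2
    rw [swap_swap] at h
    rw [wVecDual, rhoTilde_eq, modeChain_neg]
    refine IsCosetVector.smul ?_ (pow_ne_zero n (neg_ne_zero.2 one_ne_zero))
    convert h using 1
    · ring
    · rw [sum_range_neg_two_mul_sub, cosetWeight, Eps.val]
      push_cast
      ring
  · obtain ⟨h1, h2⟩ := htop.rhoChain hF hK.swap hκ zero_le_one hw (exists_dualFock_functional κ j)
      hp (hf.chain_half_swap hK hirr hf0 rfl) n
    have h := h1.isCosetVector_swap hF hK.swap h2
    rw [swap_swap] at h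
    rw [wVecDual, rhoTilde_eq, modeChain_neg]
    refine IsCosetVector.smul (IsCosetVector.smul ?_ ?_) ?_
    · convert h using 1
      · ring
      -- The indices -2i - 2 contribute n² + n, which with ε² = 1/4 gives (n + 1/2)².
      · rw [sum_range_neg_two_mul_sub, cosetWeight, Eps.val]
        push_cast
        ring
    · exact pow_ne_zero n (neg_ne_zero.2 one_ne_zero)
    · exact pow_ne_zero n (neg_ne_zero.2 one_ne_zero)

end AffineCoset

end

theorem mainTheorem4 (κ j : ℂ) (hκ : κ ≠ 0) (hκ3 : level κ ≠ -3) (ε : Eps) (n : ℕ) :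
    (wVec κ j ε n ≠ 0 ∧
      (∀ (a : SlIdx) (m : ℤ), 0 < m → (calJ κ j ε a).mode m (wVec κ j ε n) = 0) ∧
      (∀ m : ℤ, 0 < m → LVir κ j ε m (wVec κ j ε n) = 0) ∧
      (calJ κ j ε .plus).mode 0 (wVec κ j ε n) = 0 ∧
      (calJ κ j ε .zero).mode 0 (wVec κ j ε n) = (j + ε.val - n) • wVec κ j ε n ∧
      LVir κ j ε 0 (wVec κ j ε n) = cosetWeight (level κ) j ε.val (-n) • wVec κ j ε n) ∧
    (wVecDual κ j ε n ≠ 0 ∧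
      (∀ (a : SlIdx) (m : ℤ), 0 < m → (calJDual κ j ε a).mode m (wVecDual κ j ε n) = 0) ∧
      (∀ m : ℤ, 0 < m → LVirDual κ j ε m (wVecDual κ j ε n) = 0) ∧
      (calJDual κ j ε .plus).mode 0 (wVecDual κ j ε n) = 0 ∧
      (calJDual κ j ε .zero).mode 0 (wVecDual κ j ε n) = (j + ε.val + n) • wVecDual κ j ε n ∧
      LVirDual κ j ε 0 (wVecDual κ j ε n) =
        cosetWeight (level κ) j ε.val n • wVecDual κ j ε n) := by
  have h := isCosetVector_wVec hκ j ε n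
  have h' := isCosetVector_wVecDual hκ j ε n
  exact ⟨⟨h.ne_zero, h.hw.pos, h.vir, h.hw.plus, h.hw.zero, h.weight⟩,
    ⟨h'.ne_zero, h'.hw.pos, h'.vir, h'.hw.plus, h'.hw.zero, h'.weight⟩⟩
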